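/- Let $d\ge 1$ be an integer, $\alpha>-1/2$, and $\mathbb{R}^{d+1}_+=\mathbb{R}^d\times(0,\infty)$; write $x=(x',x_{d+1})$ with $x'\in\mathbb{R}^d$. Put $d\mu_\alpha(x)=x_{d+1}^{2\alpha+1}\,dx$ on $\mathbb{R}^{d+1}_+$, $S^d_+=\{x\in\mathbb{R}^{d+1}_+:\|x\|=1\}$, and $d\sigma_\alpha(t)=t_{d+1}^{2\alpha+1}\,d\sigma(t)$ with $\sigma$ the surface measure of the unit sphere. Let $$j_\alpha(z)=\Gamma(\alpha+1)\sum_{k=0}^\infty\frac{(-1)^k z^{2k}}{2^{2k}\,k!\,\Gamma(\alpha+k+1)},\qquad \mathcal{F}_{W,\alpha}(\varphi)(\xi)=\int_{\mathbb{R}^{d+1}_+}\varphi(x)\,e^{-i\langle x',\xi'\rangle}j_\alpha(x_{d+1}\xi_{d+1})\,d\mu_\alpha(x)$$ (the Weinstein transform). For an integer $l\ge 0$ let $\mathcal{H}^\alpha_l$ be the space of homogeneous polynomials $P$ of degree $l$ on $\mathbb{R}^{d+1}$, with complex coefficients, that are even in $x_{d+1}$ and satisfy $$\sum_{j=1}^{d+1}\frac{\partial^2P}{\partial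 x_j^2}+\frac{2\alpha+1}{x_{d+1}}\frac{\partial P}{\partial x_{d+1}}=0\quad\text{on }\mathbb{R}^{d+1}_+ .$$ For $P_l\in\mathcal{H}^\alpha_l$ the corresponding Weinstein spherical harmonic coefficient of $\varphi$ is $$\Phi_{l,\alpha}(\lambda)=\lambda^{-l}\int_{S^d_+}\mathcal{F}_{W,\alpha}(\varphi)(\lambda t)\,P_l(t)\,d\sigma_\alpha(t),\qquad\lambda>0 .$$ **Theorem.** Let $\varphi$ be a complex-valued Schwartz function on $\mathbb{R}^{d+1}$ that is even in the last variable, and let $R>0$. Then $\varphi$ is supported in $\{x:\|x\|<R\}$, in the sense that $\varphi(x)=0$ whenever $\|x\|\ge R$, if and only if for every integer $l\ge 0$ and every $P_l\in\mathcal{H}^\alpha_l$ the function $\Phi_{l,\alpha}$ extends from $(0,\infty)$ to an entire function of $\lambda\in\mathbb{C}$ for which there is a constant $c_{l,\alpha}$ (which may depend on $\varphi$, $R$ and $P_l$, but not on $\lambda$) with $$|\Phi_{l,\alpha}(\lambda)|\le c_{l,\alpha}\,e^{R|\operatorname{Im}\lambda|}\qquad\text{for all }\lambda\in\mathbb{C}.$$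 -/

import Mathlib

open MeasureTheory Complex
open scoped SchwartzMap

noncomputable section

namespace Weinstein

/-- Euclidean space of dimension `d + 1`; the distinguished last coordinate is `Fin.last d`. -/
abbrev Space (d : ℕ) : Type := EuclideanSpace ℝ (Fin (d + 1))

/-- The open half-space where the last coordinate is positive. -/
def halfSpace (d : ℕ) : Set (Space d) := {x | 0 < x (Fin.last d)}

/-- The reflection `(x', s) ↦ (x', -s)` in the last coordinate. -/
def reflectLast {d : ℕ} (x : Space d) : Space d :=
  WithLp.toLp 2 (Function.update x.ofLp (Fin.last d) (-x (Fin.last d)))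

/-- Functions that are even with respect to the last variable. -/
def EvenInLast {d : ℕ} (u : Space d → ℂ) : Prop := ∀ x, u (reflectLast x) = u x

/-- The measure `x_{d+1}^(2α+1) dx` on the half-space. -/
def weightedMeasure (d : ℕ) (α : ℝ) : Measure (Space d) :=
  ((volume : Measure (Space d)).restrict (halfSpace d)).withDensity
    (fun x => ENNReal.ofReal (x (Fin.last d) ^ (2 * α + 1)))

/-- The measure `t_{d+1}^(2α+1) dσ(t)` on the open upper half of the unit sphere, where `σ` is
the surface measure of the unit sphere. -/
def sphereMeasure (d : ℕ) (α : ℝ) : Measure (Metric.sphere (0 : Space d) 1) :=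
  ((volume : Measure (Space d)).toSphere.restrict
      {t | (t : Space d) ∈ halfSpace d}).withDensity
    (fun t => ENNReal.ofReal ((t : Space d) (Fin.last d) ^ (2 * α + 1)))

/-- The normalized Bessel function `j_α`, with `j_α 0 = 1`. -/
def normalizedBessel (α : ℝ) (z : ℂ) : ℂ :=
  (Real.Gamma (α + 1) : ℂ) *
    ∑' k : ℕ, (-1) ^ k * z ^ (2 * k) /
      (2 ^ (2 * k) * (k.factorial : ℂ) * (Real.Gamma (α + k + 1) : ℂ))

/-- The Weinstein kernel `exp(-i ⟨x', ξ'⟩) j_α(x_{d+1} ξ_{d+1})`. -/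
def kernel {d : ℕ} (α : ℝ) (ξ : Fin (d + 1) → ℂ) (x : Space d) : ℂ :=
  cexp (-I * ∑ j : Fin d, (x j.castSucc : ℂ) * ξ j.castSucc) *
    normalizedBessel α ((x (Fin.last d) : ℂ) * ξ (Fin.last d))

/-- The Weinstein transform. -/
def transform {d : ℕ} (α : ℝ) (φ : Space d → ℂ) (ξ : Space d) : ℂ :=
  ∫ x, φ x * kernel α (fun j => (ξ j : ℂ)) x ∂(weightedMeasure d α)

/-- The partial derivative in the `j`-th coordinate direction. -/
def partialDeriv {d : ℕ} (j : Fin (d + 1)) (u : Space d → ℂ) (x : Space d) : ℂ :=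
  fderiv ℝ u x (EuclideanSpace.single j 1)

/-- The Weinstein operator
`∑_{j ≤ d+1} ∂_j² u + ((2α+1) / x_{d+1}) ∂_{d+1} u`, considered on the half-space. -/
def weinsteinOperator {d : ℕ} (α : ℝ) (u : Space d → ℂ) (x : Space d) : ℂ :=
  (∑ j : Fin (d + 1), partialDeriv j (partialDeriv j u) x) +
    (((2 * α + 1) / x (Fin.last d) : ℝ) : ℂ) * partialDeriv (Fin.last d) u x

/-- The function on Euclidean space defined by a polynomial with complex coefficients. -/
def polyFun {d : ℕ} (P : MvPolynomial (Fin (d + 1)) ℂ) (x : Space d) : ℂ :=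
  MvPolynomial.eval (fun j => (x j : ℂ)) P

/-- Generalized spherical harmonics of degree `l`: homogeneous polynomials of degree `l`, even in
the last variable, annihilated by the Weinstein operator on the half-space. -/
def sphericalHarmonics (d : ℕ) (α : ℝ) (l : ℕ) : Set (MvPolynomial (Fin (d + 1)) ℂ) :=
  {P | P.IsHomogeneous l ∧ EvenInLast (polyFun P) ∧
    ∀ x ∈ halfSpace d, weinsteinOperator α (polyFun P) x = 0}

/-- The Weinstein spherical harmonic coefficient of `φ` with respect to `P` of degree `l`, at a
radius `r > 0`. -/
def harmonicCoeff {d : ℕ} (α : ℝ) (l : ℕ) (P : MvPolynomial (Fin (d + 1)) ℂ)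
    (φ : Space d → ℂ) (r : ℝ) : ℂ :=
  ((r : ℂ) ^ l)⁻¹ * ∫ t : Metric.sphere (0 : Space d) 1,
    transform α φ (r • (t : Space d)) * polyFun P (t : Space d) ∂(sphereMeasure d α)

end Weinstein

end

noncomputable section

namespace Weinstein

/-! ### The normalized Bessel function -/

/-! Write Δ for the Weinstein operator, K for the kernel, μ and σ for the weighted measures, and
call even homogeneous polynomials killed by Δ harmonic.

Support implies growth. If φ vanishes for ‖x‖ ≥ R, then g(z) = ∫∫ φ(x) K(zt, x) P(t) dσ(t) dμ(x) is
entire and O(e^{R|Im z|}), because |K(zt, x)| ≤ e^{‖x‖‖t‖|Im z|} (`norm_kernel_le`). A harmonic P of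
degree l is orthogonal on the half-sphere to even polynomials of lower degree
(`sphere_integral_mul_harmonic_eq_zero`), so g vanishes to order l at 0, and g/z^l is the required
extension (`exists_entire_extension`).

Growth implies support, without inverting the transform. By the Hecke identity
(`integral_kernel_mul_harmonic_mul_gauss`) the transform of P e^{-‖x‖²} is (HP)(y) e^{-‖y‖²/4},
where H is a bijection of the harmonic polynomials of degree l. Fubini and polar coordinates then
express ∫ φ · HP · e^{-w²‖x‖²} dμ, for w > 0, as a Gaussian average of Φ(2wτ) over τ
(`integral_harmonicCoeff_mul_gauss`). Replacing Φ by its entire extension gives an entire function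
E(w) that is O(e^{S(Im w)²}) for every S > R². For T > S, multiply E by e^{Tw²} and subtract the
part of the integral over ‖x‖² ≤ T. The result is bounded near the real axis because it is an
integral over ‖x‖² > T, and near the imaginary axis by Phragmén–Lindelöf. By Liouville it is
constant, and its limit along the reals is 0 (`setIntegral_eq_zero_of_gaussAverage_bound`). Thus
φQe^{-‖x‖²} has integral 0 over ‖x‖² > T for all harmonic Q and T > R². Differentiating in T shows
that φ(r·) is orthogonal to all harmonic Q on the half-sphere when r > R. Every even polynomial
agrees on the sphere with a sum of harmonic ones, and these are dense, so φ vanishes there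
(`eq_zero_of_setIntegral_harmonic_eq_zero`).

The algebra rests on `gaussIntegral_green`, a Green identity for the Gaussian weight checked on
monomials by the recursion of Gaussian moments. With positivity of the pairing it gives
orthogonality, the Hecke identity, bijectivity of H and the harmonic decomposition. -/

open ProbabilityTheory in
lemma pow_mul_betaPDFReal {a b : ℝ} (ha : 0 < a) (hb : 0 < b) (k : ℕ) (x : ℝ) :
    betaPDFReal a b x * x ^ k =
      beta (a + k) b / beta a b * betaPDFReal (a + k) b x := by
  unfold betaPDFReal
  split_ifs with h
  · have h1 := (beta_pos ha hb).ne'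
    have h2 := (beta_pos (α := a + k) (β := b) (by positivity) hb).ne'
    rw [show a + k - 1 = (a - 1) + k by ring, Real.rpow_add_natCast h.1.ne']
    field_simp
  · simp

open ProbabilityTheory in
lemma integral_betaMeasure {E : Type*} [NormedAddCommGroup E] [NormedSpace ℝ E] {a b : ℝ}
    (ha : 0 < a) (hb : 0 < b) (f : ℝ → E) :
    ∫ x, f x ∂(betaMeasure a b) = ∫ x, betaPDFReal a b x • f x := by
  have h0 : ∀ x, 0 ≤ betaPDFReal a b x := by
    intro x
    by_cases h : 0 < x ∧ x < 1
    · exact (betaPDFReal_pos h.1 h.2 ha hb).le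
    · simp [betaPDFReal, h]
  rw [betaMeasure, integral_withDensity_eq_integral_toReal_smul]
  · simp [betaPDF, ENNReal.toReal_ofReal (h0 _)]
  · exact (measurable_betaPDFReal a b).ennreal_ofReal
  · simp [betaPDF]

open ProbabilityTheory in
lemma integral_betaPDFReal {a b : ℝ} (ha : 0 < a) (hb : 0 < b) :
    ∫ x, betaPDFReal a b x = 1 := by
  have := isProbabilityMeasureBeta ha hb
  have h := integral_betaMeasure ha hb (fun _ => (1 : ℝ))
  simpa using h.symm

open ProbabilityTheory in
lemma integral_pow_betaMeasure {a b : ℝ} (ha : 0 < a) (hb : 0 < b) (k : ℕ) :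
    ∫ x, x ^ k ∂(betaMeasure a b) = beta (a + k) b / beta a b := by
  rw [integral_betaMeasure ha hb]
  simp only [smul_eq_mul, pow_mul_betaPDFReal ha hb]
  rw [integral_const_mul, integral_betaPDFReal (by positivity) hb, mul_one]

/-- The duplication formula at half-integers, by Γ(s+1) = sΓ(s). Γ(1/2) stays unevaluated because it
cancels in the ratio of Beta functions. -/
lemma gamma_nat_add_half_eq (k : ℕ) :
    Real.Gamma (1 / 2 + k) * (2 ^ (2 * k) * k.factorial) =
      (2 * k).factorial * Real.Gamma (1 / 2) := by
  induction k with
  | zero => simp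
  | succ k ih =>
    have : (1 / 2 + ((k + 1 : ℕ) : ℝ)) = (1 / 2 + k) + 1 := by push_cast; ring
    rw [this, Real.Gamma_add_one (by positivity), show 2 * (k + 1) = 2 * k + 1 + 1 by ring,
      Nat.factorial_succ, Nat.factorial_succ, Nat.factorial_succ]
    push_cast
    linear_combination (2 * (2 * k + 1) * (k + 1) : ℝ) * ih

open ProbabilityTheory in
-- The moments of the Beta(1/2, α+1/2) law are the Bessel coefficients up to sign and the factor
-- (2k)! of the cosine series. The condition α > -1/2 is positivity of the second parameter.
lemma beta_ratio_eq {α : ℝ} (hα : -1 / 2 < α) (k : ℕ) :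
    beta (1 / 2 + k) (α + 1 / 2) / beta (1 / 2) (α + 1 / 2) =
      (2 * k).factorial *
        (Real.Gamma (α + 1) / (2 ^ (2 * k) * k.factorial * Real.Gamma (α + k + 1))) := by
  unfold beta
  have e1 : (1 / 2 + k + (α + 1 / 2) : ℝ) = α + k + 1 := by ring
  have e2 : (1 / 2 + (α + 1 / 2) : ℝ) = α + 1 := by ring
  rw [e1, e2]
  have h1 := (Real.Gamma_pos_of_pos (show (0 : ℝ) < 1 / 2 by norm_num)).ne'
  have hk : (0 : ℝ) ≤ k := Nat.cast_nonneg k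
  have h2 := (Real.Gamma_pos_of_pos (show (0 : ℝ) < α + 1 / 2 by linarith)).ne'
  have h3 := (Real.Gamma_pos_of_pos (show (0 : ℝ) < α + 1 by linarith)).ne'
  have h4 := (Real.Gamma_pos_of_pos (show (0 : ℝ) < α + k + 1 by linarith)).ne'
  have h5 : (k.factorial : ℝ) ≠ 0 := by positivity
  have := gamma_nat_add_half_eq k
  generalize Real.Gamma (1 / 2 + k) = A at *
  generalize Real.Gamma (1 / 2) = B at *
  generalize Real.Gamma (α + 1 / 2) = C at *
  field_simp
  linear_combination this

/-- The Taylor coefficients of the normalized Bessel function. -/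
def besselCoeff (α : ℝ) (n : ℕ) : ℂ :=
  if Even n then
    (-1) ^ (n / 2) *
      ((Real.Gamma (α + 1) /
        (2 ^ n * (n / 2).factorial * Real.Gamma (α + (n / 2 : ℕ) + 1)) : ℝ) : ℂ)
  else 0

lemma besselCoeff_odd (α : ℝ) (k : ℕ) : besselCoeff α (2 * k + 1) = 0 := by
  simp [besselCoeff, Nat.not_even_bit1]

open ProbabilityTheory in
lemma besselCoeff_even {α : ℝ} (hα : -1 / 2 < α) (k : ℕ) :
    besselCoeff α (2 * k) =
      (-1) ^ k / ((2 * k).factorial : ℂ) *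
        ((∫ x, x ^ k ∂(betaMeasure (1 / 2) (α + 1 / 2)) : ℝ) : ℂ) := by
  rw [integral_pow_betaMeasure (by norm_num) (by linarith), beta_ratio_eq hα]
  have : ((2 * k).factorial : ℂ) ≠ 0 := by exact_mod_cast (Nat.factorial_ne_zero _)
  simp only [besselCoeff, even_two, Even.mul_right, if_true]
  rw [show 2 * k / 2 = k by omega]
  push_cast
  field_simp

lemma besselCoeff_zero {α : ℝ} (hα : -1 / 2 < α) : besselCoeff α 0 = 1 := by
  have h3 := (Real.Gamma_pos_of_pos (show (0 : ℝ) < α + 1 by linarith)).ne'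
  simp [besselCoeff]
  exact_mod_cast h3

/-- The equation j'' + ((2α+1)/z) j' = -j, read on Taylor coefficients. -/
lemma besselCoeff_rec {α : ℝ} (hα : -1 / 2 < α) (n : ℕ) :
    besselCoeff α (n + 2) * ((n + 2) * (n + 1 + (2 * α + 1))) = -besselCoeff α n := by
  rcases Nat.even_or_odd' n with ⟨k, rfl | rfl⟩
  · have hk : (0 : ℝ) ≤ k := Nat.cast_nonneg k
    simp only [besselCoeff, Nat.even_add, even_two, Even.mul_right, if_true]
    rw [show (2 * k + 2) / 2 = k + 1 by omega, show 2 * k / 2 = k by omega,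
      Nat.factorial_succ]
    have e : α + ((k + 1 : ℕ) : ℝ) + 1 = (α + k + 1) + 1 := by push_cast; ring
    have h0 : α + k + 1 ≠ 0 := by linarith
    rw [e, Real.Gamma_add_one h0]
    have h4 := (Real.Gamma_pos_of_pos (show (0 : ℝ) < α + k + 1 by linarith)).ne'
    have h4' : (Real.Gamma (α + k + 1) : ℂ) ≠ 0 := by exact_mod_cast h4
    have h5 : (k.factorial : ℂ) ≠ 0 := by exact_mod_cast Nat.factorial_ne_zero _
    have h0' : (α + k + 1 : ℂ) ≠ 0 := by exact_mod_cast h0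
    have h6 : (k + 1 : ℂ) ≠ 0 := by exact_mod_cast Nat.succ_ne_zero k
    push_cast
    field_simp
    ring
  · rw [show 2 * k + 1 + 2 = 2 * (k + 1) + 1 by ring, besselCoeff_odd, besselCoeff_odd]
    simp

lemma besselCoeff_ne_zero {α : ℝ} (hα : -1 / 2 < α) (k : ℕ) : besselCoeff α (2 * k) ≠ 0 := by
  induction k with
  | zero => simp [besselCoeff_zero hα]
  | succ k ih =>
    intro h
    have := besselCoeff_rec hα (2 * k)
    rw [show 2 * k + 2 = 2 * (k + 1) by ring, h] at this
    simp [ih] at this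

open ProbabilityTheory in
lemma ae_mem_Ioo_betaMeasure (a b : ℝ) : ∀ᵐ x ∂(betaMeasure a b), x ∈ Set.Ioo (0 : ℝ) 1 := by
  rw [betaMeasure, ae_withDensity_iff (show Measurable (betaPDF a b) from
    (measurable_betaPDFReal a b).ennreal_ofReal)]
  refine Filter.Eventually.of_forall fun x hx => ?_
  by_contra h
  exact hx (by simp only [betaPDF_eq]; rw [if_neg (by simpa using h)]; simp)

open ProbabilityTheory in
-- Moments of a probability measure on (0,1) are at most 1, so the exponential series dominates
-- uniformly in α.
lemma norm_besselCoeff_le {α : ℝ} (hα : -1 / 2 < α) (n : ℕ) :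
    ‖besselCoeff α n‖ ≤ ((n.factorial : ℝ))⁻¹ := by
  rcases Nat.even_or_odd' n with ⟨k, rfl | rfl⟩
  · rw [besselCoeff_even hα]
    have := isProbabilityMeasureBeta (α := 1 / 2) (β := α + 1 / 2) (by norm_num) (by linarith)
    have h1 : ‖∫ x, x ^ k ∂(betaMeasure (1 / 2) (α + 1 / 2))‖ ≤
        1 * (betaMeasure (1 / 2) (α + 1 / 2)).real Set.univ := by
      apply norm_integral_le_of_norm_le_const
      filter_upwards [ae_mem_Ioo_betaMeasure (1 / 2) (α + 1 / 2)] with x hx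
      rw [norm_pow, Real.norm_of_nonneg hx.1.le]
      exact pow_le_one₀ hx.1.le hx.2.le
    simp only [probReal_univ, mul_one] at h1
    rw [norm_mul, norm_div, norm_pow, norm_neg, norm_one, one_pow, Complex.norm_natCast,
      Complex.norm_real, one_div]
    exact mul_le_of_le_one_right (by positivity) h1
  · rw [besselCoeff_odd]
    simp

lemma summable_besselCoeff_mul_pow {α : ℝ} (hα : -1 / 2 < α) (z : ℂ) :
    Summable fun n => ‖besselCoeff α n * z ^ n‖ := by
  refine Summable.of_nonneg_of_le (fun _ => norm_nonneg _) (fun n => ?_)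
    (Real.summable_pow_div_factorial ‖z‖)
  rw [norm_mul, norm_pow, div_eq_inv_mul]
  gcongr
  exact norm_besselCoeff_le hα n

lemma summable_even_besselCoeff {α : ℝ} (hα : -1 / 2 < α) (z : ℂ) :
    Summable fun k => besselCoeff α (2 * k) * z ^ (2 * k) := by
  have hinj : Function.Injective (fun k : ℕ => 2 * k) := fun a b h => by simpa using h
  exact (summable_besselCoeff_mul_pow hα z).of_norm.comp_injective hinj

lemma hasSum_even_normalizedBessel {α : ℝ} (hα : -1 / 2 < α) (z : ℂ) :
    HasSum (fun k => besselCoeff α (2 * k) * z ^ (2 * k)) (normalizedBessel α z) := by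
  convert (summable_even_besselCoeff hα z).hasSum using 1
  rw [normalizedBessel, ← tsum_mul_left]
  refine tsum_congr fun k => ?_
  rw [besselCoeff, if_pos (even_two_mul k), show 2 * k / 2 = k by omega]
  push_cast
  ring

lemma hasSum_normalizedBessel {α : ℝ} (hα : -1 / 2 < α) (z : ℂ) :
    HasSum (fun n => besselCoeff α n * z ^ n) (normalizedBessel α z) := by
  have ho : HasSum (fun k => besselCoeff α (2 * k + 1) * z ^ (2 * k + 1)) 0 := by
    simp only [besselCoeff_odd, zero_mul, hasSum_zero]
  have h := HasSum.even_add_odd (f := fun n => besselCoeff α n * z ^ n)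
    (hasSum_even_normalizedBessel hα z) ho
  rwa [add_zero] at h

open ProbabilityTheory in
-- Poisson's integral in the variable x = s², obtained by averaging the cosine series term by term.
-- It gives the sharp rate e^{|Im z|}, whereas the coefficient bounds alone give only e^{|z|}.
lemma normalizedBessel_eq_integral {α : ℝ} (hα : -1 / 2 < α) (z : ℂ) :
    normalizedBessel α z =
      ∫ x : ℝ, Complex.cos (z * (√x : ℝ)) ∂(betaMeasure (1 / 2) (α + 1 / 2)) := by
  have := isProbabilityMeasureBeta (α := 1 / 2) (β := α + 1 / 2) (by norm_num) (by linarith)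
  have hinj : Function.Injective (fun k : ℕ => 2 * k) := fun a b h => by simpa using h
  have hI := hasSum_integral_of_dominated_convergence
    (μ := betaMeasure (1 / 2) (α + 1 / 2))
    (F := fun (k : ℕ) (x : ℝ) => (-1) ^ k * (z * (√x : ℝ)) ^ (2 * k) / ((2 * k).factorial : ℂ))
    (f := fun x => Complex.cos (z * (√x : ℝ)))
    (fun k _ => ‖z‖ ^ (2 * k) / ((2 * k).factorial : ℝ))
    (fun k => by
      apply Measurable.aestronglyMeasurable
      fun_prop)
    (fun k => by
      filter_upwards [ae_mem_Ioo_betaMeasure (1 / 2) (α + 1 / 2)] with x hx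
      rw [norm_div, norm_mul, norm_pow, norm_neg, norm_one, one_pow, one_mul, norm_pow,
        norm_mul, Complex.norm_natCast, Complex.norm_real, Real.norm_of_nonneg (Real.sqrt_nonneg x)]
      gcongr
      exact mul_le_of_le_one_right (norm_nonneg _) (Real.sqrt_le_one.2 hx.2.le))
    (Filter.Eventually.of_forall fun x =>
      (Real.summable_pow_div_factorial ‖z‖).comp_injective hinj)
    (integrable_const _)
    (Filter.Eventually.of_forall fun x => Complex.hasSum_cos _)
  refine (hasSum_even_normalizedBessel hα z).unique ?_
  refine (congrArg (HasSum · _) (funext fun k => ?_)).mp hI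
  symm
  rw [besselCoeff_even hα]
  rw [show (fun x : ℝ => (-1) ^ k * (z * (√x : ℝ)) ^ (2 * k) / ((2 * k).factorial : ℂ)) =
    fun x : ℝ => ((-1) ^ k * z ^ (2 * k) / ((2 * k).factorial : ℂ)) * (((√x) ^ 2) ^ k : ℝ) by
      ext x; push_cast; ring]
  rw [integral_const_mul, integral_complex_ofReal]
  rw [integral_congr_ae (f := fun x : ℝ => (√x ^ 2) ^ k) (g := fun x : ℝ => x ^ k)]
  · ring
  · filter_upwards [ae_mem_Ioo_betaMeasure (1 / 2) (α + 1 / 2)] with x hx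
    rw [Real.sq_sqrt hx.1.le]

lemma norm_cos_le (z : ℂ) : ‖Complex.cos z‖ ≤ Real.exp |z.im| := by
  rw [Complex.cos, norm_div, Complex.norm_ofNat, div_le_iff₀ two_pos]
  have h1 : ‖cexp (z * I)‖ ≤ Real.exp |z.im| := by
    rw [Complex.norm_exp]
    simpa using neg_le_abs z.im
  have h2 : ‖cexp (-z * I)‖ ≤ Real.exp |z.im| := by
    rw [Complex.norm_exp]
    simpa using le_abs_self z.im
  linarith [norm_add_le (cexp (z * I)) (cexp (-z * I))]

open ProbabilityTheory in
lemma norm_normalizedBessel_le {α : ℝ} (hα : -1 / 2 < α) (z : ℂ) :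
    ‖normalizedBessel α z‖ ≤ Real.exp |z.im| := by
  have := isProbabilityMeasureBeta (α := 1 / 2) (β := α + 1 / 2) (by norm_num) (by linarith)
  rw [normalizedBessel_eq_integral hα]
  have h1 : ‖∫ x : ℝ, Complex.cos (z * (√x : ℝ)) ∂(betaMeasure (1 / 2) (α + 1 / 2))‖ ≤
      Real.exp |z.im| * (betaMeasure (1 / 2) (α + 1 / 2)).real Set.univ := by
    apply norm_integral_le_of_norm_le_const
    filter_upwards [ae_mem_Ioo_betaMeasure (1 / 2) (α + 1 / 2)] with x hx
    refine (norm_cos_le _).trans ?_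
    rw [Complex.im_mul_ofReal, abs_mul, abs_of_nonneg (Real.sqrt_nonneg x)]
    gcongr
    exact mul_le_of_le_one_right (abs_nonneg _) (Real.sqrt_le_one.2 hx.2.le)
  rwa [probReal_univ, mul_one] at h1

lemma differentiable_normalizedBessel {α : ℝ} (hα : -1 / 2 < α) :
    Differentiable ℂ (normalizedBessel α) := by
  have h : HasFPowerSeriesOnBall (normalizedBessel α)
      (FormalMultilinearSeries.ofScalars ℂ (besselCoeff α)) 0 ⊤ := by
    refine ⟨?_, by simp, fun {y} _ => ?_⟩
    · rw [top_le_iff]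
      refine FormalMultilinearSeries.radius_eq_top_of_summable_norm _ fun r => ?_
      have := summable_besselCoeff_mul_pow hα (r : ℂ)
      refine Summable.of_nonneg_of_le (fun _ => by positivity) (fun n => ?_) this
      rw [norm_mul, norm_pow, show ‖((r : ℝ) : ℂ)‖ = r by simp]
      gcongr
      exact (FormalMultilinearSeries.ofScalars_norm ..).le
    · simpa [FormalMultilinearSeries.ofScalars_apply_eq, mul_comm] using
        hasSum_normalizedBessel hα y
  intro z
  exact (h.analyticAt_of_mem (by simp)).differentiableAt

end Weinstein

end

noncomputable section

namespace Weinstein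

/-! ### The weighted measures and polar coordinates -/

variable {d : ℕ} {α : ℝ}

@[fun_prop]
lemma continuous_coord (j : Fin (d + 1)) : Continuous fun x : Space d => x j :=
  (EuclideanSpace.proj (𝕜 := ℝ) j).continuous

lemma measurableSet_halfSpace : MeasurableSet (halfSpace d) :=
  (isOpen_lt continuous_const (continuous_coord _)).measurableSet

lemma isOpen_halfSpace : IsOpen (halfSpace d) :=
  isOpen_lt continuous_const (continuous_coord _)

lemma measurable_weight (α : ℝ) :
    Measurable fun x : Space d => ENNReal.ofReal (x (Fin.last d) ^ (2 * α + 1)) := by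
  have : Measurable fun x : Space d => x (Fin.last d) := (continuous_coord _).measurable
  fun_prop

lemma lintegral_weightedMeasure (α : ℝ) {f : Space d → ENNReal} (hf : Measurable f) :
    ∫⁻ x, f x ∂(weightedMeasure d α) =
      ∫⁻ x in halfSpace d, ENNReal.ofReal (x (Fin.last d) ^ (2 * α + 1)) * f x := by
  rw [weightedMeasure, lintegral_withDensity_eq_lintegral_mul _ (measurable_weight α) hf]
  rfl

lemma integral_weightedMeasure (α : ℝ) (f : Space d → ℂ) :
    ∫ x, f x ∂(weightedMeasure d α) =
      ∫ x in halfSpace d, ((x (Fin.last d) ^ (2 * α + 1) : ℝ) : ℂ) * f x := by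
  rw [weightedMeasure, integral_withDensity_eq_integral_toReal_smul (measurable_weight α)
    (by simp)]
  refine setIntegral_congr_fun measurableSet_halfSpace fun x hx => ?_
  rw [ENNReal.toReal_ofReal (Real.rpow_nonneg (le_of_lt hx) _), Complex.real_smul]

lemma abs_coord_le_norm (x : Space d) (j : Fin (d + 1)) : |x j| ≤ ‖x‖ := by
  simpa using PiLp.norm_apply_le x j

/-- The weight is at most (1 + ‖x‖)^m for any integer m > 2α+1, and d+2 further powers of decay are
integrable in dimension d+1. -/
lemma hasTemperateGrowth_weightedMeasure (d : ℕ) (hα : -1 / 2 < α) :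
    (weightedMeasure d α).HasTemperateGrowth := by
  obtain ⟨m, hm⟩ := exists_nat_gt (2 * α + 1)
  refine ⟨d + 2 + m, ?_⟩
  have h1 : Integrable (fun x : Space d => (1 + ‖x‖) ^ (-((d + 2 : ℕ) : ℝ))) volume := by
    apply integrable_one_add_norm
    simp
  rw [weightedMeasure, integrable_withDensity_iff_integrable_smul' (measurable_weight α) (by simp)]
  refine (h1.mono_measure Measure.restrict_le_self).mono' ?_ ?_
  · have : Measurable fun x : Space d => x (Fin.last d) := (continuous_coord _).measurable
    apply Measurable.aestronglyMeasurable
    fun_prop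
  · filter_upwards [ae_restrict_mem measurableSet_halfSpace] with x hx
    have hx0 : 0 < x (Fin.last d) := hx
    have hw := Real.rpow_nonneg hx0.le (2 * α + 1)
    have h2 : x (Fin.last d) ^ (2 * α + 1) ≤ (1 + ‖x‖) ^ (m : ℝ) := by
      calc x (Fin.last d) ^ (2 * α + 1) ≤ (1 + ‖x‖) ^ (2 * α + 1) := by
            apply Real.rpow_le_rpow hx0.le _ (by linarith)
            linarith [abs_coord_le_norm x (Fin.last d), le_abs_self (x (Fin.last d))]
        _ ≤ _ := by
            apply Real.rpow_le_rpow_of_exponent_le _ hm.le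
            linarith [norm_nonneg x]
    have hpos : 0 < 1 + ‖x‖ := by positivity
    rw [ENNReal.toReal_ofReal hw, smul_eq_mul, norm_mul, Real.norm_of_nonneg hw,
      Real.norm_of_nonneg (by positivity)]
    calc _ ≤ (1 + ‖x‖) ^ (m : ℝ) * (1 + ‖x‖) ^ (-((d + 2 + m : ℕ) : ℝ)) := by gcongr
      _ = _ := by
        rw [← Real.rpow_add hpos]
        congr 1
        push_cast
        ring

/-! ### Integrability against the Gaussian -/

lemma one_add_pow_mul_exp_le (n : ℕ) (c : ℝ) :
    ∃ C, ∀ r : ℝ, 0 ≤ r → (1 + r) ^ n * Real.exp (c * r) * Real.exp (-r ^ 2) ≤ C := by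
  -- From (1+r)^n ≤ n! e^{1+r}, and the maximum 1 + (c+1)²/4 of 1 + r + cr - r².
  refine ⟨n.factorial * Real.exp (1 + (c + 1) ^ 2 / 4), fun r hr => ?_⟩
  have h1 : (1 + r) ^ n ≤ n.factorial * Real.exp (1 + r) := by
    have := Real.pow_div_factorial_le_exp (1 + r) (by linarith) n
    rwa [div_le_iff₀' (by positivity)] at this
  calc _ ≤ n.factorial * Real.exp (1 + r) * Real.exp (c * r) * Real.exp (-r ^ 2) := by gcongr
    _ = n.factorial * Real.exp (1 + r + c * r - r ^ 2) := by
        rw [sub_eq_add_neg, Real.exp_add (1 + r + c * r), Real.exp_add (1 + r) (c * r)]; ring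
    _ ≤ _ := by
        gcongr
        nlinarith [sq_nonneg (r - (c + 1) / 2)]

lemma integrable_of_gaussian_bound (hα : -1 / 2 < α) (n : ℕ) (C c : ℝ)
    {f : Space d → ℂ} (hf : AEStronglyMeasurable f (weightedMeasure d α))
    (h : ∀ x, ‖f x‖ ≤ C * ((1 + ‖x‖) ^ n * Real.exp (c * ‖x‖) * Real.exp (-‖x‖ ^ 2))) :
    Integrable f (weightedMeasure d α) := by
  obtain ⟨⟨M, hM⟩⟩ := hasTemperateGrowth_weightedMeasure d hα
  obtain ⟨D, hD⟩ := one_add_pow_mul_exp_le (n + M) c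
  refine (hM.const_mul (|C| * D)).mono' hf (Filter.Eventually.of_forall fun x => (h x).trans ?_)
  have hpos : 0 < 1 + ‖x‖ := by positivity
  rw [Real.rpow_neg hpos.le, Real.rpow_natCast, mul_assoc |C|, ← div_eq_mul_inv]
  have h2 : (1 + ‖x‖) ^ n * Real.exp (c * ‖x‖) * Real.exp (-‖x‖ ^ 2) ≤ D / (1 + ‖x‖) ^ M := by
    rw [le_div_iff₀ (by positivity)]
    refine le_trans (le_of_eq ?_) (hD ‖x‖ (norm_nonneg x))
    rw [pow_add]
    ring
  exact mul_le_mul (le_abs_self C) h2 (by positivity) (abs_nonneg C)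

/-- The radial part `r ^ (d + 2α + 1) dr` of the weighted measure. -/
def radialMeasure (d : ℕ) (α : ℝ) : Measure ℝ :=
  (volume.restrict (Set.Ioi (0 : ℝ))).withDensity
    (fun r => ENNReal.ofReal (r ^ ((d : ℝ) + (2 * α + 1))))

instance : SFinite (radialMeasure d α) := by unfold radialMeasure; infer_instance
instance : SFinite (sphereMeasure d α) := by unfold sphereMeasure; infer_instance
instance : SFinite (weightedMeasure d α) := by unfold weightedMeasure; infer_instance

lemma measurable_sphere_coord :
    Measurable fun t : Metric.sphere (0 : Space d) 1 => (t : Space d) (Fin.last d) :=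
  ((continuous_coord _).comp continuous_subtype_val).measurable

lemma measurable_sphere_weight (α : ℝ) :
    Measurable fun t : Metric.sphere (0 : Space d) 1 =>
      ENNReal.ofReal ((t : Space d) (Fin.last d) ^ (2 * α + 1)) := by
  have := measurable_sphere_coord (d := d)
  fun_prop

lemma measurableSet_sphere_halfSpace :
    MeasurableSet {t : Metric.sphere (0 : Space d) 1 | (t : Space d) ∈ halfSpace d} :=
  measurable_subtype_coe measurableSet_halfSpace

lemma isFiniteMeasure_sphereMeasure (d : ℕ) (hα : -1 / 2 < α) :
    IsFiniteMeasure (sphereMeasure d α) := by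
  refine isFiniteMeasure_withDensity (ne_of_lt ?_)
  calc _ ≤ ∫⁻ t in {t : Metric.sphere (0 : Space d) 1 | (t : Space d) ∈ halfSpace d},
        1 ∂(volume : Measure (Space d)).toSphere := by
        refine setLIntegral_mono measurable_const fun t ht => ?_
        rw [ENNReal.ofReal_le_one]
        refine Real.rpow_le_one (le_of_lt ht) ?_ (by linarith)
        have := abs_coord_le_norm (t : Space d) (Fin.last d)
        rw [norm_eq_of_mem_sphere t] at this
        exact (le_abs_self _).trans this
    _ < ⊤ := by
        rw [lintegral_const, one_mul]
        exact measure_lt_top _ _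

lemma ae_pos_radialMeasure : ∀ᵐ r ∂(radialMeasure d α), 0 < r :=
  (withDensity_absolutelyContinuous _ _).ae_le (ae_restrict_mem measurableSet_Ioi)

lemma lintegral_radialMeasure {f : ℝ → ENNReal} (hf : Measurable f) :
    ∫⁻ r, f r ∂(radialMeasure d α) =
      ∫⁻ r in Set.Ioi 0, ENNReal.ofReal (r ^ ((d : ℝ) + (2 * α + 1))) * f r := by
  rw [radialMeasure, lintegral_withDensity_eq_lintegral_mul _ (by fun_prop) hf]
  rfl

lemma integral_radialMeasure (f : ℝ → ℂ) :
    ∫ r, f r ∂(radialMeasure d α) =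
      ∫ r in Set.Ioi 0, ((r ^ ((d : ℝ) + (2 * α + 1)) : ℝ) : ℂ) * f r := by
  rw [radialMeasure, integral_withDensity_eq_integral_toReal_smul (by fun_prop) (by simp)]
  refine setIntegral_congr_fun measurableSet_Ioi fun x hx => ?_
  rw [ENNReal.toReal_ofReal (Real.rpow_nonneg (le_of_lt hx) _), Complex.real_smul]

/-- The origin is null, and the punctured space is the sphere times (0, ∞). The form for nonnegative
functions suffices to identify measures, with no integrability to check. -/
lemma lintegral_volume_polar {f : Space d → ENNReal} (hf : Measurable f) :
    ∫⁻ x, f x = ∫⁻ t : Metric.sphere (0 : Space d) 1, (∫⁻ r in Set.Ioi (0 : ℝ),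
      ENNReal.ofReal (r ^ d) * f (r • (t : Space d))) ∂(volume : Measure (Space d)).toSphere := by
  have hmp := (volume : Measure (Space d)).measurePreserving_homeomorphUnitSphereProd
  have hdim : Module.finrank ℝ (Space d) - 1 = d := by simp
  rw [hdim] at hmp
  have hcoe := MeasurableEmbedding.subtype_coe (measurableSet_singleton (0 : Space d)).compl
  have h1 : ∫⁻ x, f x = ∫⁻ x : ({0}ᶜ : Set (Space d)), f x ∂(volume.comap Subtype.val) := by
    rw [← hcoe.lintegral_map, hcoe.map_comap, Subtype.range_coe]
    rw [Measure.restrict_eq_self_of_ae_mem]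
    exact Measure.ae_ne volume 0
  have h2 : ∫⁻ x : ({0}ᶜ : Set (Space d)), f x ∂(volume.comap Subtype.val) =
      ∫⁻ p : Metric.sphere (0 : Space d) 1 × Set.Ioi (0 : ℝ),
        f (p.2.1 • (p.1 : Space d)) ∂((volume : Measure (Space d)).toSphere.prod
          (Measure.volumeIoiPow d)) := by
    rw [← hmp.map_eq, (Homeomorph.measurableEmbedding _).lintegral_map]
    refine lintegral_congr fun x => ?_
    have : ‖(x : Space d)‖ ≠ 0 := norm_ne_zero_iff.2 x.2
    simp [smul_smul, this]
  have hm : Measurable fun p : Metric.sphere (0 : Space d) 1 × Set.Ioi (0 : ℝ) =>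
      f (p.2.1 • (p.1 : Space d)) := by fun_prop
  rw [h1, h2, lintegral_prod _ hm.aemeasurable]
  refine lintegral_congr fun t => ?_
  have hm2 : Measurable fun r : ℝ => ENNReal.ofReal (r ^ d) * f (r • (t : Space d)) := by fun_prop
  rw [Measure.volumeIoiPow, lintegral_withDensity_eq_lintegral_mul _ (by fun_prop) (by fun_prop),
    ← lintegral_subtype_comap measurableSet_Ioi]
  rfl

/-- The weight is homogeneous, so at rt it splits as r^(2α+1) times its value at t, and the Jacobian
supplies r^d. The half-space is a cone, so the restriction concerns t only. -/
lemma weightedMeasure_eq_map (d : ℕ) (α : ℝ) :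
    weightedMeasure d α =
      ((sphereMeasure d α).prod (radialMeasure d α)).map (fun p => p.2 • (p.1 : Space d)) := by
  have hmeas : Measurable fun p : Metric.sphere (0 : Space d) 1 × ℝ => p.2 • (p.1 : Space d) := by
    fun_prop
  refine Measure.ext_of_lintegral _ fun f hf => ?_
  rw [lintegral_map hf hmeas, lintegral_prod (fun p : Metric.sphere (0 : Space d) 1 × ℝ => f (p.2 • (p.1 : Space d)))
    (hf.comp hmeas).aemeasurable, lintegral_weightedMeasure α hf, ← lintegral_indicator measurableSet_halfSpace,
    lintegral_volume_polar (f := (halfSpace d).indicator fun x =>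
      ENNReal.ofReal (x (Fin.last d) ^ (2 * α + 1)) * f x)
      (((measurable_weight α).mul hf).indicator measurableSet_halfSpace)]
  have hinner : Measurable fun t : Metric.sphere (0 : Space d) 1 =>
      ∫⁻ r, f (r • (t : Space d)) ∂(radialMeasure d α) :=
    (hf.comp hmeas).lintegral_prod_right'
  rw [sphereMeasure, lintegral_withDensity_eq_lintegral_mul _ (measurable_sphere_weight α) hinner,
    ← lintegral_indicator measurableSet_sphere_halfSpace]
  refine lintegral_congr fun t => ?_
  by_cases ht : (t : Space d) ∈ halfSpace d
  · rw [Set.indicator_of_mem (by exact ht), Pi.mul_apply, lintegral_radialMeasure (by fun_prop),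
      ← lintegral_const_mul _ (by fun_prop)]
    refine setLIntegral_congr_fun measurableSet_Ioi fun r hr => ?_
    have hr0 : 0 < r := hr
    have ht0 : 0 < (t : Space d) (Fin.last d) := ht
    have hmem : r • (t : Space d) ∈ halfSpace d := by
      simpa [halfSpace] using mul_pos hr0 ht0
    simp only [Set.indicator_of_mem hmem, PiLp.smul_apply, smul_eq_mul]
    rw [Real.mul_rpow hr0.le ht0.le, Real.rpow_add hr0 d, Real.rpow_natCast,
      ENNReal.ofReal_mul (by positivity), ENNReal.ofReal_mul (by positivity)]
    ring
  · rw [Set.indicator_of_notMem (by exact ht)]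
    rw [setLIntegral_congr_fun (g := fun _ => 0) measurableSet_Ioi, lintegral_zero]
    intro r hr
    have hr0 : 0 < r := hr
    have hmem : r • (t : Space d) ∉ halfSpace d := by
      simp only [halfSpace, Set.mem_ofPred_eq, PiLp.smul_apply, smul_eq_mul] at ht ⊢
      exact fun h => ht (by rwa [mul_pos_iff_of_pos_left hr0] at h)
    simp [Set.indicator_of_notMem hmem]

lemma integrable_polar {f : Space d → ℂ} (hf : Integrable f (weightedMeasure d α)) :
    Integrable (fun p : Metric.sphere (0 : Space d) 1 × ℝ => f (p.2 • (p.1 : Space d)))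
      ((sphereMeasure d α).prod (radialMeasure d α)) := by
  rw [weightedMeasure_eq_map] at hf
  exact hf.comp_measurable (by fun_prop)

lemma integral_polar {f : Space d → ℂ} (hf : Integrable f (weightedMeasure d α)) :
    ∫ x, f x ∂(weightedMeasure d α) =
      ∫ r, ∫ t, f (r • (t : Space d)) ∂(sphereMeasure d α) ∂(radialMeasure d α) := by
  have h := integrable_polar hf
  rw [weightedMeasure_eq_map] at hf ⊢
  rw [integral_map (by fun_prop) hf.aestronglyMeasurable, integral_prod_symm _ h]

end Weinstein

end

noncomputable section

namespace Weinstein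

variable {d : ℕ} {α : ℝ}

/-! ### Polynomial functions and Gaussian moments -/

/-- Polynomials in the coordinates of `Space d`. -/
abbrev Poly (d : ℕ) : Type := MvPolynomial (Fin (d + 1)) ℂ

@[simp] lemma polyFun_add (p q : Poly d) (x : Space d) :
    polyFun (p + q) x = polyFun p x + polyFun q x := by simp [polyFun]

@[simp] lemma polyFun_sub (p q : Poly d) (x : Space d) :
    polyFun (p - q) x = polyFun p x - polyFun q x := by simp [polyFun]

@[simp] lemma polyFun_mul (p q : Poly d) (x : Space d) :
    polyFun (p * q) x = polyFun p x * polyFun q x := by simp [polyFun]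

@[simp] lemma polyFun_smul (c : ℂ) (p : Poly d) (x : Space d) :
    polyFun (c • p) x = c * polyFun p x := by simp [polyFun]

@[simp] lemma polyFun_C (c : ℂ) (x : Space d) : polyFun (MvPolynomial.C c) x = c := by
  simp [polyFun]

@[simp] lemma polyFun_X (j : Fin (d + 1)) (x : Space d) :
    polyFun (MvPolynomial.X j) x = x j := by simp [polyFun]

@[simp] lemma polyFun_sum {ι : Type*} (s : Finset ι) (p : ι → Poly d) (x : Space d) :
    polyFun (∑ i ∈ s, p i) x = ∑ i ∈ s, polyFun (p i) x := by simp [polyFun]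

lemma polyFun_monomial (β : Fin (d + 1) →₀ ℕ) (c : ℂ) (x : Space d) :
    polyFun (MvPolynomial.monomial β c) x = c * ∏ j, (x j : ℂ) ^ β j := by
  rw [polyFun, MvPolynomial.eval_monomial, Finsupp.prod_fintype _ _ (by simp)]

lemma polyFun_real_smul {p : Poly d} {l : ℕ} (hp : p.IsHomogeneous l) (r : ℝ) (x : Space d) :
    polyFun p (r • x) = (r : ℂ) ^ l * polyFun p x := by
  rw [p.as_sum, polyFun_sum, polyFun_sum, Finset.mul_sum]
  refine Finset.sum_congr rfl fun β hβ => ?_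
  rw [polyFun_monomial, polyFun_monomial, hp.degree_eq_sum_deg_support hβ, ← Finsupp.degree_apply,
    Finsupp.degree_eq_sum, ← Finset.prod_pow_eq_pow_sum]
  simp only [PiLp.smul_apply, smul_eq_mul, Complex.ofReal_mul, mul_pow, Finset.prod_mul_distrib]
  ring

@[fun_prop]
lemma continuous_polyFun (p : Poly d) : Continuous (polyFun p) := by
  unfold polyFun
  exact (MvPolynomial.continuous_eval p).comp (by fun_prop)

lemma exists_norm_polyFun_le (p : Poly d) :
    ∃ C : ℝ, ∃ n : ℕ, 0 ≤ C ∧ ∀ x, ‖polyFun p x‖ ≤ C * (1 + ‖x‖) ^ n := by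
  induction p using MvPolynomial.induction_on with
  | C a => exact ⟨‖a‖, 0, norm_nonneg _, by simp⟩
  | add p q hp hq =>
    obtain ⟨C, n, hC, h⟩ := hp
    obtain ⟨D, m, hD, h'⟩ := hq
    refine ⟨C + D, n + m, by positivity, fun x => ?_⟩
    rw [polyFun_add, add_mul]
    refine (norm_add_le _ _).trans (add_le_add ((h x).trans ?_) ((h' x).trans ?_))
    · exact mul_le_mul_of_nonneg_left (pow_le_pow_right₀ (by simp) (by omega)) hC
    · exact mul_le_mul_of_nonneg_left (pow_le_pow_right₀ (by simp) (by omega)) hD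
  | mul_X p j hp =>
    obtain ⟨C, n, hC, h⟩ := hp
    refine ⟨C, n + 1, hC, fun x => ?_⟩
    rw [polyFun_mul, norm_mul, pow_succ, ← mul_assoc]
    refine mul_le_mul (h x) ?_ (norm_nonneg _) (by positivity)
    rw [polyFun_X, Complex.norm_real, Real.norm_eq_abs]
    linarith [abs_coord_le_norm x j]

/-- The Gaussian weight `exp (-‖x‖²)`. -/
def gauss (x : Space d) : ℂ := (Real.exp (-‖x‖ ^ 2) : ℝ)

@[fun_prop]
lemma continuous_gauss : Continuous (gauss (d := d)) := by
  unfold gauss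
  fun_prop

lemma norm_gauss (x : Space d) : ‖gauss x‖ = Real.exp (-‖x‖ ^ 2) := by
  rw [gauss, Complex.norm_real, Real.norm_of_nonneg (Real.exp_pos _).le]

lemma integrable_mul_polyFun_mul_gauss (hα : -1 / 2 < α) (p : Poly d) {f : Space d → ℂ}
    (hf : Continuous f) {C c : ℝ} (h : ∀ x, ‖f x‖ ≤ C * Real.exp (c * ‖x‖)) :
    Integrable (fun x => f x * (polyFun p x * gauss x)) (weightedMeasure d α) := by
  obtain ⟨D, n, hD, hp⟩ := exists_norm_polyFun_le p
  refine integrable_of_gaussian_bound hα n (C * D) c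
    (Continuous.aestronglyMeasurable (by fun_prop)) fun x => ?_
  rw [norm_mul, norm_mul, norm_gauss]
  have h2 : ‖polyFun p x‖ * Real.exp (-‖x‖ ^ 2) ≤ D * (1 + ‖x‖) ^ n * Real.exp (-‖x‖ ^ 2) := by
    gcongr
    exact hp x
  calc _ ≤ (C * Real.exp (c * ‖x‖)) * (D * (1 + ‖x‖) ^ n * Real.exp (-‖x‖ ^ 2)) :=
        mul_le_mul (h x) h2 (by positivity) ((norm_nonneg _).trans (h x))
    _ = _ := by ring

lemma integrable_polyFun_mul_gauss (hα : -1 / 2 < α) (p : Poly d) :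
    Integrable (fun x => polyFun p x * gauss x) (weightedMeasure d α) := by
  simpa using integrable_mul_polyFun_mul_gauss hα p (f := fun _ => 1) continuous_const
    (C := 1) (c := 0) (by simp)

/-- Integration of a polynomial against the Gaussian with respect to the weighted measure. -/
def gaussIntegral (hα : -1 / 2 < α) : Poly d →ₗ[ℂ] ℂ where
  toFun p := ∫ x, polyFun p x * gauss x ∂(weightedMeasure d α)
  map_add' p q := by
    rw [← integral_add (integrable_polyFun_mul_gauss hα p) (integrable_polyFun_mul_gauss hα q)]
    simp only [polyFun_add, add_mul]
  map_smul' c p := by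
    simp only [polyFun_smul, mul_assoc, integral_const_mul, smul_eq_mul, RingHom.id_apply]

lemma gaussIntegral_apply (hα : -1 / 2 < α) (p : Poly d) :
    gaussIntegral hα p = ∫ x, polyFun p x * gauss x ∂(weightedMeasure d α) := rfl

/-- The exponent of the weight attached to each coordinate: `2α + 1` for the last one, `0` for the
others. -/
def kappa (α : ℝ) (j : Fin (d + 1)) : ℝ := if j = Fin.last d then 2 * α + 1 else 0

/-- The factor of the integrand of a Gaussian moment that depends on the `j`-th coordinate. -/
def momentFactor (α : ℝ) (j : Fin (d + 1)) (n : ℕ) (t : ℝ) : ℝ :=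
  if j = Fin.last d then (Set.Ioi 0).indicator (fun t => t ^ (2 * α + 1)) t *
    (t ^ n * Real.exp (-t ^ 2)) else t ^ n * Real.exp (-t ^ 2)

/-- Monomial, Gaussian, weight and indicator of the half-space all factor over the coordinates. -/
lemma gaussIntegral_monomial (hα : -1 / 2 < α) (β : Fin (d + 1) →₀ ℕ) (c : ℂ) :
    gaussIntegral hα (MvPolynomial.monomial β c) =
      c * ((∏ j, ∫ t, momentFactor α j (β j) t : ℝ) : ℂ) := by
  rw [gaussIntegral_apply, integral_weightedMeasure, ← integral_indicator measurableSet_halfSpace,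
    ← integral_fintype_prod_volume_eq_prod (𝕜 := ℝ), ← integral_complex_ofReal,
    ← integral_const_mul,
    ← (PiLp.volume_preserving_ofLp (Fin (d + 1))).integral_comp
      (MeasurableEquiv.toLp 2 (Fin (d + 1) → ℝ)).symm.measurableEmbedding]
  refine integral_congr_ae (Filter.Eventually.of_forall fun x => ?_)
  simp only
  rw [Fin.prod_univ_castSucc]
  have hne : ∀ j : Fin d, j.castSucc ≠ Fin.last d := fun j => (Fin.castSucc_lt_last j).ne
  have hg : gauss x = ((∏ j : Fin d, Real.exp (-(x j.castSucc) ^ 2) : ℝ) : ℂ) *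
      ((Real.exp (-(x (Fin.last d)) ^ 2) : ℝ) : ℂ) := by
    rw [gauss, EuclideanSpace.norm_sq_eq, Fin.sum_univ_castSucc, ← Real.exp_sum,
      ← Complex.ofReal_mul, ← Real.exp_add]
    simp [Finset.sum_neg_distrib]
    ring_nf
  simp only [momentFactor, hne, if_false, if_true]
  by_cases hx : x ∈ halfSpace d
  · have hx' : x (Fin.last d) ∈ Set.Ioi (0 : ℝ) := hx
    rw [Set.indicator_of_mem hx, Set.indicator_of_mem hx', polyFun_monomial, hg,
      Fin.prod_univ_castSucc]
    push_cast
    rw [Finset.prod_mul_distrib]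
    ring
  · have hx' : x (Fin.last d) ∉ Set.Ioi (0 : ℝ) := hx
    rw [Set.indicator_of_notMem hx, Set.indicator_of_notMem hx']
    simp

lemma integral_momentFactor_last (hα : -1 / 2 < α) (n : ℕ) :
    ∫ t, momentFactor α (Fin.last d) n t = 1 / 2 * Real.Gamma ((n + (2 * α + 1) + 1) / 2) := by
  have h := _root_.integral_rpow_mul_exp_neg_mul_rpow (p := 2) (q := n + (2 * α + 1)) (b := 1) (by simp)
    (by have : (0 : ℝ) ≤ n := Nat.cast_nonneg n
        linarith) one_pos
  rw [Real.one_rpow, one_mul] at h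
  rw [← h, ← integral_indicator measurableSet_Ioi]
  congr 1 with t
  simp only [momentFactor, if_true, Set.indicator]
  split_ifs with ht
  · rw [add_comm (n : ℝ), Real.rpow_add_natCast (ne_of_gt ht)]
    norm_num
    ring
  · simp

lemma integral_pow_mul_gauss_of_odd {n : ℕ} (hn : Odd n) :
    ∫ t : ℝ, t ^ n * Real.exp (-t ^ 2) = 0 := by
  have h := integral_neg_eq_self (fun t : ℝ => t ^ n * Real.exp (-t ^ 2)) volume
  simp only [hn.neg_pow, even_two.neg_pow, neg_mul, integral_neg] at h
  linarith

lemma integral_pow_mul_gauss_of_even {n : ℕ} (hn : Even n) :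
    ∫ t : ℝ, t ^ n * Real.exp (-t ^ 2) = Real.Gamma ((n + 1) / 2) := by
  have h := _root_.integral_rpow_mul_exp_neg_mul_rpow (p := 2) (q := n) (b := 1) (by simp)
    (by have : (0 : ℝ) ≤ n := Nat.cast_nonneg n
        linarith) one_pos
  have h2 := integral_comp_abs (f := fun t : ℝ => t ^ n * Real.exp (-t ^ 2))
  simp only [hn.pow_abs, sq_abs] at h2
  rw [h2]
  norm_num at h
  rw [h]
  ring

/-- The functional equation of Γ; it stands in for integration by parts in everything below. In the
unweighted coordinates odd moments vanish on both sides; the last coordinate runs over a half-line,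
so parity plays no role there. -/
lemma integral_momentFactor_add_two (hα : -1 / 2 < α) (j : Fin (d + 1)) (n : ℕ) :
    2 * ∫ t, momentFactor α j (n + 2) t =
      (n + 1 + kappa α j) * ∫ t, momentFactor α j n t := by
  have hn : (0 : ℝ) ≤ n := Nat.cast_nonneg n
  by_cases hj : j = Fin.last d
  · subst hj
    rw [integral_momentFactor_last hα, integral_momentFactor_last hα, kappa, if_pos rfl]
    have e : (((n + 2 : ℕ) : ℝ) + (2 * α + 1) + 1) / 2 = (n + (2 * α + 1) + 1) / 2 + 1 := by
      push_cast
      ring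
    rw [e, Real.Gamma_add_one (by apply ne_of_gt; linarith)]
    ring
  · simp only [momentFactor, hj, if_false, kappa]
    rcases Nat.even_or_odd n with he | ho
    · rw [integral_pow_mul_gauss_of_even he, integral_pow_mul_gauss_of_even (he.add even_two)]
      have e : (((n + 2 : ℕ) : ℝ) + 1) / 2 = (n + 1) / 2 + 1 := by
        push_cast
        ring
      rw [e, Real.Gamma_add_one (by positivity)]
      ring
    · rw [integral_pow_mul_gauss_of_odd ho, integral_pow_mul_gauss_of_odd (ho.add_even even_two)]
      simp

lemma gaussIntegral_monomial_of_odd (hα : -1 / 2 < α) (β : Fin (d + 1) →₀ ℕ) (c : ℂ)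
    {j : Fin (d + 1)} (hj : j ≠ Fin.last d) (ho : Odd (β j)) :
    gaussIntegral hα (MvPolynomial.monomial β c) = 0 := by
  rw [gaussIntegral_monomial, Finset.prod_eq_zero (Finset.mem_univ j)]
  · simp
  · simp only [momentFactor, hj, if_false]
    exact integral_pow_mul_gauss_of_odd ho

lemma gaussIntegral_monomial_add_single (hα : -1 / 2 < α) (β : Fin (d + 1) →₀ ℕ) (c : ℂ)
    (j : Fin (d + 1)) :
    2 * gaussIntegral hα (MvPolynomial.monomial (β + Finsupp.single j 2) c) =
      (β j + 1 + kappa α j) * gaussIntegral hα (MvPolynomial.monomial β c) := by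
  rw [gaussIntegral_monomial, gaussIntegral_monomial,
    ← Finset.mul_prod_erase _ _ (Finset.mem_univ j),
    ← Finset.mul_prod_erase _ (fun i => ∫ t, momentFactor α i (β i) t) (Finset.mem_univ j)]
  have h : ∏ i ∈ Finset.univ.erase j, ∫ t, momentFactor α i ((β + Finsupp.single j 2 : Fin (d + 1) →₀ ℕ) i) t =
      ∏ i ∈ Finset.univ.erase j, ∫ t, momentFactor α i (β i) t := by
    refine Finset.prod_congr rfl fun i hi => ?_
    rw [Finsupp.add_apply, Finsupp.single_eq_of_ne (Finset.ne_of_mem_erase hi), add_zero]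
  rw [h, Finsupp.add_apply, Finsupp.single_eq_same]
  have h2 := congrArg (fun r : ℝ => (r : ℂ)) (integral_momentFactor_add_two hα j (β j))
  push_cast at h2 ⊢
  linear_combination c * (∏ i ∈ Finset.univ.erase j,
    ((∫ t, momentFactor α i (β i) t : ℝ) : ℂ)) * h2

end Weinstein

end

noncomputable section

namespace Weinstein

variable {d : ℕ} {α : ℝ}

/-! ### The Weinstein operator on polynomials -/

open MvPolynomial (monomial coeff pderiv)

/-- The Bessel operator `∂_j² + (κ_j / x_j) ∂_j` on polynomials, where the division by `x_j`
discards the terms that are not divisible by `x_j`. -/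
def besselPoly (α : ℝ) (j : Fin (d + 1)) : Poly d →ₗ[ℂ] Poly d where
  toFun p := pderiv j (pderiv j p) + (kappa α j : ℂ) • (pderiv j p).divMonomial (Finsupp.single j 1)
  map_add' p q := by
    simp only [map_add, MvPolynomial.add_divMonomial, smul_add]
    abel
  map_smul' c p := by
    ext γ
    simp [MvPolynomial.coeff_divMonomial, MvPolynomial.coeff_pderiv]
    ring

lemma coeff_besselPoly (j : Fin (d + 1)) (p : Poly d) (γ : Fin (d + 1) →₀ ℕ) :
    coeff γ (besselPoly α j p) =
      coeff (γ + Finsupp.single j 2) p * ((γ j + 2) * (γ j + 1 + kappa α j)) := by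
  have h1 : γ + Finsupp.single j 1 + Finsupp.single j 1 = γ + Finsupp.single j 2 := by
    rw [add_assoc, ← Finsupp.single_add]
  have h2 : Finsupp.single j 1 + γ + Finsupp.single j 1 = γ + Finsupp.single j 2 := by
    rw [add_comm (Finsupp.single j 1), h1]
  simp only [besselPoly, LinearMap.coe_mk, AddHom.coe_mk, MvPolynomial.coeff_add,
    MvPolynomial.coeff_smul, MvPolynomial.coeff_divMonomial, MvPolynomial.coeff_pderiv, h1, h2,
    Finsupp.add_apply, Finsupp.single_eq_same, smul_eq_mul]
  push_cast
  ring

/-- The Weinstein operator on polynomials that are even in the last variable. -/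
def weinsteinPoly (d : ℕ) (α : ℝ) : Poly d →ₗ[ℂ] Poly d := ∑ j, besselPoly α j

lemma weinsteinPoly_apply (p : Poly d) : weinsteinPoly d α p = ∑ j, besselPoly α j p := by
  simp [weinsteinPoly]

lemma coeff_weinsteinPoly (p : Poly d) (γ : Fin (d + 1) →₀ ℕ) :
    coeff γ (weinsteinPoly d α p) =
      ∑ j, coeff (γ + Finsupp.single j 2) p * ((γ j + 2) * (γ j + 1 + kappa α j)) := by
  rw [weinsteinPoly_apply, MvPolynomial.coeff_sum]
  simp only [coeff_besselPoly]

/-- Evenness excludes exponent 1 in the last variable, the only case where discarding the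
non-polynomial term would break the formula. In the other cases with exponent below 2 the
coefficient is 0, so the truncated subtraction is harmless. -/
lemma besselPoly_monomial (j : Fin (d + 1)) {β : Fin (d + 1) →₀ ℕ} (hβ : Even (β (Fin.last d)))
    (c : ℂ) :
    besselPoly α j (monomial β c) =
      monomial (β - Finsupp.single j 2) (c * (β j * (β j - 1 + kappa α j))) := by
  ext γ
  rw [coeff_besselPoly, MvPolynomial.coeff_monomial, MvPolynomial.coeff_monomial]
  by_cases h2 : 2 ≤ β j
  · have hle : Finsupp.single j 2 ≤ β := by rwa [Finsupp.single_le_iff]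
    have hiff : β = γ + Finsupp.single j 2 ↔ β - Finsupp.single j 2 = γ :=
      (tsub_eq_iff_eq_add_of_le hle).symm
    by_cases h : β = γ + Finsupp.single j 2
    · rw [if_pos h, if_pos (hiff.1 h), h]
      simp only [Finsupp.add_apply, Finsupp.single_eq_same]
      push_cast
      ring
    · rw [if_neg h, if_neg (mt hiff.2 h), zero_mul]
  · have h : β ≠ γ + Finsupp.single j 2 := by
      rintro rfl
      simp at h2
    have h0 : (β j : ℂ) * (β j - 1 + kappa α j) = 0 := by
      obtain h0 | h1 : β j = 0 ∨ β j = 1 := by omega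
      · simp [h0]
      · have hj : j ≠ Fin.last d := by
          rintro rfl
          rw [h1] at hβ
          simp at hβ
        simp [h1, kappa, hj]
    rw [if_neg h, h0]
    simp

/-- Polynomials all of whose exponents in the last variable are even. -/
def evenPoly (d : ℕ) : Submodule ℂ (Poly d) where
  carrier := {p | ∀ β : Fin (d + 1) →₀ ℕ, ¬Even (β (Fin.last d)) → coeff β p = 0}
  add_mem' := fun {p q} hp hq β hβ => by
    rw [MvPolynomial.coeff_add, hp β hβ, hq β hβ, add_zero]
  zero_mem' := fun β _ => MvPolynomial.coeff_zero β
  smul_mem' := fun c p hp β hβ => by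
    rw [MvPolynomial.coeff_smul, hp β hβ, smul_zero]

lemma mem_evenPoly {p : Poly d} : p ∈ evenPoly d ↔
    ∀ β : Fin (d + 1) →₀ ℕ, ¬Even (β (Fin.last d)) → coeff β p = 0 := Iff.rfl

lemma even_of_mem_support {p : Poly d} (hp : p ∈ evenPoly d) {β : Fin (d + 1) →₀ ℕ}
    (hβ : β ∈ p.support) : Even (β (Fin.last d)) := by
  by_contra h
  exact MvPolynomial.mem_support_iff.1 hβ (hp β h)

lemma mul_mem_evenPoly {p q : Poly d} (hp : p ∈ evenPoly d) (hq : q ∈ evenPoly d) :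
    p * q ∈ evenPoly d := by
  classical
  intro β hβ
  rw [MvPolynomial.coeff_mul]
  refine Finset.sum_eq_zero fun x hx => ?_
  rw [Finset.HasAntidiagonal.mem_antidiagonal] at hx
  have : ¬Even (x.1 (Fin.last d)) ∨ ¬Even (x.2 (Fin.last d)) := by
    by_contra! h
    rw [← hx] at hβ
    exact hβ (h.1.add h.2)
  rcases this with h | h
  · rw [hp _ h, zero_mul]
  · rw [hq _ h, mul_zero]

/-- Homogeneous polynomials of degree `k` that are even in the last variable. -/
def evenHom (d k : ℕ) : Submodule ℂ (Poly d) :=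
  MvPolynomial.homogeneousSubmodule (Fin (d + 1)) ℂ k ⊓ evenPoly d

lemma mem_evenHom {k : ℕ} {p : Poly d} :
    p ∈ evenHom d k ↔ p.IsHomogeneous k ∧ p ∈ evenPoly d := Iff.rfl

lemma mem_evenHom_iff_coeff {k : ℕ} {p : Poly d} :
    p ∈ evenHom d k ↔ ∀ β : Fin (d + 1) →₀ ℕ,
      ¬(β.degree = k ∧ Even (β (Fin.last d))) → coeff β p = 0 := by
  rw [mem_evenHom, mem_evenPoly]
  constructor
  · rintro ⟨h1, h2⟩ β hβ
    by_cases h : β.degree = k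
    · exact h2 β fun h' => hβ ⟨h, h'⟩
    · exact h1.coeff_eq_zero h
  · intro h
    refine ⟨?_, fun β hβ => h β fun h' => hβ h'.2⟩
    rw [← MvPolynomial.mem_homogeneousSubmodule,
      MvPolynomial.homogeneousSubmodule_eq_finsupp_supported]
    intro β hβ
    by_contra h'
    exact MvPolynomial.mem_support_iff.1 hβ (h β fun h'' => h' h''.1)

instance (k : ℕ) : FiniteDimensional ℂ (evenHom d k) :=
  have : FiniteDimensional ℂ (MvPolynomial.homogeneousSubmodule (Fin (d + 1)) ℂ k) :=
    Module.Finite.iff_fg.2 (MvPolynomial.homogeneousSubmodule_fg _ _ _)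
  Submodule.finiteDimensional_inf_left _ _

lemma degree_add_single (γ : Fin (d + 1) →₀ ℕ) (j : Fin (d + 1)) (n : ℕ) :
    (γ + Finsupp.single j n).degree = γ.degree + n := by
  rw [map_add, Finsupp.degree_single]

lemma even_add_single_two (γ : Fin (d + 1) →₀ ℕ) (j : Fin (d + 1)) :
    Even ((γ + Finsupp.single j 2 : Fin (d + 1) →₀ ℕ) (Fin.last d)) ↔ Even (γ (Fin.last d)) := by
  rw [Finsupp.add_apply, Nat.even_add]
  by_cases h : j = Fin.last d
  · subst h
    simp
  · rw [Finsupp.single_eq_of_ne (Ne.symm h)]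
    simp

lemma weinsteinPoly_mem_evenHom {k : ℕ} {p : Poly d} (hp : p ∈ evenHom d (k + 2)) :
    weinsteinPoly d α p ∈ evenHom d k := by
  rw [mem_evenHom_iff_coeff] at hp ⊢
  intro β hβ
  rw [coeff_weinsteinPoly]
  refine Finset.sum_eq_zero fun j _ => ?_
  rw [hp _ fun h => hβ ?_, zero_mul]
  rw [degree_add_single, even_add_single_two] at h
  exact ⟨by omega, h.2⟩

lemma weinsteinPoly_eq_zero_of_lt {k : ℕ} (hk : k < 2) {p : Poly d} (hp : p ∈ evenHom d k) :
    weinsteinPoly d α p = 0 := by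
  rw [mem_evenHom_iff_coeff] at hp
  ext β
  rw [coeff_weinsteinPoly, MvPolynomial.coeff_zero]
  refine Finset.sum_eq_zero fun j _ => ?_
  rw [hp _ fun h => ?_, zero_mul]
  rw [degree_add_single] at h
  omega

/-- The polynomial `‖x‖²`. -/
def normSqPoly (d : ℕ) : Poly d := ∑ j, MvPolynomial.X j ^ 2

lemma polyFun_normSqPoly (x : Space d) : polyFun (normSqPoly d) x = (‖x‖ ^ 2 : ℝ) := by
  rw [EuclideanSpace.norm_sq_eq]
  simp [normSqPoly, polyFun]

lemma normSqPoly_mul_monomial (β : Fin (d + 1) →₀ ℕ) (c : ℂ) :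
    normSqPoly d * monomial β c = ∑ j, monomial (β + Finsupp.single j 2) c := by
  rw [normSqPoly, Finset.sum_mul]
  refine Finset.sum_congr rfl fun j _ => ?_
  rw [MvPolynomial.X_pow_eq_monomial, MvPolynomial.monomial_mul, one_mul, add_comm β]

lemma normSqPoly_mul_mem_evenHom {k : ℕ} {p : Poly d} (hp : p ∈ evenHom d k) :
    normSqPoly d * p ∈ evenHom d (k + 2) := by
  constructor
  · rw [add_comm k]
    refine MvPolynomial.IsHomogeneous.mul ?_ hp.1
    exact MvPolynomial.IsHomogeneous.sum _ _ _ fun j _ => MvPolynomial.isHomogeneous_X_pow j 2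
  · refine mul_mem_evenPoly ?_ hp.2
    refine Submodule.sum_mem _ fun j _ β hβ => ?_
    rw [MvPolynomial.X_pow_eq_monomial, MvPolynomial.coeff_monomial, if_neg]
    rintro rfl
    have := (even_add_single_two 0 j).2 (by simp)
    rw [zero_add] at this
    exact hβ this

lemma sum_add_kappa (β : Fin (d + 1) →₀ ℕ) :
    ∑ j, ((β j : ℂ) + 1 + kappa α j) = β.degree + (d + 1) + (2 * α + 1) := by
  rw [Finset.sum_add_distrib, Finset.sum_add_distrib, Finsupp.degree_eq_sum]
  simp [kappa, apply_ite Complex.ofReal]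

/-- The moment recursion summed over the coordinates. Under the Gaussian integral, multiplying a
homogeneous polynomial by ‖x‖² is only a rescaling. -/
lemma gaussIntegral_normSqPoly_mul (hα : -1 / 2 < α) {k : ℕ} {p : Poly d}
    (hp : p.IsHomogeneous k) :
    2 * gaussIntegral hα (normSqPoly d * p) =
      (k + (d + 1) + (2 * α + 1)) * gaussIntegral hα p := by
  rw [p.as_sum, Finset.mul_sum, map_sum, map_sum, Finset.mul_sum, Finset.mul_sum]
  refine Finset.sum_congr rfl fun β hβ => ?_
  rw [normSqPoly_mul_monomial, map_sum, Finset.mul_sum]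
  simp only [gaussIntegral_monomial_add_single]
  rw [← Finset.sum_mul, sum_add_kappa]
  have : β.degree = k := by
    rw [hp.degree_eq_sum_deg_support hβ, Finsupp.degree_apply]
  rw [this]

/-- Green's identity in one coordinate. Both products involve the single moment of exponent β + γ -
2e_j, with coefficients differing by (β_j - γ_j)(β_j + γ_j - 1 + κ_j); the moment recursion absorbs
the second factor. -/
lemma gaussIntegral_mul_besselPoly (hα : -1 / 2 < α) {β γ : Fin (d + 1) →₀ ℕ} (j : Fin (d + 1))
    (hβ : Even (β (Fin.last d))) (hγ : Even (γ (Fin.last d))) (a b : ℂ) :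
    gaussIntegral hα (monomial γ b * besselPoly α j (monomial β a)) -
        gaussIntegral hα (monomial β a * besselPoly α j (monomial γ b)) =
      2 * ((β j : ℂ) - γ j) * gaussIntegral hα (monomial β a * monomial γ b) := by
  have key : ∀ (β γ : Fin (d + 1) →₀ ℕ) (a b : ℂ), Even (β (Fin.last d)) →
      gaussIntegral hα (monomial γ b * besselPoly α j (monomial β a)) =
        (β j * (β j - 1 + kappa α j)) *
          gaussIntegral hα (monomial (β + γ - Finsupp.single j 2) (a * b)) := by
    intro β γ a b hβ
    rw [besselPoly_monomial j hβ, MvPolynomial.monomial_mul]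
    by_cases h2 : 2 ≤ β j
    · have hle : Finsupp.single j 2 ≤ β := by rwa [Finsupp.single_le_iff]
      rw [← add_tsub_assoc_of_le hle, add_comm γ β, ← smul_eq_mul (a := _ * _), ← map_smul,
        MvPolynomial.smul_monomial, smul_eq_mul]
      congr 2
      ring
    · have h0 : (β j : ℂ) * (β j - 1 + kappa α j) = 0 := by
        obtain h0 | h1 : β j = 0 ∨ β j = 1 := by omega
        · simp [h0]
        · have hj : j ≠ Fin.last d := by
            rintro rfl
            rw [h1] at hβ
            simp at hβ
          simp [h1, kappa, hj]
      rw [h0]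
      simp
  rw [key β γ a b hβ, key γ β b a hγ, MvPolynomial.monomial_mul, add_comm γ β, mul_comm b a]
  by_cases h2 : 2 ≤ β j + γ j
  · have hle : Finsupp.single j 2 ≤ β + γ := by rwa [Finsupp.single_le_iff]
    have h := gaussIntegral_monomial_add_single hα (β + γ - Finsupp.single j 2) (a * b) j
    rw [tsub_add_cancel_of_le hle] at h
    have hj : (((β + γ - Finsupp.single j 2 : Fin (d + 1) →₀ ℕ) j : ℕ) : ℂ) = β j + γ j - 2 := by
      rw [Finsupp.tsub_apply, Finsupp.add_apply, Finsupp.single_eq_same, Nat.cast_sub h2]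
      push_cast
      ring
    rw [hj] at h
    linear_combination -((β j : ℂ) - γ j) * h
  -- Here β_j + γ_j ≤ 1. A sum of 1 cannot occur in the last coordinate, since both exponents there
  -- are even; elsewhere the odd moment vanishes.
  · have hodd : β j = γ j ∨ Odd ((β + γ : Fin (d + 1) →₀ ℕ) j) ∧ j ≠ Fin.last d := by
      obtain h0 | h1 : β j = γ j ∨ β j + γ j = 1 := by omega
      · exact Or.inl h0
      · refine Or.inr ⟨by rw [Finsupp.add_apply, h1]; exact odd_one, ?_⟩
        rintro rfl
        have := hβ.add hγ
        rw [h1] at this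
        simp at this
    rcases hodd with h | ⟨h, hj⟩
    · rw [h]
      ring
    · rw [gaussIntegral_monomial_of_odd hα _ _ hj h]
      have : kappa α j = 0 := by simp [kappa, hj]
      rw [this]
      obtain ⟨h1, h3⟩ | ⟨h1, h3⟩ : β j = 0 ∧ γ j = 1 ∨ β j = 1 ∧ γ j = 0 := by
        rw [Finsupp.add_apply] at h
        have := h.pos
        omega
      · simp [h1, h3]
      · simp [h1, h3]

/-- Green's identity for the Gaussian weight. -/
lemma gaussIntegral_green (hα : -1 / 2 < α) {k l : ℕ} {p q : Poly d} (hp : p ∈ evenHom d k)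
    (hq : q ∈ evenHom d l) :
    2 * ((k : ℂ) - l) * gaussIntegral hα (p * q) =
      gaussIntegral hα (q * weinsteinPoly d α p) - gaussIntegral hα (p * weinsteinPoly d α q) := by
  have hmono : ∀ β ∈ p.support, ∀ γ ∈ q.support, 
      gaussIntegral hα (monomial γ (coeff γ q) * weinsteinPoly d α (monomial β (coeff β p))) -
        gaussIntegral hα (monomial β (coeff β p) * weinsteinPoly d α (monomial γ (coeff γ q))) =
      2 * ((k : ℂ) - l) *
        gaussIntegral hα (monomial β (coeff β p) * monomial γ (coeff γ q)) := by
    intro β hβ γ hγ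
    rw [weinsteinPoly_apply, weinsteinPoly_apply, Finset.mul_sum, Finset.mul_sum, map_sum, map_sum,
      ← Finset.sum_sub_distrib]
    simp only [gaussIntegral_mul_besselPoly hα _ (even_of_mem_support hp.2 hβ)
      (even_of_mem_support hq.2 hγ)]
    rw [← Finset.sum_mul, ← Finset.mul_sum, Finset.sum_sub_distrib, ← Nat.cast_sum, ← Nat.cast_sum,
      ← Finsupp.degree_eq_sum, ← Finsupp.degree_eq_sum]
    have h1 : β.degree = k := by rw [hp.1.degree_eq_sum_deg_support hβ, Finsupp.degree_apply]
    have h2 : γ.degree = l := by rw [hq.1.degree_eq_sum_deg_support hγ, Finsupp.degree_apply]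
    rw [h1, h2]
  have e1 : gaussIntegral hα (p * q) = ∑ β ∈ p.support, ∑ γ ∈ q.support,
      gaussIntegral hα (monomial β (coeff β p) * monomial γ (coeff γ q)) := by
    conv_lhs => rw [p.as_sum, q.as_sum]
    simp only [Finset.sum_mul_sum, map_sum]
  have e2 : ∀ p q : Poly d, gaussIntegral hα (q * weinsteinPoly d α p) =
      ∑ β ∈ p.support, ∑ γ ∈ q.support,
      gaussIntegral hα (monomial γ (coeff γ q) * weinsteinPoly d α (monomial β (coeff β p))) := by
    intro p q
    conv_lhs => rw [p.as_sum, q.as_sum]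
    simp only [map_sum, Finset.sum_mul_sum]
    exact Finset.sum_comm
  rw [e1, e2 p q, e2 q p, Finset.sum_comm (s := q.support), ← Finset.sum_sub_distrib,
    Finset.mul_sum]
  refine Finset.sum_congr rfl fun β hβ => ?_
  rw [← Finset.sum_sub_distrib, Finset.mul_sum]
  exact Finset.sum_congr rfl fun γ hγ => (hmono β hβ γ hγ).symm

/-- Homogeneous even polynomials annihilated by the Weinstein operator. -/
def harmonicPoly (d : ℕ) (α : ℝ) (l : ℕ) : Submodule ℂ (Poly d) :=
  evenHom d l ⊓ LinearMap.ker (weinsteinPoly d α)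

instance (l : ℕ) : FiniteDimensional ℂ (harmonicPoly d α l) :=
  Submodule.finiteDimensional_inf_left _ _

lemma gaussIntegral_mul_harmonic (hα : -1 / 2 < α) {k l : ℕ} {p P : Poly d} (hp : p ∈ evenHom d k)
    (hP : P ∈ harmonicPoly d α l) :
    2 * ((k : ℂ) - l) * gaussIntegral hα (p * P) =
      gaussIntegral hα (weinsteinPoly d α p * P) := by
  have h0 : weinsteinPoly d α P = 0 := hP.2
  rw [gaussIntegral_green hα hp hP.1, h0, mul_zero, map_zero, sub_zero, mul_comm]

/-- Green's identity replaces p by Δp, of degree k - 2, at the cost of the nonzero factor 2(k - l).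
The descent ends in degree 0 or 1, where Δ vanishes. -/
lemma gaussIntegral_mul_harmonic_eq_zero (hα : -1 / 2 < α) {k l : ℕ} (hkl : k < l) {p P : Poly d}
    (hp : p ∈ evenHom d k) (hP : P ∈ harmonicPoly d α l) :
    gaussIntegral hα (p * P) = 0 := by
  have hne : 2 * ((k : ℂ) - l) ≠ 0 := by
    have : (k : ℂ) ≠ l := by exact_mod_cast hkl.ne
    simpa [sub_eq_zero] using this
  induction k using Nat.strong_induction_on generalizing p with
  | _ k ih =>
    have h := gaussIntegral_mul_harmonic hα hp hP
    have h2 : gaussIntegral hα (weinsteinPoly d α p * P) = 0 := by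
      by_cases hk : k < 2
      · rw [weinsteinPoly_eq_zero_of_lt hk hp, zero_mul, map_zero]
      · obtain ⟨m, rfl⟩ : ∃ m, k = m + 2 := ⟨k - 2, by omega⟩
        refine ih m (by omega) (by omega) (weinsteinPoly_mem_evenHom hp) ?_
        have : (m : ℂ) ≠ l := by exact_mod_cast (show m ≠ l by omega)
        simpa [sub_eq_zero] using this
    rw [h2] at h
    exact (mul_eq_zero.1 h).resolve_left hne

/-- Complex conjugation of the coefficients. -/
def conjPoly (p : Poly d) : Poly d := MvPolynomial.map (starRingEnd ℂ) p

lemma polyFun_conjPoly (p : Poly d) (x : Space d) :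
    polyFun (conjPoly p) x = starRingEnd ℂ (polyFun p x) := by
  induction p using MvPolynomial.induction_on with
  | C a => simp [conjPoly]
  | add p q hp hq => simp_all [conjPoly]
  | mul_X p j hp => simp_all [conjPoly]

lemma conjPoly_mem_evenHom {k : ℕ} {p : Poly d} (hp : p ∈ evenHom d k) :
    conjPoly p ∈ evenHom d k := by
  rw [mem_evenHom_iff_coeff] at hp ⊢
  intro β hβ
  rw [conjPoly, MvPolynomial.coeff_map, hp β hβ, map_zero]

lemma eq_zero_of_polyFun_eq_zero {p : Poly d} (h : ∀ x ∈ halfSpace d, polyFun p x = 0) :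
    p = 0 := by
  refine MvPolynomial.funext_set (fun _ => (fun r : ℝ => (r : ℂ)) '' Set.Ioi 0)
    (fun _ => (Set.Ioi_infinite 0).image Complex.ofReal_injective.injOn) fun y hy => ?_
  have hy' : ∀ j, ∃ r : ℝ, 0 < r ∧ (r : ℂ) = y j := fun j => hy j (Set.mem_univ j)
  choose r hr hry using hy'
  have := h (WithLp.toLp 2 r) (hr _)
  simp only [polyFun, hry] at this
  simpa using this

/-- The Gaussian pairing is positive definite: |p|² vanishes almost everywhere on the half-space,
then everywhere on it by continuity. The injectivity of H and of q ↦ Δ(‖x‖²q) both come from this.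
-/
lemma eq_zero_of_gaussIntegral_conj (hα : -1 / 2 < α) {p : Poly d}
    (h : gaussIntegral hα (conjPoly p * p) = 0) : p = 0 := by
  apply eq_zero_of_polyFun_eq_zero
  have e : ∀ x : Space d, polyFun (conjPoly p * p) x * gauss x =
      ((‖polyFun p x‖ ^ 2 * Real.exp (-‖x‖ ^ 2) : ℝ) : ℂ) := by
    intro x
    rw [polyFun_mul, polyFun_conjPoly, Complex.conj_mul', gauss]
    push_cast
    ring
  rw [gaussIntegral_apply] at h
  have hint := integrable_polyFun_mul_gauss hα (conjPoly p * p)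
  simp only [e] at h hint
  have hint := hint.re
  simp only [RCLike.re_to_complex, Complex.ofReal_re] at hint
  rw [integral_complex_ofReal, Complex.ofReal_eq_zero, integral_eq_zero_iff_of_nonneg
    (fun x => by positivity) hint] at h
  have h2 : ∀ᵐ x ∂(volume.restrict (halfSpace d)), polyFun p x = 0 := by
    rw [weightedMeasure, Filter.EventuallyEq, ae_withDensity_iff (measurable_weight α)] at h
    filter_upwards [h, ae_restrict_mem measurableSet_halfSpace] with x hx hx'
    have hx0 : 0 < x (Fin.last d) := hx'
    have := hx (by simpa using Real.rpow_pos_of_pos hx0 _)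
    simpa [(Real.exp_pos _).ne'] using this
  exact Measure.eqOn_open_of_ae_eq h2 isOpen_halfSpace (continuous_polyFun p).continuousOn
    continuousOn_const

end Weinstein

end

noncomputable section

namespace Weinstein

variable {d : ℕ} {α : ℝ}

/-! ### Spherical harmonics as polynomials in the kernel of the algebraic operator -/

open MvPolynomial (monomial coeff pderiv)

@[simp] lemma polyFun_zero (x : Space d) : polyFun (0 : Poly d) x = 0 := by simp [polyFun]

/-- Substitution of `-x_{d+1}` for `x_{d+1}` in a polynomial. -/
def reflectPoly (p : Poly d) : Poly d :=
  ∑ β ∈ p.support, monomial β ((-1) ^ β (Fin.last d) * coeff β p)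

lemma coeff_reflectPoly (p : Poly d) (β : Fin (d + 1) →₀ ℕ) :
    coeff β (reflectPoly p) = (-1) ^ β (Fin.last d) * coeff β p := by
  rw [reflectPoly, MvPolynomial.coeff_sum]
  simp only [MvPolynomial.coeff_monomial]
  rw [Finset.sum_ite_eq']
  split_ifs with h
  · rfl
  · rw [MvPolynomial.notMem_support_iff.1 h, mul_zero]

lemma reflectLast_last (x : Space d) : reflectLast x (Fin.last d) = -x (Fin.last d) := by
  simp [reflectLast]

lemma reflectLast_castSucc (x : Space d) (j : Fin d) :
    reflectLast x j.castSucc = x j.castSucc := by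
  simp [reflectLast, (Fin.castSucc_lt_last j).ne]

lemma polyFun_reflectPoly (p : Poly d) (x : Space d) :
    polyFun (reflectPoly p) x = polyFun p (reflectLast x) := by
  conv_rhs => rw [p.as_sum]
  rw [reflectPoly, polyFun_sum, polyFun_sum]
  refine Finset.sum_congr rfl fun β _ => ?_
  rw [polyFun_monomial, polyFun_monomial, Fin.prod_univ_castSucc, Fin.prod_univ_castSucc]
  simp only [reflectLast_castSucc, reflectLast_last]
  push_cast
  rw [neg_pow (x (Fin.last d) : ℂ)]
  ring

lemma evenInLast_polyFun_iff (p : Poly d) : EvenInLast (polyFun p) ↔ p ∈ evenPoly d := by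
  have h1 : EvenInLast (polyFun p) ↔ reflectPoly p = p := by
    constructor
    · intro h
      rw [← sub_eq_zero]
      refine eq_zero_of_polyFun_eq_zero fun x _ => ?_
      rw [polyFun_sub, polyFun_reflectPoly, h x, sub_self]
    · intro h x
      rw [← polyFun_reflectPoly, h]
  rw [h1, mem_evenPoly, MvPolynomial.ext_iff]
  refine forall_congr' fun β => ?_
  rw [coeff_reflectPoly]
  rcases Nat.even_or_odd (β (Fin.last d)) with h | h
  · simp [h]
  · rw [h.neg_one_pow, neg_one_mul, neg_eq_self]
    simp [h]

lemma differentiable_polyFun (p : Poly d) : Differentiable ℝ (polyFun p) := by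
  induction p using MvPolynomial.induction_on with
  | C a => simp only [funext (polyFun_C a)]; fun_prop
  | add p q hp hq => simp only [funext (polyFun_add p q)]; fun_prop
  | mul_X p j hp =>
    simp only [funext (polyFun_mul p (MvPolynomial.X j)), polyFun_X]
    have : Differentiable ℝ fun x : Space d => (x j : ℂ) :=
      (Complex.ofRealCLM.comp (EuclideanSpace.proj (𝕜 := ℝ) j)).differentiable
    fun_prop

lemma partialDeriv_polyFun (j : Fin (d + 1)) (p : Poly d) :
    partialDeriv j (polyFun p) = polyFun (pderiv j p) := by
  induction p using MvPolynomial.induction_on with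
  | C a =>
    ext x
    simp [partialDeriv, funext (polyFun_C a)]
  | add p q hp hq =>
    ext x
    have h1 := congrFun hp x
    have h2 := congrFun hq x
    simp only [partialDeriv] at h1 h2 ⊢
    rw [funext (polyFun_add p q),
      fderiv_fun_add (differentiable_polyFun p x) (differentiable_polyFun q x)]
    simp [h1, h2]
  | mul_X p i hp =>
    ext x
    have h1 := congrFun hp x
    have hi : HasFDerivAt (fun x : Space d => (x i : ℂ))
        (Complex.ofRealCLM.comp (EuclideanSpace.proj (𝕜 := ℝ) i)) x :=
      (Complex.ofRealCLM.comp (EuclideanSpace.proj (𝕜 := ℝ) i)).hasFDerivAt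
    simp only [partialDeriv] at h1 ⊢
    simp only [funext (polyFun_mul p (MvPolynomial.X i)), polyFun_X]
    rw [fderiv_fun_mul (differentiable_polyFun p x) hi.differentiableAt, hi.fderiv]
    simp [h1, MvPolynomial.pderiv_X, Pi.single_apply]
    split_ifs <;> simp_all [mul_comm]

/-- The derivative of an even polynomial is odd in the last variable, so the division discards
nothing. -/
lemma X_mul_divMonomial_pderiv {p : Poly d} (hp : p ∈ evenPoly d) :
    MvPolynomial.X (Fin.last d) *
      (pderiv (Fin.last d) p).divMonomial (Finsupp.single (Fin.last d) 1) =
        pderiv (Fin.last d) p := by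
  classical
  ext γ
  rw [MvPolynomial.coeff_X_mul']
  split_ifs with h
  · have hle : Finsupp.single (Fin.last d) 1 ≤ γ := by
      rw [Finsupp.single_le_iff]
      exact Nat.one_le_iff_ne_zero.2 (Finsupp.mem_support_iff.1 h)
    rw [MvPolynomial.coeff_divMonomial, add_tsub_cancel_of_le hle]
  · rw [MvPolynomial.coeff_pderiv, hp, zero_mul]
    rw [Finsupp.notMem_support_iff] at h
    simp [h]

lemma weinsteinOperator_polyFun {p : Poly d} (hp : p ∈ evenPoly d) {x : Space d}
    (hx : x ∈ halfSpace d) :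
    weinsteinOperator α (polyFun p) x = polyFun (weinsteinPoly d α p) x := by
  have hx0 : (x (Fin.last d) : ℂ) ≠ 0 := by
    have : 0 < x (Fin.last d) := hx
    exact_mod_cast this.ne'
  have h2 : polyFun (weinsteinPoly d α p) x = (∑ j, polyFun (pderiv j (pderiv j p)) x) +
      ((2 * α + 1 : ℝ) : ℂ) *
        polyFun ((pderiv (Fin.last d) p).divMonomial (Finsupp.single (Fin.last d) 1)) x := by
    rw [weinsteinPoly_apply, polyFun_sum]
    simp only [besselPoly, LinearMap.coe_mk, AddHom.coe_mk, polyFun_add, polyFun_smul,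
      Finset.sum_add_distrib]
    congr 1
    rw [Finset.sum_eq_single (Fin.last d)]
    · simp [kappa]
    · intro j _ hj
      simp [kappa, hj]
    · simp
  rw [weinsteinOperator, h2]
  simp only [partialDeriv_polyFun]
  have h3 := congrArg (fun q => polyFun q x) (X_mul_divMonomial_pderiv hp)
  simp only [polyFun_mul, polyFun_X] at h3
  rw [← h3]
  push_cast
  field_simp

/-- Replaces the analytic condition on the half-space by membership in a finite-dimensional kernel.
-/
lemma mem_sphericalHarmonics_iff {l : ℕ} {P : Poly d} :
    P ∈ sphericalHarmonics d α l ↔ P ∈ harmonicPoly d α l := by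
  constructor
  · rintro ⟨h1, h2, h3⟩
    rw [evenInLast_polyFun_iff] at h2
    refine ⟨⟨h1, h2⟩, eq_zero_of_polyFun_eq_zero fun x hx => ?_⟩
    rw [← weinsteinOperator_polyFun h2 hx, h3 x hx]
  · rintro ⟨⟨h1, h2⟩, h3⟩
    refine ⟨h1, (evenInLast_polyFun_iff P).2 h2, fun x hx => ?_⟩
    have h3' : weinsteinPoly d α P = 0 := h3
    rw [weinsteinOperator_polyFun h2 hx, h3']
    simp [polyFun]

end Weinstein

end

noncomputable section

namespace Weinstein

variable {d : ℕ} {α : ℝ}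

/-! ### Homogeneous expansion of the kernel -/

open MvPolynomial (monomial coeff)

lemma sum_antidiagonal_pow_div_factorial (a b : ℝ) (k : ℕ) :
    ∑ x ∈ Finset.HasAntidiagonal.antidiagonal k,
        a ^ x.1 / (x.1.factorial : ℝ) * (b ^ x.2 / (x.2.factorial : ℝ)) =
      (a + b) ^ k / k.factorial := by
  rw [(Commute.all a b).add_pow', Finset.sum_div]
  refine Finset.sum_congr rfl fun x hx => ?_
  rw [Finset.HasAntidiagonal.mem_antidiagonal] at hx
  subst hx
  rw [nsmul_eq_mul, Nat.cast_add_choose ℝ]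
  have h1 : ((x.1 + x.2).factorial : ℝ) ≠ 0 := by positivity
  have h2 : (x.1.factorial : ℝ) ≠ 0 := by positivity
  have h3 : (x.2.factorial : ℝ) ≠ 0 := by positivity
  field_simp

/-- Cauchy products of series dominated by exp(a_j) are dominated, degree by degree, by exp(∑ a_j);
formal power series do the grouping by total degree. Bound and sum are proved together because the
inductive step for the sum needs the absolute summability that the bound gives. -/
lemma coeff_prod_mk_bound_and_hasSum {ι : Type*} (s : Finset ι) (f : ι → ℕ → ℂ) (a : ι → ℝ)
    (ha : ∀ j, 0 ≤ a j) (hf : ∀ j n, ‖f j n‖ ≤ a j ^ n / (n.factorial : ℝ)) :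
    (∀ k, ‖PowerSeries.coeff k (∏ j ∈ s, PowerSeries.mk (f j))‖ ≤
      (∑ j ∈ s, a j) ^ k / (k.factorial : ℝ)) ∧
    HasSum (fun k => PowerSeries.coeff k (∏ j ∈ s, PowerSeries.mk (f j)))
      (∏ j ∈ s, ∑' n, f j n) := by
  classical
  induction s using Finset.induction_on with
  | empty =>
    constructor
    · intro k
      rcases k with _ | k <;> simp [PowerSeries.coeff_one]
    · simp only [Finset.prod_empty, PowerSeries.coeff_one]
      exact hasSum_ite_eq 0 1
  | insert i s hi ih =>
    have h0 : 0 ≤ ∑ j ∈ s, a j := Finset.sum_nonneg fun j _ => ha j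
    have hs1 : Summable fun n => ‖f i n‖ :=
      Summable.of_nonneg_of_le (fun _ => norm_nonneg _) (hf i) (Real.summable_pow_div_factorial _)
    have hs2 : Summable fun k => ‖PowerSeries.coeff k (∏ j ∈ s, PowerSeries.mk (f j))‖ :=
      Summable.of_nonneg_of_le (fun _ => norm_nonneg _) ih.1 (Real.summable_pow_div_factorial _)
    simp only [Finset.prod_insert hi, Finset.sum_insert hi, PowerSeries.coeff_mul,
      PowerSeries.coeff_mk]
    constructor
    · intro k
      rw [← sum_antidiagonal_pow_div_factorial]
      refine (norm_sum_le _ _).trans (Finset.sum_le_sum fun x _ => ?_)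
      rw [norm_mul]
      have := ha i
      exact mul_le_mul (hf i _) (ih.1 _) (norm_nonneg _) (by positivity)
    · rw [← ih.2.tsum_eq, tsum_mul_tsum_eq_tsum_sum_antidiagonal_of_summable_norm hs1 hs2]
      exact (summable_norm_sum_mul_antidiagonal_of_summable_norm hs1 hs2).of_norm.hasSum

/-- The Taylor coefficients of the factor of the kernel that depends on the `j`-th coordinate. -/
def coordCoeff (α : ℝ) (j : Fin (d + 1)) (n : ℕ) : ℂ :=
  if j = Fin.last d then besselCoeff α n else (-I) ^ n / (n.factorial : ℂ)

/-- Each one-variable factor of the kernel is an eigenfunction of ∂² + (κ_j/x)∂ with eigenvalue -1.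
-/
lemma coordCoeff_rec (hα : -1 / 2 < α) (j : Fin (d + 1)) (n : ℕ) :
    coordCoeff α j (n + 2) * ((n + 2) * (n + 1 + kappa α j)) = -coordCoeff α j n := by
  by_cases hj : j = Fin.last d
  · simp only [coordCoeff, hj, if_true, kappa]
    have := besselCoeff_rec hα n
    push_cast
    exact this
  · simp only [coordCoeff, hj, if_false, kappa, Nat.factorial_succ]
    have h3 : (n.factorial : ℂ) ≠ 0 := by exact_mod_cast n.factorial_ne_zero
    have h1 : (n + 1 : ℂ) ≠ 0 := by exact_mod_cast n.succ_ne_zero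
    have h2 : (n + 1 + 1 : ℂ) ≠ 0 := by exact_mod_cast (n + 1).succ_ne_zero
    push_cast
    rw [pow_add, neg_sq, I_sq]
    field_simp
    ring

lemma norm_coordCoeff_le (hα : -1 / 2 < α) (j : Fin (d + 1)) (n : ℕ) :
    ‖coordCoeff α j n‖ ≤ ((n.factorial : ℝ))⁻¹ := by
  unfold coordCoeff
  split_ifs
  · exact norm_besselCoeff_le hα n
  · simp

lemma coordCoeff_ne_zero (hα : -1 / 2 < α) {β : Fin (d + 1) →₀ ℕ} (hβ : Even (β (Fin.last d)))
    (j : Fin (d + 1)) : coordCoeff α j (β j) ≠ 0 := by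
  unfold coordCoeff
  split_ifs with hj
  · subst hj
    obtain ⟨m, hm⟩ := even_iff_exists_two_mul.1 hβ
    rw [hm]
    exact besselCoeff_ne_zero hα m
  · exact div_ne_zero (pow_ne_zero _ (by simp)) (by exact_mod_cast Nat.factorial_ne_zero _)

/-- The coefficient of `x^β ξ^β` in the kernel. -/
def kernelCoeff (α : ℝ) (β : Fin (d + 1) →₀ ℕ) : ℂ := ∏ j, coordCoeff α j (β j)

lemma kernelCoeff_ne_zero (hα : -1 / 2 < α) {β : Fin (d + 1) →₀ ℕ} (hβ : Even (β (Fin.last d))) :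
    kernelCoeff α β ≠ 0 :=
  Finset.prod_ne_zero_iff.2 fun j _ => coordCoeff_ne_zero hα hβ j

lemma kernelCoeff_eq_zero {β : Fin (d + 1) →₀ ℕ} (hβ : ¬Even (β (Fin.last d))) :
    kernelCoeff α β = 0 :=
  Finset.prod_eq_zero (Finset.mem_univ (Fin.last d)) (by simp [coordCoeff, besselCoeff, hβ])

lemma kernelCoeff_add_single (hα : -1 / 2 < α) (β : Fin (d + 1) →₀ ℕ) (j : Fin (d + 1)) :
    kernelCoeff α (β + Finsupp.single j 2) * ((β j + 2) * (β j + 1 + kappa α j)) =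
      -kernelCoeff α β := by
  rw [kernelCoeff, kernelCoeff, ← Finset.mul_prod_erase _ _ (Finset.mem_univ j),
    ← Finset.mul_prod_erase _ (fun i => coordCoeff α i (β i)) (Finset.mem_univ j)]
  have h : ∏ i ∈ Finset.univ.erase j,
      coordCoeff α i ((β + Finsupp.single j 2 : Fin (d + 1) →₀ ℕ) i) =
      ∏ i ∈ Finset.univ.erase j, coordCoeff α i (β i) := by
    refine Finset.prod_congr rfl fun i hi => ?_
    rw [Finsupp.add_apply, Finsupp.single_eq_of_ne (Finset.ne_of_mem_erase hi), add_zero]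
  rw [h, Finsupp.add_apply, Finsupp.single_eq_same]
  linear_combination (∏ i ∈ Finset.univ.erase j, coordCoeff α i (β i)) * coordCoeff_rec hα j (β j)

/-- The homogeneous component of degree `k` of the kernel, as a polynomial in one variable
depending on the other. -/
def kernelPoly (α : ℝ) (x : Space d) (k : ℕ) : Poly d :=
  ∑ β ∈ Finset.finsuppAntidiag Finset.univ k, monomial β (kernelCoeff α β * ∏ j, (x j : ℂ) ^ β j)

lemma mem_finsuppAntidiag_univ {β : Fin (d + 1) →₀ ℕ} {k : ℕ} :
    β ∈ Finset.finsuppAntidiag Finset.univ k ↔ β.degree = k := by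
  simp [Finset.mem_finsuppAntidiag, Finsupp.degree_eq_sum]

lemma coeff_sum_finsuppAntidiag (f : (Fin (d + 1) →₀ ℕ) → ℂ) (k : ℕ) (β : Fin (d + 1) →₀ ℕ) :
    coeff β (∑ γ ∈ Finset.finsuppAntidiag Finset.univ k, monomial γ (f γ)) =
      if β.degree = k then f β else 0 := by
  rw [MvPolynomial.coeff_sum]
  simp only [MvPolynomial.coeff_monomial]
  rw [Finset.sum_ite_eq']
  simp only [mem_finsuppAntidiag_univ]

lemma coeff_kernelPoly (x : Space d) (k : ℕ) (β : Fin (d + 1) →₀ ℕ) :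
    coeff β (kernelPoly α x k) =
      if β.degree = k then kernelCoeff α β * ∏ j, (x j : ℂ) ^ β j else 0 :=
  coeff_sum_finsuppAntidiag _ _ _

lemma kernelPoly_mem_evenHom (x : Space d) (k : ℕ) : kernelPoly α x k ∈ evenHom d k := by
  rw [mem_evenHom_iff_coeff]
  intro β hβ
  rw [coeff_kernelPoly]
  split_ifs with h
  · rw [kernelCoeff_eq_zero fun h' => hβ ⟨h, h'⟩, zero_mul]
  · rfl

lemma prod_pow_add_single (x : Space d) (β : Fin (d + 1) →₀ ℕ) (j : Fin (d + 1)) :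
    ∏ i, (x i : ℂ) ^ (β + Finsupp.single j 2 : Fin (d + 1) →₀ ℕ) i =
      (x j : ℂ) ^ 2 * ∏ i, (x i : ℂ) ^ β i := by
  simp only [Finsupp.add_apply, pow_add, Finset.prod_mul_distrib]
  rw [mul_comm, Finset.prod_eq_single j]
  · simp
  · intro i _ hi
    simp [Finsupp.single_eq_of_ne hi]
  · simp

/-- The eigenfunction equation Δ_ξ K(ξ, x) = -‖x‖² K(ξ, x), one degree at a time. -/
lemma weinsteinPoly_kernelPoly (hα : -1 / 2 < α) (x : Space d) (k : ℕ) :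
    weinsteinPoly d α (kernelPoly α x (k + 2)) =
      (-(‖x‖ ^ 2 : ℝ) : ℂ) • kernelPoly α x k := by
  ext β
  rw [coeff_weinsteinPoly, MvPolynomial.coeff_smul, coeff_kernelPoly]
  simp only [coeff_kernelPoly, degree_add_single, add_left_inj, prod_pow_add_single]
  split_ifs with h
  · rw [EuclideanSpace.norm_sq_eq]
    push_cast
    rw [smul_eq_mul, ← Finset.sum_neg_distrib, Finset.sum_mul]
    refine Finset.sum_congr rfl fun j _ => ?_
    have h2 : ((‖x j‖ : ℝ) : ℂ) ^ 2 = (x j : ℂ) ^ 2 := by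
      rw [Real.norm_eq_abs]
      exact_mod_cast sq_abs (x j)
    rw [h2]
    linear_combination (x j : ℂ) ^ 2 * (∏ i, (x i : ℂ) ^ β i) * kernelCoeff_add_single hα β j
  · simp

lemma polyFun_kernelPoly (x t : Space d) (k : ℕ) :
    polyFun (kernelPoly α x k) t = PowerSeries.coeff k
      (∏ j, PowerSeries.mk fun n => coordCoeff α j n * ((x j : ℂ) * t j) ^ n) := by
  rw [PowerSeries.coeff_prod, kernelPoly, polyFun_sum]
  refine Finset.sum_congr rfl fun β _ => ?_
  rw [polyFun_monomial, kernelCoeff]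
  simp only [PowerSeries.coeff_mk, mul_pow, Finset.prod_mul_distrib]
  ring

/-- A crude majorant, the factor d + 1 counting coordinates. It serves for convergence and for
estimates near z = 0; the sharp exponential rate is that of `norm_kernel_le`. -/
lemma norm_polyFun_kernelPoly_le (hα : -1 / 2 < α) (x t : Space d) (k : ℕ) :
    ‖polyFun (kernelPoly α x k) t‖ ≤ ((d + 1) * ‖x‖ * ‖t‖) ^ k / (k.factorial : ℝ) := by
  rw [polyFun_kernelPoly]
  have h := (coeff_prod_mk_bound_and_hasSum Finset.univ
    (fun j n => coordCoeff α j n * ((x j : ℂ) * t j) ^ n) (fun _ => ‖x‖ * ‖t‖)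
    (fun _ => by positivity) (fun j n => by
      rw [norm_mul, div_eq_inv_mul, norm_pow, norm_mul, Complex.norm_real, Complex.norm_real]
      gcongr
      · exact norm_coordCoeff_le hα j n
      · exact PiLp.norm_apply_le x j
      · exact PiLp.norm_apply_le t j)).1 k
  refine h.trans (le_of_eq ?_)
  simp [mul_assoc]

lemma tsum_coordCoeff_castSucc (α : ℝ) (j : Fin d) (w : ℂ) :
    ∑' n, coordCoeff α j.castSucc n * w ^ n = cexp (-I * w) := by
  rw [Complex.exp_eq_exp_ℂ, NormedSpace.exp_eq_tsum_div]
  refine tsum_congr fun n => ?_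
  rw [coordCoeff, if_neg (Fin.castSucc_lt_last j).ne, mul_pow]
  ring

lemma tsum_coordCoeff_last (hα : -1 / 2 < α) (w : ℂ) :
    ∑' n, coordCoeff α (Fin.last d) n * w ^ n = normalizedBessel α w := by
  simp only [coordCoeff, if_true]
  exact (hasSum_normalizedBessel hα w).tsum_eq

lemma kernel_eq_prod (hα : -1 / 2 < α) (y : Fin (d + 1) → ℂ) (x : Space d) :
    kernel α y x = ∏ j, ∑' n, coordCoeff α j n * ((x j : ℂ) * y j) ^ n := by
  rw [Fin.prod_univ_castSucc, tsum_coordCoeff_last hα, kernel]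
  simp only [tsum_coordCoeff_castSucc]
  rw [← Complex.exp_sum, Finset.mul_sum]

lemma hasSum_kernelPoly (hα : -1 / 2 < α) (z : ℂ) (x t : Space d) :
    HasSum (fun k => z ^ k * polyFun (kernelPoly α x k) t) (kernel α (fun j => z * t j) x) := by
  have h := (coeff_prod_mk_bound_and_hasSum Finset.univ
    (fun j n => coordCoeff α j n * ((x j : ℂ) * (z * t j)) ^ n) (fun _ => ‖z‖ * ‖x‖ * ‖t‖)
    (fun _ => by positivity) (fun j n => by
      rw [norm_mul, div_eq_inv_mul, norm_pow, norm_mul, norm_mul, Complex.norm_real,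
        Complex.norm_real, mul_assoc, mul_left_comm]
      gcongr
      · exact norm_coordCoeff_le hα j n
      · exact PiLp.norm_apply_le x j
      · exact PiLp.norm_apply_le t j)).2
  rw [kernel_eq_prod hα]
  convert h using 1
  funext k
  rw [polyFun_kernelPoly, PowerSeries.coeff_prod, PowerSeries.coeff_prod, Finset.mul_sum]
  refine Finset.sum_congr rfl fun β hβ => ?_
  have hk : ∑ j, β j = k := (Finset.mem_finsuppAntidiag.1 hβ).1
  simp only [PowerSeries.coeff_mk]
  rw [← hk, ← Finset.prod_pow_eq_pow_sum, ← Finset.prod_mul_distrib]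
  refine Finset.prod_congr rfl fun j _ => ?_
  ring

lemma hasSum_kernelPoly_real (hα : -1 / 2 < α) (x t : Space d) :
    HasSum (fun k => polyFun (kernelPoly α x k) t) (kernel α (fun j => (t j : ℂ)) x) := by
  simpa using hasSum_kernelPoly hα 1 x t

lemma kernel_real_smul (r : ℝ) (y x : Space d) :
    kernel α (fun j => ((r • y) j : ℂ)) x = kernel α (fun j => (y j : ℂ)) (r • x) := by
  simp only [kernel, PiLp.smul_apply, smul_eq_mul, Complex.ofReal_mul]
  congr 2
  · congr 1
    exact Finset.sum_congr rfl fun j _ => by ring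
  · ring

/-- Each coordinate contributes |x_j t_j||Im z| to the exponent, and Cauchy–Schwarz for the vectors
of absolute values gives exactly ‖x‖‖t‖. Any loss here would change the radius R in the theorem. -/
lemma norm_kernel_le (hα : -1 / 2 < α) (z : ℂ) (x t : Space d) :
    ‖kernel α (fun j => z * t j) x‖ ≤ Real.exp (‖x‖ * ‖t‖ * |z.im|) := by
  set a : Space d := WithLp.toLp 2 fun j => |x j|
  set b : Space d := WithLp.toLp 2 fun j => |t j|
  have h1 : ‖cexp (-I * ∑ j : Fin d, (x j.castSucc : ℂ) * (z * t j.castSucc))‖ ≤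
      Real.exp (∑ j : Fin d, |x j.castSucc| * |t j.castSucc| * |z.im|) := by
    rw [Complex.norm_exp]
    apply Real.exp_le_exp.2
    have : (-I * ∑ j : Fin d, (x j.castSucc : ℂ) * (z * t j.castSucc)).re =
        ∑ j : Fin d, x j.castSucc * t j.castSucc * z.im := by
      simp
      exact Finset.sum_congr rfl fun j _ => by ring
    rw [this]
    refine Finset.sum_le_sum fun j _ => ?_
    rw [← abs_mul, ← abs_mul]
    exact le_abs_self _
  have h2 : ‖normalizedBessel α ((x (Fin.last d) : ℂ) * (z * t (Fin.last d)))‖ ≤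
      Real.exp (|x (Fin.last d)| * |t (Fin.last d)| * |z.im|) := by
    refine (norm_normalizedBessel_le hα _).trans (Real.exp_le_exp.2 (le_of_eq ?_))
    rw [← abs_mul, ← abs_mul]
    simp
    ring_nf
  have h3 : ∑ j, |x j| * |t j| ≤ ‖x‖ * ‖t‖ := by
    have h := real_inner_le_norm b a
    have ha : ‖a‖ = ‖x‖ := by simp [EuclideanSpace.norm_eq, a]
    have hb : ‖b‖ = ‖t‖ := by simp [EuclideanSpace.norm_eq, b]
    rw [ha, hb, mul_comm ‖t‖] at h
    refine le_trans (le_of_eq ?_) h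
    simp [PiLp.inner_apply, a, b]
  rw [kernel, norm_mul]
  calc _ ≤ Real.exp (∑ j : Fin d, |x j.castSucc| * |t j.castSucc| * |z.im|) *
        Real.exp (|x (Fin.last d)| * |t (Fin.last d)| * |z.im|) := by gcongr
    _ = Real.exp ((∑ j, |x j| * |t j|) * |z.im|) := by
      rw [← Real.exp_add, Fin.sum_univ_castSucc, add_mul, Finset.sum_mul]
    _ ≤ _ := by gcongr

lemma norm_kernel_real_le (hα : -1 / 2 < α) (t x : Space d) :
    ‖kernel α (fun j => (t j : ℂ)) x‖ ≤ 1 := by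
  simpa using norm_kernel_le hα 1 x t

lemma continuous_kernel (hα : -1 / 2 < α) :
    Continuous fun p : (Fin (d + 1) → ℂ) × Space d => kernel α p.1 p.2 := by
  have := (differentiable_normalizedBessel hα).continuous
  unfold kernel
  have hc : ∀ j : Fin (d + 1), Continuous fun p : (Fin (d + 1) → ℂ) × Space d => p.2 j :=
    fun j => (continuous_coord j).comp continuous_snd
  fun_prop

lemma differentiable_kernel (hα : -1 / 2 < α) (x t : Space d) :
    Differentiable ℂ fun z : ℂ => kernel α (fun j => z * t j) x := by
  have := differentiable_normalizedBessel hα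
  unfold kernel
  refine Differentiable.mul (by fun_prop) (this.comp (by fun_prop))

end Weinstein

end

noncomputable section

namespace Weinstein

variable {d : ℕ} {α : ℝ}

/-! ### The Hecke identity and the harmonic decomposition -/

open MvPolynomial (monomial coeff)

/-- Green's identity puts Δ on the kernel, where it acts as the scalar -‖y‖² while lowering the
degree by 2. -/
lemma gaussIntegral_kernelPoly_add_two (hα : -1 / 2 < α) {l : ℕ} {P : Poly d}
    (hP : P ∈ harmonicPoly d α l) (y : Space d) (k : ℕ) :
    2 * ((k : ℂ) + 2 - l) * gaussIntegral hα (kernelPoly α y (k + 2) * P) =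
      -((‖y‖ ^ 2 : ℝ) : ℂ) * gaussIntegral hα (kernelPoly α y k * P) := by
  have h := gaussIntegral_mul_harmonic hα (kernelPoly_mem_evenHom (α := α) y (k + 2)) hP
  rw [weinsteinPoly_kernelPoly hα, smul_mul_assoc, map_smul, smul_eq_mul] at h
  rw [← h]
  push_cast
  ring

/-- The recursion starts from degree l - 1, where orthogonality applies, or from degree 1 if l = 0,
where Δ is zero. It propagates because 2m + 3 ≠ 0. -/
lemma gaussIntegral_kernelPoly_odd (hα : -1 / 2 < α) {l : ℕ} {P : Poly d}
    (hP : P ∈ harmonicPoly d α l) (y : Space d) (m : ℕ) :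
    gaussIntegral hα (kernelPoly α y (l + (2 * m + 1)) * P) = 0 := by
  induction m with
  | zero =>
    rcases l with _ | l
    · have h := gaussIntegral_mul_harmonic hα (kernelPoly_mem_evenHom (α := α) y 1) hP
      rw [weinsteinPoly_eq_zero_of_lt one_lt_two (kernelPoly_mem_evenHom y 1)] at h
      simpa using h
    · have h := gaussIntegral_kernelPoly_add_two hα hP y l
      rw [gaussIntegral_mul_harmonic_eq_zero hα (Nat.lt_succ_self l)
        (kernelPoly_mem_evenHom y l) hP, mul_zero] at h
      push_cast at h
      ring_nf at h
      simpa [add_comm, add_left_comm] using h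
  | succ m ih =>
    have h := gaussIntegral_kernelPoly_add_two hα hP y (l + (2 * m + 1))
    rw [ih, mul_zero] at h
    have hne : 2 * (((l + (2 * m + 1) : ℕ) : ℂ) + 2 - l) ≠ 0 := by
      have : (2 * (m : ℂ) + 3) ≠ 0 := by
        exact_mod_cast (show 2 * m + 3 ≠ 0 by omega)
      intro h0
      apply this
      push_cast at h0
      linear_combination h0 / 2
    exact (mul_eq_zero.1 h).resolve_left hne

/-- Each step of the recursion multiplies by -‖y‖²/(4(m+1)), which produces the series of
e^{-‖y‖²/4}. -/
lemma gaussIntegral_kernelPoly_even (hα : -1 / 2 < α) {l : ℕ} {P : Poly d}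
    (hP : P ∈ harmonicPoly d α l) (y : Space d) (m : ℕ) :
    gaussIntegral hα (kernelPoly α y (l + 2 * m) * P) =
      gaussIntegral hα (kernelPoly α y l * P) *
        (((-(‖y‖ ^ 2 / 4) : ℝ) : ℂ) ^ m / (m.factorial : ℂ)) := by
  induction m with
  | zero => simp
  | succ m ih =>
    have h := gaussIntegral_kernelPoly_add_two hα hP y (l + 2 * m)
    rw [ih] at h
    have h1 : (m + 1 : ℂ) ≠ 0 := by exact_mod_cast m.succ_ne_zero
    have h2 : (m.factorial : ℂ) ≠ 0 := by exact_mod_cast m.factorial_ne_zero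
    rw [show l + 2 * (m + 1) = l + 2 * m + 2 by ring, Nat.factorial_succ]
    push_cast at h ⊢
    have h3 : gaussIntegral hα (kernelPoly α y (l + 2 * m + 2) * P) * (4 * (m + 1)) =
      -((‖y‖ : ℂ) ^ 2) * (gaussIntegral hα (kernelPoly α y l * P) *
        ((-((‖y‖ : ℂ) ^ 2 / 4)) ^ m / (m.factorial : ℂ))) := by
      linear_combination h
    rw [eq_div_of_mul_eq (by simpa using h1) h3]
    field_simp
    ring

lemma hasSum_gaussIntegral_kernelPoly (hα : -1 / 2 < α) {l : ℕ} {P : Poly d}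
    (hP : P ∈ harmonicPoly d α l) (y : Space d) :
    HasSum (fun k => gaussIntegral hα (kernelPoly α y k * P))
      (gaussIntegral hα (kernelPoly α y l * P) * (Real.exp (-(‖y‖ ^ 2 / 4)) : ℝ)) := by
  have hinj : Function.Injective fun m : ℕ => l + 2 * m := fun a b h => by
    have : l + 2 * a = l + 2 * b := h
    omega
  rw [← hinj.hasSum_iff]
  · have h : HasSum (fun m : ℕ => ((-(‖y‖ ^ 2 / 4) : ℝ) : ℂ) ^ m / (m.factorial : ℂ))
        (cexp ((-(‖y‖ ^ 2 / 4) : ℝ) : ℂ)) := by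
      rw [Complex.exp_eq_exp_ℂ]
      exact NormedSpace.expSeries_div_hasSum_exp _
    rw [Complex.ofReal_exp]
    refine (h.mul_left _).congr_fun fun m => ?_
    exact gaussIntegral_kernelPoly_even hα hP y m
  · intro k hk
    by_cases hkl : k < l
    · exact gaussIntegral_mul_harmonic_eq_zero hα hkl (kernelPoly_mem_evenHom y k) hP
    · rcases Nat.even_or_odd' (k - l) with ⟨m, hm | hm⟩
      · exact absurd ⟨m, show l + 2 * m = k by omega⟩ hk
      · rw [show k = l + (2 * m + 1) by omega]
        exact gaussIntegral_kernelPoly_odd hα hP y m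

/-- The Hecke identity: the Weinstein transform of a harmonic polynomial times a Gaussian. -/
lemma integral_kernel_mul_harmonic_mul_gauss (hα : -1 / 2 < α) {l : ℕ} {P : Poly d}
    (hP : P ∈ harmonicPoly d α l) (y : Space d) :
    ∫ x, kernel α (fun j => (x j : ℂ)) y * (polyFun P x * gauss x) ∂(weightedMeasure d α) =
      gaussIntegral hα (kernelPoly α y l * P) * (Real.exp (-(‖y‖ ^ 2 / 4)) : ℝ) := by
  -- The majorant sums to e^{(d+1)‖y‖‖x‖}, which the Gaussian makes integrable, so the kernel may be
  -- integrated term by term.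
  have hbound : ∀ x : Space d, HasSum (fun k : ℕ => ((d + 1) * ‖y‖ * ‖x‖) ^ k /
      (k.factorial : ℝ) * ‖polyFun P x * gauss x‖)
      (Real.exp ((d + 1) * ‖y‖ * ‖x‖) * ‖polyFun P x * gauss x‖) := by
    intro x
    refine HasSum.mul_right _ ?_
    rw [Real.exp_eq_exp_ℝ]
    exact NormedSpace.expSeries_div_hasSum_exp _
  have hi : Integrable (fun x => Real.exp ((d + 1) * ‖y‖ * ‖x‖) * ‖polyFun P x * gauss x‖)
      (weightedMeasure d α) := by
    have := (integrable_mul_polyFun_mul_gauss hα P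
      (f := fun x => ((Real.exp ((d + 1) * ‖y‖ * ‖x‖) : ℝ) : ℂ)) (by fun_prop)
      (C := 1) (c := (d + 1) * ‖y‖) (fun x => by
        rw [Complex.norm_real, Real.norm_of_nonneg (Real.exp_pos _).le, one_mul])).norm
    refine this.congr (Filter.Eventually.of_forall fun x => ?_)
    simp only
    rw [norm_mul _ (polyFun P x * gauss x), Complex.norm_real,
      Real.norm_of_nonneg (Real.exp_pos _).le]
  have h := hasSum_integral_of_dominated_convergence (μ := weightedMeasure d α)
    (F := fun k x => polyFun (kernelPoly α y k) x * (polyFun P x * gauss x))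
    (f := fun x => kernel α (fun j => (x j : ℂ)) y * (polyFun P x * gauss x))
    (fun k x => ((d + 1) * ‖y‖ * ‖x‖) ^ k / (k.factorial : ℝ) * ‖polyFun P x * gauss x‖)
    (fun k => Continuous.aestronglyMeasurable (by fun_prop))
    (fun k => Filter.Eventually.of_forall fun x => by
      rw [norm_mul]
      exact mul_le_mul_of_nonneg_right (norm_polyFun_kernelPoly_le hα y x k) (norm_nonneg _))
    (Filter.Eventually.of_forall fun x => (hbound x).summable)
    (hi.congr (Filter.Eventually.of_forall fun x => (hbound x).tsum_eq.symm))
    (Filter.Eventually.of_forall fun x => (hasSum_kernelPoly_real hα y x).mul_right _)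
  refine h.unique ?_
  refine (hasSum_gaussIntegral_kernelPoly hα hP y).congr_fun fun k => ?_
  rw [gaussIntegral_apply]
  simp only [polyFun_mul, mul_assoc]

/-- The operator by which the Hecke identity acts on harmonic polynomials of degree `l`. -/
def heckePoly (hα : -1 / 2 < α) (l : ℕ) : Poly d →ₗ[ℂ] Poly d where
  toFun P := ∑ β ∈ Finset.finsuppAntidiag Finset.univ l,
    monomial β (kernelCoeff α β * gaussIntegral hα (monomial β 1 * P))
  map_add' p q := by
    simp only [mul_add, map_add, Finset.sum_add_distrib]
  map_smul' c p := by
    simp only [mul_smul_comm, map_smul, smul_eq_mul, RingHom.id_apply, Finset.smul_sum,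
      MvPolynomial.smul_monomial, mul_left_comm c]

lemma coeff_heckePoly (hα : -1 / 2 < α) (l : ℕ) (P : Poly d) (β : Fin (d + 1) →₀ ℕ) :
    coeff β (heckePoly hα l P) =
      if β.degree = l then kernelCoeff α β * gaussIntegral hα (monomial β 1 * P) else 0 :=
  coeff_sum_finsuppAntidiag _ _ _

lemma polyFun_heckePoly (hα : -1 / 2 < α) (l : ℕ) (P : Poly d) (y : Space d) :
    polyFun (heckePoly hα l P) y = gaussIntegral hα (kernelPoly α y l * P) := by
  rw [kernelPoly, Finset.sum_mul, map_sum]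
  change polyFun (∑ β ∈ Finset.finsuppAntidiag Finset.univ l, _) y = _
  rw [polyFun_sum]
  refine Finset.sum_congr rfl fun β _ => ?_
  have : monomial β (kernelCoeff α β * ∏ j, (y j : ℂ) ^ β j) =
      (kernelCoeff α β * ∏ j, (y j : ℂ) ^ β j) • monomial β (1 : ℂ) := by
    rw [MvPolynomial.smul_monomial, smul_eq_mul, mul_one]
  rw [polyFun_monomial, this, smul_mul_assoc, map_smul, smul_eq_mul]
  ring

lemma monomial_one_mem_evenHom {β : Fin (d + 1) →₀ ℕ} (hβ : Even (β (Fin.last d))) :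
    monomial β (1 : ℂ) ∈ evenHom d β.degree := by
  rw [mem_evenHom_iff_coeff]
  intro γ hγ
  rw [MvPolynomial.coeff_monomial, if_neg]
  rintro rfl
  exact hγ ⟨rfl, hβ⟩

/-- By the recursion of the kernel coefficients, Δ in y brings a factor ‖x‖² under the integral,
next to a monomial of degree l - 2. By homogeneity that factor only rescales the integral, which is
0 by orthogonality to lower degrees. -/
lemma heckePoly_mem_harmonicPoly (hα : -1 / 2 < α) {l : ℕ} {P : Poly d}
    (hP : P ∈ harmonicPoly d α l) : heckePoly hα l P ∈ harmonicPoly d α l := by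
  refine ⟨mem_evenHom_iff_coeff.2 fun β hβ => ?_, ?_⟩
  · rw [coeff_heckePoly]
    split_ifs with h
    · rw [kernelCoeff_eq_zero fun h' => hβ ⟨h, h'⟩, zero_mul]
    · rfl
  · rw [SetLike.mem_coe, LinearMap.mem_ker]
    ext γ
    rw [coeff_weinsteinPoly, MvPolynomial.coeff_zero]
    simp only [coeff_heckePoly, degree_add_single]
    split_ifs with h
    · have h1 : ∀ j, kernelCoeff α (γ + Finsupp.single j 2) *
          gaussIntegral hα (monomial (γ + Finsupp.single j 2) 1 * P) *
            ((γ j + 2) * (γ j + 1 + kappa α j)) =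
          -kernelCoeff α γ * gaussIntegral hα (monomial (γ + Finsupp.single j 2) 1 * P) := by
        intro j
        rw [← kernelCoeff_add_single hα γ j]
        ring
      simp only [h1]
      rw [← Finset.mul_sum, ← map_sum, ← Finset.sum_mul, ← normSqPoly_mul_monomial, mul_assoc]
      by_cases hγ : Even (γ (Fin.last d))
      · have h2 := gaussIntegral_normSqPoly_mul hα
          ((monomial_one_mem_evenHom hγ).1.mul hP.1.1)
        rw [gaussIntegral_mul_harmonic_eq_zero hα (by omega) (monomial_one_mem_evenHom hγ) hP,
          mul_zero] at h2
        rw [(mul_eq_zero.1 h2).resolve_left two_ne_zero, mul_zero]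
      · rw [kernelCoeff_eq_zero hγ]
        simp
    · simp

/-- The kernel coefficients at even exponents are nonzero, so P is orthogonal to every even monomial
of degree l, hence to its own conjugate. -/
lemma eq_zero_of_heckePoly_eq_zero (hα : -1 / 2 < α) {l : ℕ} {P : Poly d}
    (hP : P ∈ harmonicPoly d α l) (h : heckePoly hα l P = 0) : P = 0 := by
  apply eq_zero_of_gaussIntegral_conj hα
  have hc := conjPoly_mem_evenHom hP.1
  rw [(conjPoly P).as_sum, Finset.sum_mul, map_sum]
  refine Finset.sum_eq_zero fun β hβ => ?_
  have h1 : β.degree = l := by rw [hc.1.degree_eq_sum_deg_support hβ, Finsupp.degree_apply]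
  have h2 := congrArg (coeff β) h
  rw [coeff_heckePoly, if_pos h1, MvPolynomial.coeff_zero] at h2
  have h3 := (mul_eq_zero.1 h2).resolve_left
    (kernelCoeff_ne_zero hα (even_of_mem_support hc.2 hβ))
  have h4 : monomial β (coeff β (conjPoly P)) = coeff β (conjPoly P) • monomial β (1 : ℂ) := by
    rw [MvPolynomial.smul_monomial, smul_eq_mul, mul_one]
  rw [h4, smul_mul_assoc, map_smul, h3, smul_zero]

/-- An injective endomorphism of a finite-dimensional space is onto. This is needed because the
Gaussian averages of the coefficients only test φ against polynomials in the image of H. -/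
lemma exists_heckePoly_eq (hα : -1 / 2 < α) {l : ℕ} {Q : Poly d}
    (hQ : Q ∈ harmonicPoly d α l) : ∃ P ∈ harmonicPoly d α l, heckePoly hα l P = Q := by
  set T : harmonicPoly d α l →ₗ[ℂ] harmonicPoly d α l :=
    (heckePoly hα l).restrict fun P hP => heckePoly_mem_harmonicPoly hα hP
  have hinj : Function.Injective T := by
    rw [← LinearMap.ker_eq_bot, LinearMap.ker_eq_bot']
    intro P hP
    exact Subtype.ext (eq_zero_of_heckePoly_eq_zero hα P.2 (congrArg Subtype.val hP))
  obtain ⟨P, hP⟩ := LinearMap.injective_iff_surjective.1 hinj ⟨Q, hQ⟩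
  exact ⟨P, P.2, congrArg Subtype.val hP⟩

/-- If ‖x‖²q is harmonic of degree k + 2, it is orthogonal to the conjugate of q, of degree k; and
the integral of ‖x‖²|q|² is a positive multiple of that of |q|². -/
lemma eq_zero_of_normSqPoly_mul_harmonic (hα : -1 / 2 < α) {k : ℕ} {q : Poly d}
    (hq : q ∈ evenHom d k) (h : weinsteinPoly d α (normSqPoly d * q) = 0) : q = 0 := by
  apply eq_zero_of_gaussIntegral_conj hα
  have hH : normSqPoly d * q ∈ harmonicPoly d α (k + 2) := ⟨normSqPoly_mul_mem_evenHom hq, h⟩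
  have hc := conjPoly_mem_evenHom hq
  have h1 := gaussIntegral_mul_harmonic_eq_zero hα (by omega : k < k + 2) hc hH
  rw [mul_left_comm] at h1
  have h2 := gaussIntegral_normSqPoly_mul hα (hc.1.mul hq.1)
  rw [h1, mul_zero] at h2
  refine (mul_eq_zero.1 h2.symm).resolve_left ?_
  have : ((k + k : ℕ) : ℝ) + (d + 1) + (2 * α + 1) ≠ 0 := by
    have : (0 : ℝ) ≤ ((k + k : ℕ) : ℝ) := Nat.cast_nonneg _
    have : (0 : ℝ) ≤ d := Nat.cast_nonneg _
    apply ne_of_gt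
    linarith
  exact_mod_cast this

/-- The map q ↦ Δ(‖x‖²q) is injective on a finite-dimensional space, so Δp = Δ(‖x‖²q) can be solved
for q. -/
lemma exists_sub_normSqPoly_mul_harmonic (hα : -1 / 2 < α) {k : ℕ} {p : Poly d}
    (hp : p ∈ evenHom d (k + 2)) :
    ∃ q ∈ evenHom d k, p - normSqPoly d * q ∈ harmonicPoly d α (k + 2) := by
  set T : evenHom d k →ₗ[ℂ] evenHom d k :=
    ((weinsteinPoly d α).comp (LinearMap.mulLeft ℂ (normSqPoly d))).restrict fun q hq =>
      weinsteinPoly_mem_evenHom (normSqPoly_mul_mem_evenHom hq)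
  have hinj : Function.Injective T := by
    rw [← LinearMap.ker_eq_bot, LinearMap.ker_eq_bot']
    intro q hq
    exact Subtype.ext (eq_zero_of_normSqPoly_mul_harmonic hα q.2 (congrArg Subtype.val hq))
  obtain ⟨q, hq⟩ := LinearMap.injective_iff_surjective.1 hinj
    ⟨weinsteinPoly d α p, weinsteinPoly_mem_evenHom hp⟩
  refine ⟨q, q.2, Submodule.sub_mem _ hp (normSqPoly_mul_mem_evenHom q.2), ?_⟩
  have h : weinsteinPoly d α (normSqPoly d * q) = weinsteinPoly d α p := congrArg Subtype.val hq
  rw [SetLike.mem_coe, LinearMap.mem_ker, map_sub, h, sub_self]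

/-- The intended functional is integration over the unit sphere, which does not see ‖x‖².
Subtracting a harmonic part lowers the degree by 2, and in degrees 0 and 1 every polynomial is
harmonic. -/
lemma eq_zero_of_eq_zero_on_harmonicPoly (hα : -1 / 2 < α) (Θ : Poly d →ₗ[ℂ] ℂ)
    (hnorm : ∀ p, Θ (normSqPoly d * p) = Θ p)
    (hH : ∀ l, ∀ P ∈ harmonicPoly d α l, Θ P = 0) {p : Poly d} (hp : p ∈ evenPoly d) :
    Θ p = 0 := by
  have hhom : ∀ k, ∀ p ∈ evenHom d k, Θ p = 0 := by
    intro k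
    induction k using Nat.strong_induction_on with
    | _ k ih =>
      intro p hp
      by_cases hk : k < 2
      · exact hH k p ⟨hp, weinsteinPoly_eq_zero_of_lt hk hp⟩
      · obtain ⟨m, rfl⟩ : ∃ m, k = m + 2 := ⟨k - 2, by omega⟩
        obtain ⟨q, hq, h⟩ := exists_sub_normSqPoly_mul_harmonic hα hp
        have := hH _ _ h
        rwa [map_sub, hnorm, ih m (by omega) q hq, sub_zero] at this
  rw [← MvPolynomial.sum_homogeneousComponent p, map_sum]
  refine Finset.sum_eq_zero fun k _ => hhom k _
    ⟨MvPolynomial.homogeneousComponent_isHomogeneous k p, fun β hβ => ?_⟩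
  rw [MvPolynomial.coeff_homogeneousComponent, hp β hβ, ite_self]

end Weinstein

end

noncomputable section

namespace Weinstein

/-! ### A Paley–Wiener argument for Gaussian averages -/

open Filter Topology Asymptotics

/-! ### Holomorphic dependence of integrals on a parameter -/

section Holomorphic

variable {Ω : Type*} [MeasurableSpace Ω] {ν : Measure Ω}

/-- Cauchy's estimate on discs of radius r/3 turns the bound on F into one on its derivative, so
dominated differentiation needs no separate hypothesis. -/
lemma differentiableOn_integral_of_bound {F : ℂ → Ω → ℂ} {U : Set ℂ} (hU : IsOpen U)
    (hF : ∀ z, AEStronglyMeasurable (F z) ν)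
    (hd : ∀ ω, DifferentiableOn ℂ (fun z => F z ω) U) {bound : Ω → ℝ} (hb : Integrable bound ν)
    (h : ∀ z ∈ U, ∀ ω, ‖F z ω‖ ≤ bound ω) :
    DifferentiableOn ℂ (fun z => ∫ ω, F z ω ∂ν) U := by
  intro z₀ hz₀
  obtain ⟨r, hr, hrU⟩ := Metric.isOpen_iff.1 hU z₀ hz₀
  have hda : ∀ ω, ∀ z ∈ U, HasDerivAt (fun z => F z ω) (deriv (fun z => F z ω) z) z :=
    fun ω z hz => ((hd ω).differentiableAt (hU.mem_nhds hz)).hasDerivAt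
  have hsub : ∀ z ∈ Metric.ball z₀ (r / 2), Metric.closedBall z (r / 3) ⊆ U := by
    intro z hz w hw
    apply hrU
    rw [Metric.mem_ball] at hz ⊢
    rw [Metric.mem_closedBall] at hw
    linarith [dist_triangle w z z₀]
  -- The derivative is a limit of difference quotients, each measurable in ω.
  have hmeas : AEStronglyMeasurable (fun ω => deriv (fun z => F z ω) z₀) ν := by
    refine aestronglyMeasurable_of_tendsto_ae (𝓝[≠] (0 : ℂ))
      (f := fun t ω => t⁻¹ • (F (z₀ + t) ω - F z₀ ω))
      (fun t => ((hF (z₀ + t)).sub (hF z₀)).const_smul t⁻¹) (Eventually.of_forall fun ω => ?_)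
    exact (hda ω z₀ hz₀).tendsto_slope_zero
  refine (hasDerivAt_integral_of_dominated_loc_of_deriv_le (s := Metric.ball z₀ (r / 2))
    (F' := fun z ω => deriv (fun z => F z ω) z)
    (bound := fun ω => bound ω / (r / 3)) (Metric.ball_mem_nhds _ (by positivity))
    (Eventually.of_forall hF) ?_ hmeas ?_ (hb.div_const _) ?_).2.differentiableAt.differentiableWithinAt
  · exact hb.mono' (hF z₀) (Eventually.of_forall (h z₀ hz₀))
  · refine Eventually.of_forall fun ω z hz => ?_
    refine Complex.norm_deriv_le_of_forall_mem_sphere_norm_le (by positivity) ?_ fun w hw => ?_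
    · refine DifferentiableOn.diffContOnCl ?_
      rw [closure_ball _ (by positivity)]
      exact (hd ω).mono (hsub z hz)
    · exact h w (hsub z hz (Metric.sphere_subset_closedBall hw)) ω
  · refine Eventually.of_forall fun ω z hz => hda ω z ?_
    exact hsub z hz (Metric.mem_closedBall_self (by positivity))

lemma differentiable_integral_of_bound {F : ℂ → Ω → ℂ}
    (hF : ∀ z, AEStronglyMeasurable (F z) ν) (hd : ∀ ω, Differentiable ℂ (fun z => F z ω))
    (h : ∀ r : ℝ, ∃ bound : Ω → ℝ, Integrable bound ν ∧ ∀ z, ‖z‖ < r → ∀ ω, ‖F z ω‖ ≤ bound ω) :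
    Differentiable ℂ (fun z => ∫ ω, F z ω ∂ν) := by
  intro z
  obtain ⟨b, hb, hbound⟩ := h (‖z‖ + 1)
  refine (differentiableOn_integral_of_bound (Metric.isOpen_ball (x := (0 : ℂ)) (ε := ‖z‖ + 1)) hF
    (fun ω => (hd ω).differentiableOn) hb fun w hw ω => ?_).differentiableAt
      (Metric.isOpen_ball.mem_nhds (by simp))
  exact hbound w (by simpa using hw) ω

end Holomorphic

/-- An analytic function has the size of its leading term in every direction, so one ray determines
the order of vanishing. -/
lemma isBigO_pow_of_isBigO_right {f : ℂ → ℂ} (hf : AnalyticAt ℂ f 0) {m : ℕ} {C : ℝ}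
    (h : ∀ x : ℝ, 0 < x → ‖f x‖ ≤ C * x ^ m) : f =O[𝓝 0] fun z => z ^ m := by
  by_cases h0 : ∀ᶠ z in 𝓝 (0 : ℂ), f z = 0
  · exact (isBigO_zero _ _).congr' (h0.mono fun z hz => hz.symm) EventuallyEq.rfl
  obtain ⟨n, g, hg, hg0, hfg⟩ := hf.exists_eventuallyEq_pow_smul_nonzero_iff.2 h0
  simp only [sub_zero, smul_eq_mul] at hfg
  have hmn : m ≤ n := by
    by_contra! hlt
    have hcoe : Tendsto (fun x : ℝ => (x : ℂ)) (𝓝[>] 0) (𝓝 0) := by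
      have : Tendsto (fun x : ℝ => (x : ℂ)) (𝓝 0) (𝓝 ((0 : ℝ) : ℂ)) :=
        Complex.continuous_ofReal.tendsto 0
      simpa using this.mono_left nhdsWithin_le_nhds
    have h1 : Tendsto (fun x : ℝ => ‖g x‖) (𝓝[>] 0) (𝓝 ‖g 0‖) :=
      (hg.continuousAt.tendsto.comp hcoe).norm
    have h2 : Tendsto (fun x : ℝ => C * x ^ (m - n)) (𝓝[>] 0) (𝓝 0) := by
      have : Tendsto (fun x : ℝ => C * x ^ (m - n)) (𝓝 0) (𝓝 (C * 0 ^ (m - n))) :=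
        (by fun_prop : Continuous fun x : ℝ => C * x ^ (m - n)).tendsto 0
      rw [zero_pow (by omega), mul_zero] at this
      exact this.mono_left nhdsWithin_le_nhds
    have h3 : ‖g 0‖ ≤ 0 := by
      refine le_of_tendsto_of_tendsto h1 h2 ?_
      filter_upwards [hcoe.eventually hfg, self_mem_nhdsWithin] with x hx hx0
      have hx0' : (0 : ℝ) < x := hx0
      have h4 := h x hx0'
      rw [hx, norm_mul, norm_pow, Complex.norm_real, Real.norm_of_nonneg hx0'.le,
        show m = n + (m - n) by omega, pow_add] at h4
      have h5 : x ^ n * ‖g x‖ ≤ x ^ n * (C * x ^ (m - n)) := by linarith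
      simpa using le_of_mul_le_mul_left h5 (by positivity)
    exact hg0 (norm_le_zero_iff.1 h3)
  have hz : (fun z : ℂ => z ^ n) =O[𝓝 0] fun z => z ^ m := by
    refine IsBigO.of_bound 1 ?_
    filter_upwards [Metric.ball_mem_nhds (0 : ℂ) one_pos] with z hz
    rw [norm_pow, norm_pow, one_mul]
    exact pow_le_pow_of_le_one (norm_nonneg _) (mem_ball_zero_iff.1 hz).le hmn
  have hgO : g =O[𝓝 0] fun _ => (1 : ℂ) := hg.continuousAt.isBigO_one ℂ
  have := hz.mul hgO
  simp only [mul_one] at this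
  exact this.congr' (hfg.mono fun z hz => hz.symm) EventuallyEq.rfl

/-- Taylor's remainder for x ≤ 1; for x ≥ 1 the power x^m dominates the exponential and the Taylor
polynomial. -/
lemma abs_exp_neg_sub_sum_le (m : ℕ) :
    ∃ C, ∀ x : ℝ, 0 ≤ x →
      |Real.exp (-x) - ∑ n ∈ Finset.range m, (-x) ^ n / (n.factorial : ℝ)| ≤ C * x ^ m := by
  refine ⟨1 + Real.exp 1, fun x hx => ?_⟩
  rcases le_total x 1 with h | h
  · have h1 := Complex.norm_exp_sub_sum_le_norm_mul_exp ((-x : ℝ) : ℂ) m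
    have h2 : cexp ((-x : ℝ) : ℂ) - ∑ n ∈ Finset.range m, ((-x : ℝ) : ℂ) ^ n / (n.factorial : ℂ) =
        ((Real.exp (-x) - ∑ n ∈ Finset.range m, (-x) ^ n / (n.factorial : ℝ) : ℝ) : ℂ) := by
      push_cast
      rfl
    rw [h2, Complex.norm_real, Complex.norm_real, Real.norm_eq_abs, Real.norm_eq_abs, abs_neg,
      abs_of_nonneg hx] at h1
    refine h1.trans ?_
    have h3 : Real.exp x ≤ 1 + Real.exp 1 := by linarith [Real.exp_le_exp.2 h]
    nlinarith [pow_nonneg hx m]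
  · have h1 : Real.exp (-x) ≤ x ^ m := by
      have : Real.exp (-x) ≤ 1 := Real.exp_le_one_iff.2 (by linarith)
      exact this.trans (one_le_pow₀ h)
    have h2 : |∑ n ∈ Finset.range m, (-x) ^ n / (n.factorial : ℝ)| ≤ Real.exp 1 * x ^ m := by
      calc _ ≤ ∑ n ∈ Finset.range m, |(-x) ^ n / (n.factorial : ℝ)| :=
            Finset.abs_sum_le_sum_abs _ _
        _ ≤ ∑ n ∈ Finset.range m, 1 ^ n / (n.factorial : ℝ) * x ^ m := by
            refine Finset.sum_le_sum fun n hn => ?_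
            rw [abs_div, abs_pow, abs_neg, abs_of_nonneg hx, Nat.abs_cast, div_mul_eq_mul_div,
              one_pow, one_mul]
            gcongr
            exact (Finset.mem_range.1 hn).le
        _ ≤ _ := by
            rw [← Finset.sum_mul]
            gcongr
            exact Real.sum_le_exp_of_nonneg zero_le_one m
    calc _ ≤ |Real.exp (-x)| + |∑ n ∈ Finset.range m, (-x) ^ n / (n.factorial : ℝ)| := abs_sub _ _
      _ ≤ x ^ m + Real.exp 1 * x ^ m := by
          rw [abs_of_pos (Real.exp_pos _)]
          gcongr
      _ = _ := by ring

/-! ### Growth of a Gaussian average and the support of the averaged function -/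

section PaleyWiener

variable {Ω : Type*} [MeasurableSpace Ω] {ν : Measure Ω} {ψ : Ω → ℂ} {ρ : Ω → ℝ}

/-- The formula is assumed for x > 0 only, so evenness needs proof. All moments being finite,
expanding e^{-x²ρ} shows that E agrees with an even polynomial to order x^{2m}, for every m.
Analyticity carries this to all directions, so E(-z) - E(z) vanishes to infinite order at 0, hence
identically. -/
lemma even_of_eq_gaussAverage (hρ : Measurable ρ) (hρ0 : ∀ ω, 0 ≤ ρ ω)
    (hψ : ∀ n : ℕ, Integrable (fun ω => ((ρ ω ^ n : ℝ) : ℂ) * ψ ω) ν) {E : ℂ → ℂ}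
    (hE : Differentiable ℂ E)
    (heq : ∀ x : ℝ, 0 < x → E x = ∫ ω, ψ ω * (Real.exp (-(x ^ 2 * ρ ω)) : ℝ) ∂ν) (z : ℂ) :
    E (-z) = E z := by
  have hEa : ∀ w, AnalyticAt ℂ E w := fun w => hE.analyticAt w
  set p : ℕ → ℂ → ℂ := fun m z => ∑ n ∈ Finset.range m,
    ((∫ ω, ((ρ ω ^ n : ℝ) : ℂ) * ψ ω ∂ν) / (n.factorial : ℂ)) * (-(z ^ 2)) ^ n with hp
  have hpd : ∀ m, Differentiable ℂ (p m) := fun m => by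
    simp only [hp]
    fun_prop
  have hψ0 : Integrable ψ ν := by simpa using hψ 0
  have hO : ∀ m, (fun z => E z - p m z) =O[𝓝 0] fun z => z ^ (2 * m) := by
    intro m
    obtain ⟨C, hC⟩ := abs_exp_neg_sub_sum_le m
    refine isBigO_pow_of_isBigO_right (C := C * ∫ ω, ‖((ρ ω ^ m : ℝ) : ℂ) * ψ ω‖ ∂ν)
      ((hE.sub (hpd m)).analyticAt 0) fun x hx => ?_
    have h1 : E x - p m x = ∫ ω, ψ ω * ((Real.exp (-(x ^ 2 * ρ ω)) -
        ∑ n ∈ Finset.range m, (-(x ^ 2 * ρ ω)) ^ n / (n.factorial : ℝ) : ℝ) : ℂ) ∂ν := by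
      have hi1 : Integrable (fun ω => ψ ω * (Real.exp (-(x ^ 2 * ρ ω)) : ℝ)) ν := by
        refine hψ0.norm.mono' (hψ0.aestronglyMeasurable.mul
          (Measurable.aestronglyMeasurable (by fun_prop))) (Eventually.of_forall fun ω => ?_)
        rw [norm_mul, Complex.norm_real, Real.norm_of_nonneg (Real.exp_pos _).le]
        refine mul_le_of_le_one_right (norm_nonneg _) (Real.exp_le_one_iff.2 ?_)
        have := hρ0 ω
        have := mul_nonneg (sq_nonneg x) this
        linarith
      have hi2 : p m x = ∫ ω, ∑ n ∈ Finset.range m, ((-(x : ℂ) ^ 2) ^ n / (n.factorial : ℂ)) *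
          (((ρ ω ^ n : ℝ) : ℂ) * ψ ω) ∂ν := by
        rw [integral_finsetSum _ fun n _ => (hψ n).const_mul _]
        refine Finset.sum_congr rfl fun n _ => ?_
        rw [integral_const_mul]
        ring
      rw [heq x hx, hi2, ← integral_sub hi1 (integrable_finsetSum _ fun n _ => (hψ n).const_mul _)]
      refine integral_congr_ae (Eventually.of_forall fun ω => ?_)
      simp only
      push_cast
      rw [mul_sub, Finset.mul_sum]
      congr 1
      refine Finset.sum_congr rfl fun n _ => ?_
      rw [neg_mul_eq_neg_mul, mul_pow]
      ring
    change ‖E x - p m x‖ ≤ _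
    rw [h1, mul_right_comm, ← integral_const_mul]
    refine norm_integral_le_of_norm_le ((hψ m).norm.const_mul _)
      (Eventually.of_forall fun ω => ?_)
    rw [norm_mul, Complex.norm_real, Real.norm_eq_abs, norm_mul, Complex.norm_real,
      Real.norm_of_nonneg (pow_nonneg (hρ0 ω) m)]
    calc _ ≤ ‖ψ ω‖ * (C * (x ^ 2 * ρ ω) ^ m) := by
          gcongr
          exact hC _ (mul_nonneg (sq_nonneg x) (hρ0 ω))
      _ = _ := by rw [mul_pow, pow_mul]; ring
  set D : ℂ → ℂ := fun z => E (-z) - E z with hD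
  have hDd : Differentiable ℂ D := (hE.comp differentiable_neg).sub hE
  have hDO : ∀ m, D =O[𝓝 0] fun z => z ^ (2 * m) := by
    intro m
    have hneg : Tendsto (fun z : ℂ => -z) (𝓝 0) (𝓝 0) := by
      simpa using (continuous_neg (G := ℂ)).tendsto 0
    have h1 := (hO m).comp_tendsto hneg
    have h2 : (fun z => E (-z) - p m (-z)) =O[𝓝 0] fun z => z ^ (2 * m) := by
      refine h1.congr (fun z => rfl) fun z => ?_
      simp [pow_mul]
    refine (h2.sub (hO m)).congr_left fun z => ?_
    simp [hp, hD]
  have hD0 : ∀ᶠ z in 𝓝 (0 : ℂ), D z = 0 := by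
    by_contra h0
    obtain ⟨n, g, hg, hg0, hfg⟩ :=
      (hDd.analyticAt 0).exists_eventuallyEq_pow_smul_nonzero_iff.2 h0
    simp only [sub_zero, smul_eq_mul] at hfg
    obtain ⟨C, hC⟩ := (hDO (n + 1)).bound
    have hlim1 : Tendsto (fun z => ‖g z‖) (𝓝[≠] 0) (𝓝 ‖g 0‖) :=
      hg.continuousAt.norm.tendsto.mono_left nhdsWithin_le_nhds
    have hlim2 : Tendsto (fun z : ℂ => C * ‖z‖ ^ (n + 2)) (𝓝[≠] 0) (𝓝 0) := by
      have : Tendsto (fun z : ℂ => C * ‖z‖ ^ (n + 2)) (𝓝 0) (𝓝 (C * ‖(0 : ℂ)‖ ^ (n + 2))) :=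
        (by fun_prop : Continuous fun z : ℂ => C * ‖z‖ ^ (n + 2)).tendsto 0
      rw [norm_zero, zero_pow (by omega), mul_zero] at this
      exact this.mono_left nhdsWithin_le_nhds
    have : ‖g 0‖ ≤ 0 := by
      refine le_of_tendsto_of_tendsto hlim1 hlim2 ?_
      filter_upwards [nhdsWithin_le_nhds hC, nhdsWithin_le_nhds hfg, self_mem_nhdsWithin]
        with w h1 h2 h3
      have hw : 0 < ‖w‖ := norm_pos_iff.2 h3
      rw [h2, norm_mul, norm_pow, norm_pow, show 2 * (n + 1) = n + (n + 2) by ring, pow_add] at h1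
      have h5 : ‖w‖ ^ n * ‖g w‖ ≤ ‖w‖ ^ n * (C * ‖w‖ ^ (n + 2)) := by linarith
      exact le_of_mul_le_mul_left h5 (by positivity)
    exact hg0 (norm_le_zero_iff.1 this)
  have h := AnalyticOnNhd.eq_of_eventuallyEq (f := D) (g := fun _ => 0) (z₀ := 0)
    (fun w _ => hDd.analyticAt w) (fun w _ => analyticAt_const) hD0
  have := congrFun h z
  simp only [hD] at this
  exact sub_eq_zero.1 this

/-- A Paley–Wiener argument: the part of e^{Tz²}E(z) carried by ρ > T extends to a bounded entire
function that tends to 0 along the positive axis. -/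
lemma setIntegral_eq_zero_of_gaussAverage_bound (hρ : Measurable ρ) (hρ0 : ∀ ω, 0 ≤ ρ ω)
    (hψ : ∀ n : ℕ, Integrable (fun ω => ((ρ ω ^ n : ℝ) : ℂ) * ψ ω) ν) {E : ℂ → ℂ}
    (hE : Differentiable ℂ E)
    (heq : ∀ x : ℝ, 0 < x → E x = ∫ ω, ψ ω * (Real.exp (-(x ^ 2 * ρ ω)) : ℝ) ∂ν)
    {S T C : ℝ} (hS : 0 ≤ S) (hST : S < T)
    (hbound : ∀ z, ‖E z‖ ≤ C * Real.exp (S * z.im ^ 2)) :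
    ∫ ω in {ω | T < ρ ω}, ψ ω * (Real.exp (-ρ ω) : ℝ) ∂ν = 0 := by
  have heven := even_of_eq_gaussAverage hρ hρ0 hψ hE heq
  have hψ0 : Integrable ψ ν := by simpa using hψ 0
  have hC : 0 ≤ C := by
    have := (norm_nonneg _).trans (hbound 0)
    simpa using this
  set A : Set Ω := {ω | T < ρ ω} with hA
  have hAm : MeasurableSet A := measurableSet_lt measurable_const hρ
  set M : ℝ := ∫ ω, ‖ψ ω‖ ∂ν with hM
  have hM0 : 0 ≤ M := integral_nonneg fun ω => norm_nonneg _
  set g : ℂ → Ω → ℂ := fun z ω => ψ ω * cexp (z ^ 2 * (T - ρ ω)) with hg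
  have hgm : ∀ z, AEStronglyMeasurable (g z) ν := fun z =>
    hψ0.aestronglyMeasurable.mul (Measurable.aestronglyMeasurable (by fun_prop))
  have hgd : ∀ ω, Differentiable ℂ fun z => g z ω := fun ω => by
    simp only [hg]
    fun_prop
  have hgnorm : ∀ z ω, ‖g z ω‖ = ‖ψ ω‖ * Real.exp ((z.re ^ 2 - z.im ^ 2) * (T - ρ ω)) := by
    intro z ω
    have : (z ^ 2 * ((T : ℂ) - ρ ω)).re = (z.re ^ 2 - z.im ^ 2) * (T - ρ ω) := by
      rw [← Complex.ofReal_sub, Complex.re_mul_ofReal, sq z, Complex.mul_re]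
      ring
    rw [hg, norm_mul, Complex.norm_exp, this]
  have hgA : ∀ z : ℂ, 0 ≤ z.re ^ 2 - z.im ^ 2 → ∀ ω ∈ A, ‖g z ω‖ ≤ ‖ψ ω‖ := by
    intro z hz ω hω
    rw [hgnorm]
    refine mul_le_of_le_one_right (norm_nonneg _) (Real.exp_le_one_iff.2 ?_)
    have : T < ρ ω := hω
    nlinarith
  have hgAc : ∀ z : ℂ, ∀ ω ∈ Aᶜ, ‖g z ω‖ ≤ ‖ψ ω‖ * Real.exp (T * ‖z‖ ^ 2) := by
    intro z ω hω
    rw [hgnorm]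
    have h1 : ρ ω ≤ T := not_lt.1 hω
    have h2 : z.re ^ 2 - z.im ^ 2 ≤ ‖z‖ ^ 2 := by
      rw [Complex.sq_norm, Complex.normSq_apply]
      nlinarith [sq_nonneg z.im]
    have h3 := hρ0 ω
    refine mul_le_mul_of_nonneg_left (Real.exp_le_exp.2 ?_) (norm_nonneg _)
    nlinarith [mul_nonneg (sub_nonneg.2 h1) (sub_nonneg.2 h2), mul_nonneg h3 (sq_nonneg ‖z‖)]
  have hint1 : ∀ z, ‖∫ ω in Aᶜ, g z ω ∂ν‖ ≤ M * Real.exp (T * ‖z‖ ^ 2) := by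
    intro z
    rw [hM, ← integral_mul_const]
    refine (norm_integral_le_of_norm_le (hψ0.norm.mul_const _).integrableOn
      ((ae_restrict_iff' hAm.compl).2 (Eventually.of_forall (hgAc z)))).trans ?_
    exact setIntegral_le_integral (hψ0.norm.mul_const _)
      (Eventually.of_forall fun ω => by positivity)
  -- V continues the integral of g over ρ > T, which is only controlled where Re z² ≥ 0, to the
  -- whole plane.
  set V : ℂ → ℂ := fun z => cexp (T * z ^ 2) * E z - ∫ ω in Aᶜ, g z ω ∂ν with hV
  have hVd : Differentiable ℂ V := by
    refine Differentiable.sub (by fun_prop) ?_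
    have : (fun z => ∫ ω in Aᶜ, g z ω ∂ν) = fun z => ∫ ω, Aᶜ.indicator (g z) ω ∂ν := by
      ext z
      rw [integral_indicator hAm.compl]
    rw [this]
    refine differentiable_integral_of_bound (F := fun z => Aᶜ.indicator (g z))
      (fun z => (hgm z).indicator hAm.compl) (fun ω => ?_) fun r => ?_
    · by_cases hω : ω ∈ Aᶜ
      · simp only [Set.indicator_of_mem hω]
        exact hgd ω
      · simp only [Set.indicator_of_notMem hω]
        exact differentiable_const _
    · refine ⟨fun ω => ‖ψ ω‖ * Real.exp (T * r ^ 2), hψ0.norm.mul_const _, fun z hz ω => ?_⟩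
      by_cases hω : ω ∈ Aᶜ
      · rw [Set.indicator_of_mem hω]
        refine (hgAc z ω hω).trans ?_
        have : 0 ≤ T := by linarith
        exact mul_le_mul_of_nonneg_left (Real.exp_le_exp.2 (mul_le_mul_of_nonneg_left
          (pow_le_pow_left₀ (norm_nonneg _) hz.le 2) this)) (norm_nonneg _)
      · rw [Set.indicator_of_notMem hω, norm_zero]
        positivity
  have hVeven : ∀ z, V (-z) = V z := by
    intro z
    simp only [hV, hg, heven, even_two.neg_pow]
  -- Both sides are holomorphic on the open sector, which is convex, and they agree on the positive
  -- reals.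
  have hVeq : ∀ z : ℂ, 0 < z.re → |z.im| < z.re → V z = ∫ ω in A, g z ω ∂ν := by
    set U : Set ℂ := {z | |z.im| < z.re} with hU
    have hUo : IsOpen U := isOpen_lt (by fun_prop) (by fun_prop)
    have hUc : Convex ℝ U := by
      intro z hz w hw a b ha hb hab
      simp only [hU, Set.mem_ofPred_eq] at hz hw ⊢
      simp only [Complex.add_im, Complex.add_re, Complex.real_smul, Complex.re_ofReal_mul,
        Complex.im_ofReal_mul]
      refine (abs_add_le _ _).trans_lt ?_
      rw [abs_mul, abs_mul, abs_of_nonneg ha, abs_of_nonneg hb]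
      rcases ha.eq_or_lt with rfl | ha'
      · have : b = 1 := by linarith
        subst this
        linarith
      · nlinarith
    have hUpos : ∀ z ∈ U, 0 ≤ z.re ^ 2 - z.im ^ 2 := by
      intro z hz
      have h1 : |z.im| < z.re := hz
      nlinarith [abs_nonneg z.im, sq_abs z.im]
    have hd1 : DifferentiableOn ℂ (fun z => ∫ ω in A, g z ω ∂ν) U := by
      have : (fun z => ∫ ω in A, g z ω ∂ν) = fun z => ∫ ω, A.indicator (g z) ω ∂ν := by
        ext z
        rw [integral_indicator hAm]
      rw [this]
      refine differentiableOn_integral_of_bound (F := fun z => A.indicator (g z)) hUo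
        (fun z => (hgm z).indicator hAm) (fun ω => ?_) hψ0.norm fun z hz ω => ?_
      · by_cases hω : ω ∈ A
        · simp only [Set.indicator_of_mem hω]
          exact (hgd ω).differentiableOn
        · simp only [Set.indicator_of_notMem hω]
          exact differentiableOn_const _
      · by_cases hω : ω ∈ A
        · rw [Set.indicator_of_mem hω]
          exact hgA z (hUpos z hz) ω hω
        · rw [Set.indicator_of_notMem hω, norm_zero]
          exact norm_nonneg _
    have hreal : ∀ x : ℝ, 0 < x → V x = ∫ ω in A, g x ω ∂ν := by
      intro x hx
      have hgi : Integrable (g x) ν := by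
        refine (hψ0.norm.mul_const (Real.exp (T * x ^ 2))).mono' (hgm x)
          (Eventually.of_forall fun ω => ?_)
        rw [hgnorm]
        simp only [Complex.ofReal_re, Complex.ofReal_im]
        refine mul_le_mul_of_nonneg_left (Real.exp_le_exp.2 ?_) (norm_nonneg _)
        nlinarith [mul_nonneg (sq_nonneg x) (hρ0 ω)]
      have h1 : cexp (T * (x : ℂ) ^ 2) * E x = ∫ ω, g x ω ∂ν := by
        rw [heq x hx, ← integral_const_mul]
        refine integral_congr_ae (Eventually.of_forall fun ω => ?_)
        simp only [hg]
        push_cast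
        rw [mul_left_comm, ← Complex.exp_add]
        ring_nf
      rw [hV]
      simp only
      rw [h1, ← integral_add_compl hAm hgi]
      ring
    intro z _ hz
    refine AnalyticOnNhd.eqOn_of_preconnected_of_frequently_eq (𝕜 := ℂ) (U := U) (z₀ := 1)
      (fun w _ => hVd.analyticAt w) (hd1.analyticOnNhd hUo) hUc.isPreconnected (by simp [hU]) ?_ hz
    have hseq : Tendsto (fun n : ℕ => ((1 + 1 / ((n : ℝ) + 1) : ℝ) : ℂ)) atTop (𝓝[≠] 1) := by
      refine tendsto_nhdsWithin_iff.2 ⟨?_, Eventually.of_forall fun n => ?_⟩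
      · have := (tendsto_one_div_add_atTop_nhds_zero_nat (𝕜 := ℝ)).const_add 1
        have h2 := (Complex.continuous_ofReal.tendsto _).comp this
        simpa [Function.comp_def] using h2
      · have : (1 + 1 / ((n : ℝ) + 1)) ≠ 1 := by
          have : 0 < 1 / ((n : ℝ) + 1) := by positivity
          linarith
        rw [Set.mem_compl_iff, Set.mem_singleton_iff]
        exact_mod_cast this
    refine hseq.frequently (Frequently.of_forall fun n => ?_)
    exact hreal _ (by positivity)
  -- The open right sector, then its closure by letting z + t tend to z, then the left sector by
  -- evenness of V.
  have hVb1 : ∀ z : ℂ, |z.im| ≤ |z.re| → ‖V z‖ ≤ M := by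
    have hstrict : ∀ z : ℂ, 0 < z.re → |z.im| < z.re → ‖V z‖ ≤ M := by
      intro z hz hz'
      rw [hVeq z hz hz']
      refine (norm_integral_le_of_norm_le hψ0.norm.integrableOn
        ((ae_restrict_iff' hAm).2 (Eventually.of_forall (hgA z ?_)))).trans ?_
      · nlinarith [abs_nonneg z.im, sq_abs z.im]
      · exact setIntegral_le_integral hψ0.norm (Eventually.of_forall fun ω => norm_nonneg _)
    have hnonneg : ∀ z : ℂ, |z.im| ≤ z.re → ‖V z‖ ≤ M := by
      intro z hz
      have hlim : Tendsto (fun t : ℝ => ‖V (z + t)‖) (𝓝[>] 0) (𝓝 ‖V z‖) := by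
        have hc : Continuous fun t : ℝ => ‖V (z + t)‖ :=
          (hVd.continuous.comp (by fun_prop)).norm
        have := hc.tendsto 0
        simp only [Complex.ofReal_zero, add_zero] at this
        exact this.mono_left nhdsWithin_le_nhds
      refine le_of_tendsto hlim ?_
      filter_upwards [self_mem_nhdsWithin] with t ht
      have ht' : 0 < t := ht
      refine hstrict _ ?_ ?_
      · simp
        linarith [abs_nonneg z.im]
      · simp
        linarith
    intro z hz
    rcases le_total 0 z.re with h | h
    · exact hnonneg z (by rwa [abs_of_nonneg h] at hz)
    · rw [← hVeven]
      refine hnonneg _ ?_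
      rw [abs_of_nonpos h] at hz
      simpa using hz
  have hVgrowth : ∀ z, ‖V z‖ ≤ (C + M) * Real.exp ((2 * T) * ‖z‖ ^ 2) := by
    intro z
    have hT0 : 0 ≤ T := by linarith
    have h1 : z.re ^ 2 ≤ ‖z‖ ^ 2 := by
      rw [Complex.sq_norm, Complex.normSq_apply]
      nlinarith [sq_nonneg z.im]
    have h2 : z.im ^ 2 ≤ ‖z‖ ^ 2 := by
      rw [Complex.sq_norm, Complex.normSq_apply]
      nlinarith [sq_nonneg z.re]
    have h3 : ‖cexp (T * z ^ 2)‖ ≤ Real.exp (T * ‖z‖ ^ 2) := by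
      rw [Complex.norm_exp, Complex.re_ofReal_mul, sq z, Complex.mul_re]
      refine Real.exp_le_exp.2 (mul_le_mul_of_nonneg_left ?_ hT0)
      nlinarith [sq_nonneg z.im]
    calc ‖V z‖ ≤ ‖cexp (T * z ^ 2)‖ * ‖E z‖ + ‖∫ ω in Aᶜ, g z ω ∂ν‖ := by
          rw [← norm_mul]
          exact norm_sub_le _ _
      _ ≤ Real.exp (T * ‖z‖ ^ 2) * (C * Real.exp (T * ‖z‖ ^ 2)) +
          M * Real.exp (T * ‖z‖ ^ 2) := by
          refine add_le_add (mul_le_mul h3 ((hbound z).trans ?_) (norm_nonneg _)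
            (Real.exp_pos _).le) (hint1 z)
          gcongr
      _ ≤ C * Real.exp ((2 * T) * ‖z‖ ^ 2) + M * Real.exp ((2 * T) * ‖z‖ ^ 2) := by
          refine add_le_add (le_of_eq ?_) ?_
          · rw [mul_left_comm, ← Real.exp_add]
            ring_nf
          · gcongr
            nlinarith [mul_nonneg hT0 (sq_nonneg ‖z‖)]
      _ = _ := by ring
  -- In the variable ζ = -z² this double sector is the right half-plane, and growth of order 2
  -- becomes order 1. The imaginary ζ-axis lies in the sector already treated; positive ζ correspond
  -- to imaginary z, where S < T keeps V bounded. Evenness makes the choice of square root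
  -- immaterial.
  have hVb2 : ∀ z : ℂ, |z.re| ≤ |z.im| → ‖V z‖ ≤ M := by
    set f : ℂ → ℂ := fun ζ => V (I * ζ ^ (1 / 2 : ℂ)) with hf
    have hsq : ∀ ζ : ℂ, (I * ζ ^ (1 / 2 : ℂ)) ^ 2 = -ζ := by
      intro ζ
      rw [mul_pow, I_sq, one_div, Complex.cpow_ofNat_inv_pow]
      ring
    have hnorm : ∀ ζ : ℂ, ‖I * ζ ^ (1 / 2 : ℂ)‖ ^ 2 = ‖ζ‖ := by
      intro ζ
      rw [← norm_pow, hsq, norm_neg]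
    have hfb : ∀ ζ : ℂ, 0 ≤ ζ.re → ‖f ζ‖ ≤ M := by
      intro ζ hζ
      refine PhragmenLindelof.right_half_plane_of_bounded_on_real (f := f) ?_ ?_ ?_ ?_ hζ
      · constructor
        · intro w hw
          have hw' : w ∈ Complex.slitPlane := Or.inl hw
          exact ((hVd _).comp w (((differentiableAt_id).cpow_const hw').const_mul I)
            ).differentiableWithinAt
        · rw [Complex.closure_setOfPred_lt_re]
          intro w hw
          exact (hVd.continuous.continuousAt.comp (continuousAt_const.mul
            (continuousAt_cpow_const_of_re_pos (Or.inl hw) (by norm_num)))).continuousWithinAt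
      · refine ⟨1, by norm_num, 2 * T, IsBigO.of_bound (C + M) (Eventually.of_forall fun ζ => ?_)⟩
        rw [Real.norm_of_nonneg (Real.exp_pos _).le, Real.rpow_one, ← hnorm ζ]
        exact hVgrowth _
      · refine isBoundedUnder_of_eventually_le (a := C + M) ?_
        filter_upwards [eventually_ge_atTop 0] with x hx
        have hz : (I * (x : ℂ) ^ (1 / 2 : ℂ)) = I * (√x : ℝ) := by
          rw [Real.sqrt_eq_rpow, Complex.ofReal_cpow hx]
          norm_num
        simp only [hf, hz]
        set z : ℂ := I * (√x : ℝ)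
        have hzre : z.re = 0 := by simp [z]
        have hzim : z.im ^ 2 = x := by simp [z, Real.sq_sqrt hx]
        have hz2 : (T * z ^ 2).re = -(T * x) := by
          rw [Complex.re_ofReal_mul, sq z, Complex.mul_re, hzre, ← sq z.im, hzim]
          ring
        have h1 : ‖cexp (T * z ^ 2)‖ * ‖E z‖ ≤ C := by
          rw [Complex.norm_exp, hz2]
          calc _ ≤ Real.exp (-(T * x)) * (C * Real.exp (S * z.im ^ 2)) := by
                gcongr
                exact hbound z
            _ = C * Real.exp ((S - T) * x) := by
                rw [hzim, mul_left_comm, ← Real.exp_add]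
                ring_nf
            _ ≤ C := by
                refine mul_le_of_le_one_right hC (Real.exp_le_one_iff.2 ?_)
                nlinarith
        have h2 : ‖∫ ω in Aᶜ, g z ω ∂ν‖ ≤ M := by
          refine (norm_integral_le_of_norm_le hψ0.norm.integrableOn
            ((ae_restrict_iff' hAm.compl).2 (Eventually.of_forall fun ω hω => ?_))).trans
              (setIntegral_le_integral hψ0.norm (Eventually.of_forall fun ω => norm_nonneg _))
          rw [hgnorm, hzre, hzim]
          refine mul_le_of_le_one_right (norm_nonneg _) (Real.exp_le_one_iff.2 ?_)
          have : ρ ω ≤ T := not_lt.1 hω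
          nlinarith
        calc _ ≤ ‖cexp (T * z ^ 2)‖ * ‖E z‖ + ‖∫ ω in Aᶜ, g z ω ∂ν‖ := by
              rw [← norm_mul]
              exact norm_sub_le _ _
          _ ≤ _ := add_le_add h1 h2
      · intro x
        refine hVb1 _ ?_
        have h1 := congrArg Complex.re (hsq (x * I))
        rw [sq, Complex.mul_re] at h1
        rw [← sq_le_sq]
        simp only [Complex.neg_re, Complex.re_ofReal_mul, Complex.I_re, mul_zero, neg_zero] at h1
        linarith
    intro z hz
    have h1 : 0 ≤ (-(z ^ 2)).re := by
      rw [Complex.neg_re, sq, Complex.mul_re]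
      have := sq_le_sq.2 hz
      linarith
    have h2 := hfb _ h1
    have h3 : (I * (-(z ^ 2)) ^ (1 / 2 : ℂ)) ^ 2 = z ^ 2 := by rw [hsq, neg_neg]
    rcases sq_eq_sq_iff_eq_or_eq_neg.1 h3 with h | h
    · simpa only [hf, h] using h2
    · simpa only [hf, h, hVeven] using h2
  have hVconst : ∀ z, V z = V 1 := by
    intro z
    refine hVd.apply_eq_apply_of_bounded ?_ z 1
    rw [isBounded_iff_forall_norm_le]
    refine ⟨M, ?_⟩
    rintro _ ⟨w, rfl⟩
    rcases le_total |w.im| |w.re| with h | h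
    · exact hVb1 w h
    · exact hVb2 w h
  -- On ρ > T the exponent (n+1)²(T - ρ) tends to -∞, with ‖ψ‖ as dominating function.
  have hlim : Tendsto (fun n : ℕ => V (n + 1 : ℝ)) atTop (𝓝 0) := by
    have h1 : ∀ n : ℕ, V (n + 1 : ℝ) = ∫ ω in A, g (n + 1 : ℝ) ω ∂ν := by
      intro n
      have hp : (0 : ℝ) < n + 1 := by positivity
      refine hVeq _ ?_ ?_
      · rw [Complex.ofReal_re]
        exact hp
      · rw [Complex.ofReal_re, Complex.ofReal_im, abs_zero]
        exact hp
    simp only [h1]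
    rw [show (0 : ℂ) = ∫ ω in A, 0 ∂ν by simp]
    refine tendsto_integral_of_dominated_convergence (fun ω => ‖ψ ω‖) (fun n => (hgm _).restrict)
      hψ0.norm.integrableOn (fun n => ?_) ?_
    · refine (ae_restrict_iff' hAm).2 (Eventually.of_forall (hgA _ ?_))
      rw [Complex.ofReal_re, Complex.ofReal_im, zero_pow two_ne_zero, sub_zero]
      positivity
    · refine (ae_restrict_iff' hAm).2 (Eventually.of_forall fun ω hω => ?_)
      rw [tendsto_zero_iff_norm_tendsto_zero]
      simp only [hgnorm, Complex.ofReal_re, Complex.ofReal_im]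
      have hω' : T < ρ ω := hω
      have h2 : Tendsto (fun n : ℕ => (((n : ℝ) + 1) ^ 2 - 0 ^ 2) * (T - ρ ω)) atTop atBot := by
        refine Tendsto.atTop_mul_const_of_neg (by linarith) ?_
        refine tendsto_atTop_mono (f := fun n : ℕ => (n : ℝ)) (fun n => ?_)
          tendsto_natCast_atTop_atTop
        have : (0 : ℝ) ≤ n := Nat.cast_nonneg n
        nlinarith
      simpa using (Real.tendsto_exp_atBot.comp h2).const_mul ‖ψ ω‖
  have hV1 : V 1 = 0 := by
    refine tendsto_nhds_unique ?_ hlim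
    simp only [hVconst]
    exact tendsto_const_nhds
  have h1 := hVeq 1 (by simp) (by simp)
  rw [hV1] at h1
  -- The value z = 1 recovers the claim, as e^{-ρ} = e^{-T} e^{T-ρ}.
  have h2 : ∫ ω in A, ψ ω * (Real.exp (-ρ ω) : ℝ) ∂ν = cexp (-T) * ∫ ω in A, g 1 ω ∂ν := by
    rw [← integral_const_mul]
    refine integral_congr_ae (Eventually.of_forall fun ω => ?_)
    simp only [hg]
    push_cast
    rw [mul_left_comm, ← Complex.exp_add]
    ring_nf
  rw [h2, ← h1, mul_zero]

end PaleyWiener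

end Weinstein

end

noncomputable section

namespace Weinstein

/-! ### Density of even polynomials on the sphere -/

open Filter Topology

variable {d : ℕ} {α : ℝ}

lemma norm_reflectLast (x : Space d) : ‖reflectLast x‖ = ‖x‖ := by
  rw [EuclideanSpace.norm_eq, EuclideanSpace.norm_eq, Fin.sum_univ_castSucc,
    Fin.sum_univ_castSucc]
  simp only [reflectLast_castSucc, reflectLast_last, norm_neg]

lemma half_add_reflectPoly_mem_evenPoly (p : Poly d) :
    (1 / 2 : ℂ) • (p + reflectPoly p) ∈ evenPoly d := by
  refine Submodule.smul_mem _ _ (mem_evenPoly.2 fun β hβ => ?_)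
  rw [MvPolynomial.coeff_add, coeff_reflectPoly, (Nat.not_even_iff_odd.1 hβ).neg_one_pow]
  ring

/-- The star subalgebra of polynomial functions on the unit sphere. -/
def spherePoly (d : ℕ) : StarSubalgebra ℂ C(Metric.sphere (0 : Space d) 1, ℂ) where
  carrier := {g | ∃ p : Poly d, ∀ t, g t = polyFun p t}
  mul_mem' := by
    rintro f g ⟨p, hp⟩ ⟨q, hq⟩
    exact ⟨p * q, fun t => by simp [hp, hq]⟩
  add_mem' := by
    rintro f g ⟨p, hp⟩ ⟨q, hq⟩
    exact ⟨p + q, fun t => by simp [hp, hq]⟩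
  algebraMap_mem' c := ⟨MvPolynomial.C c, fun t => by simp [algebraMap_apply]⟩
  star_mem' := by
    rintro f ⟨p, hp⟩
    exact ⟨conjPoly p, fun t => by simp [hp, polyFun_conjPoly]⟩

lemma exists_polyFun_sub_le (g : C(Metric.sphere (0 : Space d) 1, ℂ)) {ε : ℝ} (hε : 0 < ε) :
    ∃ p : Poly d, ∀ t : Metric.sphere (0 : Space d) 1, ‖g t - polyFun p t‖ ≤ ε := by
  have h := ContinuousMap.starSubalgebra_topologicalClosure_eq_top_of_separatesPoints
    (spherePoly d) (by
      intro s t hst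
      obtain ⟨j, hj⟩ : ∃ j, (s : Space d) j ≠ (t : Space d) j := by
        by_contra! h
        exact hst (Subtype.ext (PiLp.ext h))
      refine ⟨_, ⟨⟨fun t => polyFun (MvPolynomial.X j : Poly d) t, by fun_prop⟩,
        ⟨MvPolynomial.X j, fun t => rfl⟩, rfl⟩, ?_⟩
      simpa using hj)
  have hg : g ∈ (spherePoly d).topologicalClosure := by
    rw [h]
    trivial
  have hg' : g ∈ closure (spherePoly d : Set C(Metric.sphere (0 : Space d) 1, ℂ)) := hg
  obtain ⟨f, ⟨p, hp⟩, hf⟩ := Metric.mem_closure_iff.1 hg' ε hε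
  refine ⟨p, fun t => ?_⟩
  rw [← hp, ← dist_eq_norm]
  exact (ContinuousMap.dist_apply_le_dist t).trans hf.le

/-- Stone–Weierstrass approximates the conjugate of f; averaging the approximant with its reflection
makes it even at no cost, because f is. Then the integral of |f|² = f(f̄ - q) + fq is arbitrarily
small. -/
lemma ae_eq_zero_of_integral_evenPoly (hα : -1 / 2 < α) {f : Space d → ℂ} (hf : Continuous f)
    (hfe : EvenInLast f)
    (h : ∀ p ∈ evenPoly d, ∫ t : Metric.sphere (0 : Space d) 1, f t * polyFun p t
      ∂(sphereMeasure d α) = 0) :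
    ∀ᵐ t : Metric.sphere (0 : Space d) 1 ∂(sphereMeasure d α), f t = 0 := by
  have := isFiniteMeasure_sphereMeasure d hα
  have hint : ∀ g : Metric.sphere (0 : Space d) 1 → ℂ, Continuous g →
      Integrable g (sphereMeasure d α) := fun g hg =>
    hg.integrable_of_hasCompactSupport (HasCompactSupport.of_compactSpace g)
  set F : Metric.sphere (0 : Space d) 1 → ℂ := fun t => f t with hF
  have hFc : Continuous F := hf.comp continuous_subtype_val
  have hsq : ∫ t, ‖F t‖ ^ 2 ∂(sphereMeasure d α) = 0 := by
    refine le_antisymm (le_of_forall_pos_le_add fun ε hε => ?_)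
      (integral_nonneg fun t => by positivity)
    rw [zero_add]
    set M : ℝ := ∫ t, ‖F t‖ ∂(sphereMeasure d α) with hM
    have hM0 : 0 ≤ M := integral_nonneg fun t => norm_nonneg _
    obtain ⟨p, hp⟩ := exists_polyFun_sub_le (d := d)
      ⟨fun t => starRingEnd ℂ (F t), Complex.continuous_conj.comp hFc⟩
      (div_pos hε (by linarith : 0 < M + 1))
    set δ : ℝ := ε / (M + 1) with hδ
    set q : Poly d := (1 / 2 : ℂ) • (p + reflectPoly p) with hq
    have hqb : ∀ t : Metric.sphere (0 : Space d) 1,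
        ‖starRingEnd ℂ (F t) - polyFun q t‖ ≤ δ := by
      intro t
      have ht : reflectLast (t : Space d) ∈ Metric.sphere (0 : Space d) 1 := by
        rw [mem_sphere_zero_iff_norm, norm_reflectLast]
        exact mem_sphere_zero_iff_norm.1 t.2
      have h1 := hp t
      have h2 := hp ⟨reflectLast (t : Space d), ht⟩
      simp only [ContinuousMap.coe_mk, hF, hfe (t : Space d)] at h1 h2
      have h3 : starRingEnd ℂ (F t) - polyFun q t =
          (1 / 2 : ℂ) * ((starRingEnd ℂ (f t) - polyFun p t) +
            (starRingEnd ℂ (f t) - polyFun p (reflectLast (t : Space d)))) := by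
        rw [hq, polyFun_smul, polyFun_add, polyFun_reflectPoly]
        ring
      rw [h3, norm_mul]
      have h4 : ‖(1 / 2 : ℂ)‖ = 1 / 2 := by norm_num
      rw [h4]
      linarith [norm_add_le (starRingEnd ℂ (f t) - polyFun p t)
        (starRingEnd ℂ (f t) - polyFun p (reflectLast (t : Space d)))]
    have hqc : Continuous fun t : Metric.sphere (0 : Space d) 1 => polyFun q t :=
      (continuous_polyFun q).comp continuous_subtype_val
    have h1 : ((∫ t, ‖F t‖ ^ 2 ∂(sphereMeasure d α) : ℝ) : ℂ) =
        ∫ t, F t * (starRingEnd ℂ (F t) - polyFun q t) ∂(sphereMeasure d α) := by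
      have hi1 : Integrable (fun t => F t * starRingEnd ℂ (F t)) (sphereMeasure d α) :=
        hint _ (hFc.mul (Complex.continuous_conj.comp hFc))
      have hi2 : Integrable (fun t : Metric.sphere (0 : Space d) 1 => F t * polyFun q t)
        (sphereMeasure d α) := hint _ (hFc.mul hqc)
      simp only [mul_sub]
      rw [integral_sub hi1 hi2, h q (half_add_reflectPoly_mem_evenPoly p), sub_zero,
        ← integral_complex_ofReal]
      refine integral_congr_ae (Eventually.of_forall fun t => ?_)
      simp only [Complex.mul_conj, Complex.normSq_eq_norm_sq]
    calc ∫ t, ‖F t‖ ^ 2 ∂(sphereMeasure d α)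
        ≤ ‖((∫ t, ‖F t‖ ^ 2 ∂(sphereMeasure d α) : ℝ) : ℂ)‖ := by
          rw [Complex.norm_real]
          exact le_abs_self _
      _ ≤ ∫ t, ‖F t‖ * δ ∂(sphereMeasure d α) := by
          rw [h1]
          refine norm_integral_le_of_norm_le ((hint _ hFc).norm.mul_const _)
            (Eventually.of_forall fun t => ?_)
          rw [norm_mul]
          exact mul_le_mul_of_nonneg_left (hqb t) (norm_nonneg _)
      _ = M * δ := by rw [integral_mul_const]
      _ ≤ ε := by
          rw [hδ, mul_div_assoc', div_le_iff₀ (by linarith)]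
          nlinarith
  have hi : Integrable (fun t => ‖F t‖ ^ 2) (sphereMeasure d α) := by
    refine Continuous.integrable_of_hasCompactSupport (hFc.norm.pow 2) ?_
    exact HasCompactSupport.of_compactSpace _
  rw [integral_eq_zero_iff_of_nonneg (fun t => by positivity) hi] at hsq
  filter_upwards [hsq] with t ht
  simpa [hF] using ht

/-! ### Vanishing outside a ball -/

lemma eq_zero_of_setIntegral_Ioi_eq_zero {h : ℝ → ℂ} {R : ℝ} (hi : IntegrableOn h (Set.Ioi R))
    (hc : ContinuousOn h (Set.Ioi R)) (h0 : ∀ s, R < s → ∫ r in Set.Ioi s, h r = 0) {s : ℝ}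
    (hs : R < s) : h s = 0 := by
  obtain ⟨a, hRa, has⟩ := exists_between hs
  have hii : IntervalIntegrable h volume a s :=
    (intervalIntegrable_iff_integrableOn_Ioc_of_le has.le).2
      (hi.mono_set (Set.Ioc_subset_Ioi_self.trans (Set.Ioi_subset_Ioi hRa.le)))
  have h1 := intervalIntegral.integral_hasDerivAt_right hii
    (hc.stronglyMeasurableAtFilter isOpen_Ioi s hs) (hc.continuousAt (Ioi_mem_nhds hs))
  have h2 : (fun u => ∫ r in a..u, h r) =ᶠ[𝓝 s] fun _ => 0 := by
    filter_upwards [Ioi_mem_nhds hs] with u hu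
    rw [← intervalIntegral.integral_Ioi_sub_Ioi' (hi.mono_set (Set.Ioi_subset_Ioi hRa.le))
      (hi.mono_set (Set.Ioi_subset_Ioi (le_of_lt hu))), h0 a hRa, h0 u hu, sub_zero]
  exact h1.unique ((hasDerivAt_const s (0 : ℂ)).congr_of_eventuallyEq h2)

/-- Vanishing almost everywhere becomes vanishing on the open set ‖x‖ > R, x_{d+1} > 0 by
continuity. Its boundary is reached by limits and the lower half by reflection. -/
lemma eq_zero_of_ae_sphere (φ : 𝓢(Space d, ℂ)) (hφ : EvenInLast φ) {R : ℝ}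
    (h : ∀ r, R < r → ∀ᵐ t : Metric.sphere (0 : Space d) 1 ∂(sphereMeasure d α),
      φ (r • (t : Space d)) = 0) {x : Space d} (hx : R ≤ ‖x‖) : φ x = 0 := by
  have hae : ∀ᵐ x ∂(weightedMeasure d α), R < ‖x‖ → φ x = 0 := by
    have hm : MeasurableSet {x : Space d | R < ‖x‖ → φ x = 0} := by
      have : {x : Space d | R < ‖x‖ → φ x = 0} = {x | R < ‖x‖}ᶜ ∪ {x | φ x = 0} := by
        ext x
        simp [imp_iff_not_or]
      rw [this]
      exact (measurableSet_lt measurable_const measurable_norm).compl.union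
        (measurableSet_eq_fun φ.continuous.measurable measurable_const)
    have hcont : Continuous fun p : Metric.sphere (0 : Space d) 1 × ℝ => p.2 • (p.1 : Space d) := by
      fun_prop
    have hm2 : MeasurableSet {p : Metric.sphere (0 : Space d) 1 × ℝ |
        R < ‖p.2 • (p.1 : Space d)‖ → φ (p.2 • (p.1 : Space d)) = 0} := hcont.measurable hm
    rw [weightedMeasure_eq_map, ae_map_iff hcont.measurable.aemeasurable hm,
      Measure.ae_prod_iff_ae_ae hm2, Measure.ae_ae_comm hm2]
    filter_upwards [ae_pos_radialMeasure] with r hr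
    by_cases hRr : R < r
    · filter_upwards [h r hRr] with t ht _ using ht
    · refine Eventually.of_forall fun t ht => absurd ?_ hRr
      rw [norm_smul, mem_sphere_zero_iff_norm.1 t.2, mul_one, Real.norm_of_nonneg hr.le] at ht
      exact ht
  set U : Set (Space d) := halfSpace d ∩ {x | R < ‖x‖} with hU
  have hUo : IsOpen U := isOpen_halfSpace.inter (isOpen_lt continuous_const continuous_norm)
  have hUeq : Set.EqOn φ (fun _ => 0) U := by
    refine Measure.eqOn_open_of_ae_eq (μ := volume) ?_ hUo φ.continuous.continuousOn
      continuousOn_const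
    rw [weightedMeasure, ae_withDensity_iff (measurable_weight α),
      ae_restrict_iff' measurableSet_halfSpace] at hae
    refine (ae_restrict_iff' hUo.measurableSet).2 (hae.mono fun x hx hxU => ?_)
    refine hx hxU.1 ?_ hxU.2
    have : 0 < x (Fin.last d) := hxU.1
    simpa using Real.rpow_pos_of_pos this _
  have hupper : ∀ y : Space d, 0 ≤ y (Fin.last d) → R ≤ ‖y‖ → φ y = 0 := by
    intro y hy hyR
    set e : Space d := EuclideanSpace.single (Fin.last d) 1 with he
    -- For s > 0 this path makes the last coordinate positive and the norm larger than R, even when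
    -- y lies on both boundaries.
    have hlim : Tendsto (fun s : ℝ => φ ((1 + s) • y + s • e)) (𝓝[>] 0) (𝓝 (φ y)) := by
      have : Tendsto (fun s : ℝ => φ ((1 + s) • y + s • e)) (𝓝 0)
          (𝓝 (φ ((1 + (0 : ℝ)) • y + (0 : ℝ) • e))) :=
        (φ.continuous.comp (by fun_prop : Continuous fun s : ℝ => (1 + s) • y + s • e)).tendsto 0
      rw [add_zero, one_smul, zero_smul, add_zero] at this
      exact this.mono_left nhdsWithin_le_nhds
    refine tendsto_nhds_unique hlim (tendsto_const_nhds.congr' ?_)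
    filter_upwards [self_mem_nhdsWithin] with s hs
    have hs' : 0 < s := hs
    refine (hUeq ⟨?_, ?_⟩).symm
    · change 0 < ((1 + s) • y + s • e) (Fin.last d)
      simp [he]
      positivity
    · have hinner : inner ℝ y e = y (Fin.last d) := by
        simp [he, EuclideanSpace.inner_single_right]
      have hne : ‖e‖ = 1 := by simp [he]
      have h1 : ‖(1 + s) • y + s • e‖ ^ 2 = (1 + s) ^ 2 * ‖y‖ ^ 2 +
          2 * ((1 + s) * s * y (Fin.last d)) + s ^ 2 := by
        rw [norm_add_sq_real, norm_smul, norm_smul, inner_smul_left, inner_smul_right, hinner, hne,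
          Real.norm_of_nonneg hs'.le, Real.norm_of_nonneg (by linarith : (0 : ℝ) ≤ 1 + s)]
        simp
        ring
      refine hyR.trans_lt (lt_of_pow_lt_pow_left₀ 2 (norm_nonneg _) ?_)
      rw [h1]
      have : 0 ≤ (1 + s) * s * y (Fin.last d) := by positivity
      have : 0 ≤ s * (2 + s) * ‖y‖ ^ 2 := by positivity
      nlinarith [sq_pos_of_pos hs']
  rcases le_total 0 (x (Fin.last d)) with h0 | h0
  · exact hupper x h0 hx
  · rw [← hφ x]
    refine hupper _ ?_ ?_
    · rw [reflectLast_last]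
      linarith
    · rwa [norm_reflectLast]

/-- The integral of `φ(r ·)` against polynomials over the half-sphere. -/
def sphereIntegral (hα : -1 / 2 < α) (φ : 𝓢(Space d, ℂ)) (r : ℝ) : Poly d →ₗ[ℂ] ℂ where
  toFun p := ∫ t : Metric.sphere (0 : Space d) 1, φ (r • (t : Space d)) * polyFun p t
    ∂(sphereMeasure d α)
  map_add' p q := by
    have := isFiniteMeasure_sphereMeasure d hα
    have hi : ∀ p : Poly d, Integrable (fun t : Metric.sphere (0 : Space d) 1 =>
        φ (r • (t : Space d)) * polyFun p t) (sphereMeasure d α) := fun p =>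
      Continuous.integrable_of_hasCompactSupport
        ((φ.continuous.comp (by fun_prop)).mul
          ((continuous_polyFun p).comp continuous_subtype_val))
        (HasCompactSupport.of_compactSpace _)
    rw [← integral_add (hi p) (hi q)]
    simp only [polyFun_add, mul_add]
  map_smul' c p := by
    simp only [polyFun_smul, RingHom.id_apply, smul_eq_mul]
    rw [← integral_const_mul]
    simp only [mul_left_comm]

lemma sphereIntegral_apply (hα : -1 / 2 < α) (φ : 𝓢(Space d, ℂ)) (r : ℝ) (p : Poly d) :
    sphereIntegral hα φ r p = ∫ t : Metric.sphere (0 : Space d) 1,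
      φ (r • (t : Space d)) * polyFun p t ∂(sphereMeasure d α) := rfl

lemma continuous_sphereIntegral (hα : -1 / 2 < α) (φ : 𝓢(Space d, ℂ)) (p : Poly d) :
    Continuous fun r => sphereIntegral hα φ r p := by
  have := isFiniteMeasure_sphereMeasure d hα
  obtain ⟨C, hC⟩ : ∃ C : ℝ, ∀ x, ‖φ x‖ ≤ C := by
    obtain ⟨C, hC⟩ := φ.decay 0 0
    exact ⟨C, fun x => by simpa using hC.2 x⟩
  have hpc : Continuous fun t : Metric.sphere (0 : Space d) 1 => polyFun p t :=
    (continuous_polyFun p).comp continuous_subtype_val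
  refine continuous_of_dominated (bound := fun t => C * ‖polyFun p (t : Space d)‖)
    (fun r => ((φ.continuous.comp (by fun_prop)).mul hpc).aestronglyMeasurable)
    (fun r => Eventually.of_forall fun t => ?_) ?_ (Eventually.of_forall fun t => ?_)
  · rw [norm_mul]
    exact mul_le_mul_of_nonneg_right (hC _) (norm_nonneg _)
  · exact (Continuous.integrable_of_hasCompactSupport hpc
      (HasCompactSupport.of_compactSpace _)).norm.const_mul C
  · exact (φ.continuous.comp (by fun_prop)).mul continuous_const

lemma integrable_schwartz_mul_polyFun (hα : -1 / 2 < α) (φ : 𝓢(Space d, ℂ)) (p : Poly d) :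
    Integrable (fun x => φ x * polyFun p x) (weightedMeasure d α) := by
  have := hasTemperateGrowth_weightedMeasure d hα
  obtain ⟨C, n, hC0, hC⟩ := exists_norm_polyFun_le p
  have h1 := (φ.integrable_pow_mul (weightedMeasure d α) n).add
    (φ.integrable_pow_mul (weightedMeasure d α) 0)
  refine (h1.const_mul (C * 2 ^ n)).mono'
    (φ.continuous.mul (continuous_polyFun p)).aestronglyMeasurable (Eventually.of_forall fun x => ?_)
  have h2 : (1 + ‖x‖) ^ n ≤ 2 ^ n * (‖x‖ ^ n + 1) := by
    rcases le_total ‖x‖ 1 with h | h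
    · calc (1 + ‖x‖) ^ n ≤ 2 ^ n := by
            gcongr
            linarith
        _ ≤ _ := le_mul_of_one_le_right (by positivity) (by
            have : 0 ≤ ‖x‖ ^ n := by positivity
            linarith)
    · calc (1 + ‖x‖) ^ n ≤ (2 * ‖x‖) ^ n := by
            gcongr
            linarith
        _ = 2 ^ n * ‖x‖ ^ n := mul_pow _ _ _
        _ ≤ _ := by
            gcongr
            linarith
  rw [norm_mul]
  simp only [Pi.add_apply, pow_zero, one_mul]
  calc ‖φ x‖ * ‖polyFun p x‖ ≤ ‖φ x‖ * (C * (2 ^ n * (‖x‖ ^ n + 1))) := by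
        gcongr
        exact (hC x).trans (mul_le_mul_of_nonneg_left h2 hC0)
    _ = _ := by ring

/-- In polar coordinates the hypothesis says that a continuous function of r has integral 0 over (s,
∞) for every s > R. So it vanishes for r > R, and its radial weight is nonzero. -/
lemma eq_zero_of_setIntegral_harmonic_eq_zero (hα : -1 / 2 < α) (φ : 𝓢(Space d, ℂ))
    (hφ : EvenInLast φ) {R : ℝ} (hR : 0 < R)
    (h : ∀ l, ∀ Q ∈ harmonicPoly d α l, ∀ T, R ^ 2 < T →
      ∫ x in {x : Space d | T < ‖x‖ ^ 2}, (φ x * polyFun Q x) * (Real.exp (-‖x‖ ^ 2) : ℝ)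
        ∂(weightedMeasure d α) = 0) {x : Space d} (hx : R ≤ ‖x‖) : φ x = 0 := by
  have hzero : ∀ r, R < r → ∀ l, ∀ Q ∈ harmonicPoly d α l, sphereIntegral hα φ r Q = 0 := by
    intro r hr l Q hQ
    set g : Space d → ℂ := fun x => φ x * polyFun Q x * (Real.exp (-‖x‖ ^ 2) : ℝ) with hg
    have hgi : Integrable g (weightedMeasure d α) := by
      refine (integrable_schwartz_mul_polyFun hα φ Q).norm.mono' ?_
        (Eventually.of_forall fun x => ?_)
      · exact ((φ.continuous.mul (continuous_polyFun Q)).mul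
          (by fun_prop)).aestronglyMeasurable
      · rw [hg, norm_mul, Complex.norm_real, Real.norm_of_nonneg (Real.exp_pos _).le]
        exact mul_le_of_le_one_right (norm_nonneg _) (Real.exp_le_one_iff.2 (by
          have := sq_nonneg ‖x‖
          linarith))
    set w : ℝ → ℂ := fun r => ((r ^ ((d : ℝ) + (2 * α + 1)) : ℝ) : ℂ) *
      ((r : ℂ) ^ l * (Real.exp (-r ^ 2) : ℝ)) with hw
    have hpolar : ∀ r : ℝ, 0 < r → ∫ t : Metric.sphere (0 : Space d) 1, g (r • (t : Space d))
        ∂(sphereMeasure d α) =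
          ((r : ℂ) ^ l * (Real.exp (-r ^ 2) : ℝ)) * sphereIntegral hα φ r Q := by
      intro r hr
      rw [sphereIntegral_apply, ← integral_const_mul]
      refine integral_congr_ae (Eventually.of_forall fun t => ?_)
      simp only [hg]
      rw [polyFun_real_smul hQ.1.1, norm_smul, mem_sphere_zero_iff_norm.1 t.2, mul_one,
        Real.norm_of_nonneg hr.le]
      ring
    have hset : ∀ s, R < s → ∫ r in Set.Ioi s, w r * sphereIntegral hα φ r Q = 0 := by
      intro s hs
      have hs0 : 0 < s := hR.trans hs
      have hms : MeasurableSet {x : Space d | s ^ 2 < ‖x‖ ^ 2} :=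
        measurableSet_lt measurable_const (by fun_prop)
      have h1 := h l Q hQ (s ^ 2) (by nlinarith)
      rw [← integral_indicator hms, integral_polar (hgi.indicator hms),
        integral_radialMeasure] at h1
      rw [← h1, ← integral_indicator measurableSet_Ioi, ← integral_indicator measurableSet_Ioi]
      congr 1
      ext r
      by_cases hr : r ∈ Set.Ioi (0 : ℝ)
      · have hr0 : 0 < r := hr
        rw [Set.indicator_of_mem hr]
        have hmem : ∀ t : Metric.sphere (0 : Space d) 1,
            r • (t : Space d) ∈ {x : Space d | s ^ 2 < ‖x‖ ^ 2} ↔ s < r := by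
          intro t
          rw [Set.mem_ofPred_eq, norm_smul, mem_sphere_zero_iff_norm.1 t.2, mul_one,
            Real.norm_of_nonneg hr0.le, sq_lt_sq₀ hs0.le hr0.le]
        by_cases hsr : s < r
        · have h2 : ∀ t : Metric.sphere (0 : Space d) 1,
              {x : Space d | s ^ 2 < ‖x‖ ^ 2}.indicator g (r • (t : Space d)) =
                g (r • (t : Space d)) := fun t => Set.indicator_of_mem ((hmem t).2 hsr) _
          rw [Set.indicator_of_mem (Set.mem_Ioi.2 hsr)]
          simp only [h2]
          rw [hpolar r hr0, hw]
          ring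
        · have h2 : ∀ t : Metric.sphere (0 : Space d) 1,
              {x : Space d | s ^ 2 < ‖x‖ ^ 2}.indicator g (r • (t : Space d)) = 0 :=
            fun t => Set.indicator_of_notMem (fun h => hsr ((hmem t).1 h)) _
          rw [Set.indicator_of_notMem (by simpa using hsr)]
          simp only [h2]
          simp
      · rw [Set.indicator_of_notMem hr, Set.indicator_of_notMem]
        exact fun h3 => hr (hs0.trans h3)
    have hcont : ContinuousOn (fun r => w r * sphereIntegral hα φ r Q) (Set.Ioi R) := by
      refine ContinuousOn.mul ?_ (continuous_sphereIntegral hα φ Q).continuousOn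
      refine ContinuousOn.mul (Complex.continuous_ofReal.comp_continuousOn fun r hr =>
        (Real.continuousAt_rpow_const r _ (Or.inl (ne_of_gt (hR.trans hr)))).continuousWithinAt) ?_
      fun_prop
    have hinteg : IntegrableOn (fun r => w r * sphereIntegral hα φ r Q) (Set.Ioi R) := by
      have h1 := (integrable_polar hgi).integral_prod_right
      rw [radialMeasure, integrable_withDensity_iff_integrable_smul' (by fun_prop) (by simp)] at h1
      have h2 : IntegrableOn _ (Set.Ioi R) volume :=
        IntegrableOn.mono_set h1 (Set.Ioi_subset_Ioi hR.le)
      refine h2.congr_fun (fun r hr => ?_) measurableSet_Ioi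
      have hr0 : 0 < r := hR.trans hr
      simp only
      rw [hpolar r hr0, ENNReal.toReal_ofReal (Real.rpow_nonneg hr0.le _), Complex.real_smul, hw]
      ring
    have h1 := eq_zero_of_setIntegral_Ioi_eq_zero hinteg hcont hset hr
    have hr0 : 0 < r := hR.trans hr
    refine (mul_eq_zero.1 h1).resolve_left ?_
    have := (Real.rpow_pos_of_pos hr0 ((d : ℝ) + (2 * α + 1))).ne'
    have h3 := (Real.exp_pos (-r ^ 2)).ne'
    exact mul_ne_zero (by exact_mod_cast this)
      (mul_ne_zero (pow_ne_zero _ (by exact_mod_cast hr0.ne')) (by exact_mod_cast h3))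
  refine eq_zero_of_ae_sphere (α := α) φ hφ (fun r hr => ?_) hx
  refine ae_eq_zero_of_integral_evenPoly hα (f := fun x => φ (r • x))
    (φ.continuous.comp (by fun_prop)) (fun x => ?_) fun p hp => ?_
  · have : r • reflectLast x = reflectLast (r • x) := by
      ext j
      refine Fin.lastCases ?_ (fun i => ?_) j
      · simp [reflectLast_last]
      · simp [reflectLast_castSucc]
    simp only [this, hφ (r • x)]
  · refine eq_zero_of_eq_zero_on_harmonicPoly hα (sphereIntegral hα φ r) (fun p => ?_)
      (hzero r hr) hp
    rw [sphereIntegral_apply, sphereIntegral_apply]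
    refine integral_congr_ae (Eventually.of_forall fun t => ?_)
    simp [polyFun_normSqPoly]

end Weinstein

end

noncomputable section

namespace Weinstein

/-! ### Gaussian averages of the spherical harmonic coefficients -/

open Filter Topology

variable {d : ℕ} {α : ℝ}

lemma integrable_pow_mul_exp_radialMeasure (hα : -1 / 2 < α) (n : ℕ) {a : ℝ} (ha : 0 < a) :
    Integrable (fun τ : ℝ => τ ^ (2 * n) * Real.exp (-(a * τ ^ 2))) (radialMeasure d α) := by
  rw [radialMeasure, integrable_withDensity_iff_integrable_smul' (by fun_prop) (by simp)]
  have hs : (-1 : ℝ) < (d : ℝ) + (2 * α + 1) + ((2 * n : ℕ) : ℝ) := by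
    have : (0 : ℝ) ≤ d := Nat.cast_nonneg _
    have : (0 : ℝ) ≤ ((2 * n : ℕ) : ℝ) := Nat.cast_nonneg _
    linarith
  refine IntegrableOn.congr_fun (integrableOn_rpow_mul_exp_neg_mul_sq ha hs) (fun τ hτ => ?_)
    measurableSet_Ioi
  have hτ0 : 0 < τ := hτ
  rw [ENNReal.toReal_ofReal (Real.rpow_nonneg hτ0.le _), Real.rpow_add hτ0, Real.rpow_natCast,
    smul_eq_mul, mul_assoc, neg_mul]

lemma integrable_schwartz (hα : -1 / 2 < α) (φ : 𝓢(Space d, ℂ)) :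
    Integrable φ (weightedMeasure d α) := by
  simpa only [polyFun_C, mul_one] using integrable_schwartz_mul_polyFun hα φ (MvPolynomial.C 1)

lemma continuous_kernel_comp (hα : -1 / 2 < α) {X : Type*} [TopologicalSpace X]
    {f g : X → Space d} (hf : Continuous f) (hg : Continuous g) :
    Continuous fun x => kernel α (fun j => (f x j : ℂ)) (g x) := by
  have h : Continuous fun x => ((fun j => (f x j : ℂ)) : Fin (d + 1) → ℂ) :=
    continuous_pi fun j => Complex.continuous_ofReal.comp
      ((continuous_coord (d := d) j).comp hf)
  have h2 := (continuous_kernel (d := d) hα).comp (h.prodMk hg)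
  exact h2

lemma norm_transform_le (hα : -1 / 2 < α) (φ : 𝓢(Space d, ℂ)) (ξ : Space d) :
    ‖transform α φ ξ‖ ≤ ∫ x, ‖φ x‖ ∂(weightedMeasure d α) := by
  refine norm_integral_le_of_norm_le (integrable_schwartz hα φ).norm
    (Eventually.of_forall fun x => ?_)
  rw [norm_mul]
  exact mul_le_of_le_one_right (norm_nonneg _) (norm_kernel_real_le hα ξ x)

lemma continuous_transform (hα : -1 / 2 < α) (φ : 𝓢(Space d, ℂ)) :
    Continuous (transform α φ) := by
  refine continuous_of_dominated (bound := fun x => ‖φ x‖) (fun ξ => ?_)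
    (fun ξ => Eventually.of_forall fun x => ?_) (integrable_schwartz hα φ).norm
    (Eventually.of_forall fun x => ?_)
  · exact (φ.continuous.mul (continuous_kernel_comp hα continuous_const continuous_id)
      ).aestronglyMeasurable
  · rw [norm_mul]
    exact mul_le_of_le_one_right (norm_nonneg _) (norm_kernel_real_le hα ξ x)
  · exact continuous_const.mul (continuous_kernel_comp hα continuous_id continuous_const)

lemma integrable_transform_mul_harmonic (hα : -1 / 2 < α) (φ : 𝓢(Space d, ℂ)) (P : Poly d)
    (s : ℝ) :
    Integrable (fun ξ => transform α φ (s • ξ) * (polyFun P ξ * gauss ξ))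
      (weightedMeasure d α) := by
  refine integrable_mul_polyFun_mul_gauss hα P
    ((continuous_transform hα φ).comp (continuous_const_smul s))
    (C := ∫ x, ‖φ x‖ ∂(weightedMeasure d α)) (c := 0) fun ξ => ?_
  rw [zero_mul, Real.exp_zero, mul_one]
  exact norm_transform_le hα φ _

/-- Fubini and the Hecke identity at y = 2wx; the factor 2 turns ‖y‖²/4 into w²‖x‖². -/
lemma integral_transform_mul_harmonic_mul_gauss (hα : -1 / 2 < α) (φ : 𝓢(Space d, ℂ)) {l : ℕ}
    {P : Poly d} (hP : P ∈ harmonicPoly d α l) (w : ℝ) :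
    ∫ ξ, transform α φ ((2 * w) • ξ) * (polyFun P ξ * gauss ξ) ∂(weightedMeasure d α) =
      (2 * w : ℂ) ^ l * ∫ x, (φ x * polyFun (heckePoly hα l P) x) *
        (Real.exp (-(w ^ 2 * ‖x‖ ^ 2)) : ℝ) ∂(weightedMeasure d α) := by
  set μ := weightedMeasure d α with hμ
  have hint : Integrable (fun p : Space d × Space d =>
      φ p.2 * kernel α (fun j => (((2 * w) • p.1) j : ℂ)) p.2 * (polyFun P p.1 * gauss p.1))
      (μ.prod μ) := by
    have h1 := (integrable_polyFun_mul_gauss hα P).norm.mul_prod (integrable_schwartz hα φ).norm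
    refine h1.mono' ?_ (Eventually.of_forall fun p => ?_)
    · refine Continuous.aestronglyMeasurable ?_
      refine ((φ.continuous.comp continuous_snd).mul (continuous_kernel_comp hα
        (continuous_fst.const_smul (2 * w)) continuous_snd)).mul ?_
      exact ((continuous_polyFun P).mul continuous_gauss).comp continuous_fst
    · rw [norm_mul, norm_mul, mul_comm]
      exact mul_le_mul_of_nonneg_left (mul_le_of_le_one_right (norm_nonneg _)
        (norm_kernel_real_le hα _ _)) (norm_nonneg _)
  calc _ = ∫ ξ, ∫ x, φ x * kernel α (fun j => (((2 * w) • ξ) j : ℂ)) x *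
        (polyFun P ξ * gauss ξ) ∂μ ∂μ := by
        refine integral_congr_ae (Eventually.of_forall fun ξ => ?_)
        simp only
        rw [integral_mul_const, transform]
    _ = ∫ x, ∫ ξ, φ x * kernel α (fun j => (((2 * w) • ξ) j : ℂ)) x *
        (polyFun P ξ * gauss ξ) ∂μ ∂μ := integral_integral_swap hint
    _ = _ := by
        rw [← integral_const_mul]
        refine integral_congr_ae (Eventually.of_forall fun x => ?_)
        simp only [mul_assoc (φ x)]
        rw [integral_const_mul]
        simp only [kernel_real_smul]
        rw [integral_kernel_mul_harmonic_mul_gauss hα hP, ← polyFun_heckePoly,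
          polyFun_real_smul (heckePoly_mem_harmonicPoly hα hP).1.1, norm_smul, mul_pow,
          Real.norm_eq_abs, sq_abs,
          show (2 * w) ^ 2 * ‖x‖ ^ 2 / 4 = w ^ 2 * ‖x‖ ^ 2 by ring]
        push_cast
        ring

/-- One factor τ^l comes from the homogeneity of P, the other compensates the normalization
(2wτ)^{-l} of the coefficient, whose (2w)^{-l} cancels the power from the Hecke identity. -/
lemma integral_harmonicCoeff_mul_gauss (hα : -1 / 2 < α) (φ : 𝓢(Space d, ℂ)) {l : ℕ}
    {P : Poly d} (hP : P ∈ harmonicPoly d α l) {w : ℝ} (hw : 0 < w) :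
    ∫ τ, harmonicCoeff α l P φ (2 * w * τ) * ((τ ^ (2 * l) * Real.exp (-τ ^ 2) : ℝ) : ℂ)
        ∂(radialMeasure d α) =
      ∫ x, (φ x * polyFun (heckePoly hα l P) x) *
        (Real.exp (-(w ^ 2 * ‖x‖ ^ 2)) : ℝ) ∂(weightedMeasure d α) := by
  have hw' : (2 * w : ℂ) ^ l ≠ 0 := pow_ne_zero _ (by exact_mod_cast (by positivity : 2 * w ≠ 0))
  refine mul_left_cancel₀ hw' ?_
  rw [← integral_transform_mul_harmonic_mul_gauss hα φ hP,
    integral_polar (integrable_transform_mul_harmonic hα φ P (2 * w)), ← integral_const_mul]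
  refine integral_congr_ae ?_
  filter_upwards [ae_pos_radialMeasure] with τ hτ
  have hτ' : (τ : ℂ) ≠ 0 := by exact_mod_cast hτ.ne'
  have h1 : ∫ t : Metric.sphere (0 : Space d) 1, transform α φ ((2 * w) • τ • (t : Space d)) *
      (polyFun P (τ • (t : Space d)) * gauss (τ • (t : Space d))) ∂(sphereMeasure d α) =
      ((τ : ℂ) ^ l * (Real.exp (-τ ^ 2) : ℝ)) * ∫ t : Metric.sphere (0 : Space d) 1,
        transform α φ ((2 * w * τ) • (t : Space d)) * polyFun P (t : Space d)
          ∂(sphereMeasure d α) := by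
    rw [← integral_const_mul]
    refine integral_congr_ae (Eventually.of_forall fun t => ?_)
    simp only
    rw [polyFun_real_smul hP.1.1, gauss, norm_smul, mem_sphere_zero_iff_norm.1 t.2, mul_one,
      Real.norm_of_nonneg hτ.le, smul_smul]
    ring
  rw [h1, harmonicCoeff]
  push_cast
  rw [mul_pow _ (τ : ℂ), two_mul l, pow_add]
  field_simp

/-- Completing the square in 2R|Im w||τ| - τ². Keeping a fraction a of the Gaussian for
integrability in τ costs the passage from R² to R²/(1-a). -/
lemma norm_comp_mul_gauss_le {G : ℂ → ℂ} {c R : ℝ}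
    (hG : ∀ z, ‖G z‖ ≤ c * Real.exp (R * |z.im|)) (l : ℕ) {a : ℝ} (ha : a < 1) (w : ℂ) (τ : ℝ) :
    ‖G (2 * w * τ) * ((τ ^ (2 * l) * Real.exp (-τ ^ 2) : ℝ) : ℂ)‖ ≤
      c * Real.exp (R ^ 2 / (1 - a) * w.im ^ 2) * (τ ^ (2 * l) * Real.exp (-(a * τ ^ 2))) := by
  have hc : 0 ≤ c := by simpa using (norm_nonneg _).trans (hG 0)
  have hτ : 0 ≤ τ ^ (2 * l) := by
    rw [pow_mul]
    positivity
  have him : (2 * w * τ).im = 2 * w.im * τ := by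
    rw [Complex.im_mul_ofReal, show (2 * w).im = 2 * w.im by simp]
  have h1a : 0 < 1 - a := by linarith
  have hexp : R * |2 * w.im * τ| - τ ^ 2 ≤ R ^ 2 / (1 - a) * w.im ^ 2 - a * τ ^ 2 := by
    rw [abs_mul, abs_mul, abs_two, ← sq_abs w.im, ← sq_abs τ]
    have h2 := sq_nonneg (R * |w.im| - (1 - a) * |τ|)
    have h3 : R ^ 2 / (1 - a) * |w.im| ^ 2 - a * |τ| ^ 2 - (R * (2 * |w.im| * |τ|) - |τ| ^ 2) =
        (R * |w.im| - (1 - a) * |τ|) ^ 2 / (1 - a) := by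
      field_simp
      ring
    have h4 : 0 ≤ (R * |w.im| - (1 - a) * |τ|) ^ 2 / (1 - a) := by positivity
    linarith
  rw [norm_mul, Complex.norm_real, Real.norm_of_nonneg (by positivity)]
  calc _ ≤ c * Real.exp (R * |(2 * w * τ).im|) * (τ ^ (2 * l) * Real.exp (-τ ^ 2)) := by
        gcongr
        exact hG _
    _ = c * τ ^ (2 * l) * Real.exp (R * |2 * w.im * τ| - τ ^ 2) := by
        rw [him, sub_eq_add_neg, Real.exp_add]
        ring
    _ ≤ c * τ ^ (2 * l) * Real.exp (R ^ 2 / (1 - a) * w.im ^ 2 - a * τ ^ 2) := by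
        gcongr
    _ = _ := by
        rw [sub_eq_add_neg, Real.exp_add]
        ring

lemma setIntegral_heckePoly_eq_zero (hα : -1 / 2 < α) (φ : 𝓢(Space d, ℂ)) {l : ℕ}
    {P : Poly d} (hP : P ∈ harmonicPoly d α l) {R : ℝ} (hR : 0 < R) {G : ℂ → ℂ}
    (hGd : Differentiable ℂ G) (hGr : ∀ r : ℝ, 0 < r → G r = harmonicCoeff α l P φ r) {c : ℝ}
    (hG : ∀ z, ‖G z‖ ≤ c * Real.exp (R * |z.im|)) {T : ℝ} (hT : R ^ 2 < T) :
    ∫ x in {x : Space d | T < ‖x‖ ^ 2}, (φ x * polyFun (heckePoly hα l P) x) *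
      (Real.exp (-‖x‖ ^ 2) : ℝ) ∂(weightedMeasure d α) = 0 := by
  have hc : 0 ≤ c := by simpa using (norm_nonneg _).trans (hG 0)
  obtain ⟨S, hRS, hST⟩ := exists_between hT
  have hR2 : 0 < R ^ 2 := by positivity
  have hS0 : 0 < S := hR2.trans hRS
  -- Chosen so that R²/(1-a) = S. Taking R² < S < T leaves room both for a > 0 and for the strict
  -- inequality in the Paley–Wiener step.
  set a : ℝ := 1 - R ^ 2 / S with ha
  have ha1 : a < 1 := by
    have : 0 < R ^ 2 / S := by positivity
    linarith
  have ha0 : 0 < a := by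
    have : R ^ 2 / S < 1 := (div_lt_one hS0).2 hRS
    linarith
  have haS : R ^ 2 / (1 - a) = S := by
    rw [ha, sub_sub_cancel, div_div_cancel₀ hR2.ne']
  have hgi := integrable_pow_mul_exp_radialMeasure (d := d) hα l ha0
  set F : ℂ → ℝ → ℂ := fun w τ => G (2 * w * τ) * ((τ ^ (2 * l) * Real.exp (-τ ^ 2) : ℝ) : ℂ)
    with hF
  have hFb : ∀ w τ, ‖F w τ‖ ≤
      c * Real.exp (S * w.im ^ 2) * (τ ^ (2 * l) * Real.exp (-(a * τ ^ 2))) := by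
    intro w τ
    have := norm_comp_mul_gauss_le hG l ha1 w τ
    rwa [haS] at this
  have hEd : Differentiable ℂ fun w => ∫ τ, F w τ ∂(radialMeasure d α) := by
    refine differentiable_integral_of_bound (fun w => ?_) (fun τ => ?_) fun r => ?_
    · exact ((hGd.continuous.comp (by fun_prop)).mul (by fun_prop)).aestronglyMeasurable
    · exact (hGd.comp (by fun_prop)).mul_const _
    · refine ⟨fun τ => c * Real.exp (S * r ^ 2) * (τ ^ (2 * l) * Real.exp (-(a * τ ^ 2))),
        hgi.const_mul _, fun w hw τ => (hFb w τ).trans ?_⟩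
      have hτ : 0 ≤ τ ^ (2 * l) := by
        rw [pow_mul]
        positivity
      have him : w.im ^ 2 ≤ r ^ 2 := by
        rw [← sq_abs]
        exact pow_le_pow_left₀ (abs_nonneg _) ((Complex.abs_im_le_norm w).trans hw.le) 2
      exact mul_le_mul_of_nonneg_right (mul_le_mul_of_nonneg_left (Real.exp_le_exp.2
        (mul_le_mul_of_nonneg_left him hS0.le)) hc) (mul_nonneg hτ (Real.exp_pos _).le)
  refine setIntegral_eq_zero_of_gaussAverage_bound (ρ := fun x : Space d => ‖x‖ ^ 2)
    (ψ := fun x => φ x * polyFun (heckePoly hα l P) x) (by fun_prop) (fun x => by positivity)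
    (fun n => ?_) hEd (fun w hw => ?_) hS0.le hST
    (C := c * ∫ τ, τ ^ (2 * l) * Real.exp (-(a * τ ^ 2)) ∂(radialMeasure d α)) fun w => ?_
  · refine (integrable_schwartz_mul_polyFun hα φ (normSqPoly d ^ n * heckePoly hα l P)).congr
      (Eventually.of_forall fun x => ?_)
    have : polyFun (normSqPoly d ^ n) x = (((‖x‖ ^ 2) ^ n : ℝ) : ℂ) := by
      have h := polyFun_normSqPoly x
      rw [polyFun] at h ⊢
      rw [map_pow, h]
      push_cast
      rfl
    simp only [polyFun_mul, this]
    ring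
  · rw [← integral_harmonicCoeff_mul_gauss hα φ hP hw]
    refine integral_congr_ae ?_
    filter_upwards [ae_pos_radialMeasure] with τ hτ
    simp only [hF]
    rw [← hGr _ (by positivity)]
    push_cast
    rfl
  · refine (norm_integral_le_of_norm_le (hgi.const_mul _)
      (Eventually.of_forall (hFb w))).trans (le_of_eq ?_)
    rw [integral_const_mul]
    ring

lemma eq_zero_of_entire_extension (hα : -1 / 2 < α) (φ : 𝓢(Space d, ℂ)) (hφ : EvenInLast φ)
    {R : ℝ} (hR : 0 < R)
    (h : ∀ l, ∀ P ∈ harmonicPoly d α l, ∃ G : ℂ → ℂ, Differentiable ℂ G ∧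
      (∀ r : ℝ, 0 < r → G r = harmonicCoeff α l P φ r) ∧
        ∃ c : ℝ, ∀ z : ℂ, ‖G z‖ ≤ c * Real.exp (R * |z.im|))
    {x : Space d} (hx : R ≤ ‖x‖) : φ x = 0 := by
  refine eq_zero_of_setIntegral_harmonic_eq_zero hα φ hφ hR (fun l Q hQ T hT => ?_) hx
  obtain ⟨P, hP, rfl⟩ := exists_heckePoly_eq hα hQ
  obtain ⟨G, hGd, hGr, c, hG⟩ := h l P hP
  exact setIntegral_heckePoly_eq_zero hα φ hP hR hGd hGr hG hT

end Weinstein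

end

noncomputable section

namespace Weinstein

/-! ### Entire extension of the spherical harmonic coefficients -/

open Filter Topology

variable {d : ℕ} {α : ℝ}

lemma integral_pow_mul_exp_radialMeasure_ne_zero (hα : -1 / 2 < α) (m : ℕ) :
    ∫ r, (r : ℂ) ^ m * (Real.exp (-r ^ 2) : ℝ) ∂(radialMeasure d α) ≠ 0 := by
  have hs : (-1 : ℝ) < (d : ℝ) + (2 * α + 1) + (m : ℝ) := by
    have : (0 : ℝ) ≤ d := Nat.cast_nonneg _
    have : (0 : ℝ) ≤ (m : ℝ) := Nat.cast_nonneg _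
    linarith
  have h : ∫ r, (r : ℂ) ^ m * (Real.exp (-r ^ 2) : ℝ) ∂(radialMeasure d α) =
      ((1 / 2 * Real.Gamma (((d : ℝ) + (2 * α + 1) + m + 1) / 2) : ℝ) : ℂ) := by
    rw [integral_radialMeasure, ← _root_.integral_rpow_mul_exp_neg_rpow two_pos hs,
      ← integral_complex_ofReal]
    refine setIntegral_congr_fun measurableSet_Ioi fun r hr => ?_
    have hr0 : 0 < r := hr
    rw [Real.rpow_add hr0 _ (m : ℝ), Real.rpow_natCast, Real.rpow_two]
    push_cast
    ring
  rw [h]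
  have : 0 < Real.Gamma (((d : ℝ) + (2 * α + 1) + m + 1) / 2) :=
    Real.Gamma_pos_of_pos (by linarith)
  exact_mod_cast (by positivity : 1 / 2 * Real.Gamma (((d : ℝ) + (2 * α + 1) + m + 1) / 2) ≠ 0)

lemma gaussIntegral_eq_mul_sphere (hα : -1 / 2 < α) {m : ℕ} {p : Poly d} (hp : p.IsHomogeneous m) :
    gaussIntegral hα p = (∫ r, (r : ℂ) ^ m * (Real.exp (-r ^ 2) : ℝ) ∂(radialMeasure d α)) *
      ∫ t : Metric.sphere (0 : Space d) 1, polyFun p t ∂(sphereMeasure d α) := by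
  rw [gaussIntegral_apply, integral_polar (integrable_polyFun_mul_gauss hα p),
    ← integral_mul_const]
  refine integral_congr_ae ?_
  filter_upwards [ae_pos_radialMeasure] with r hr
  rw [← integral_const_mul]
  refine integral_congr_ae (Eventually.of_forall fun t => ?_)
  simp only
  rw [polyFun_real_smul hp, gauss, norm_smul, mem_sphere_zero_iff_norm.1 t.2, mul_one,
    Real.norm_of_nonneg hr.le]
  push_cast
  ring

/-- For a homogeneous integrand the Gaussian integral is the spherical one times a nonzero radial
factor, so orthogonality passes to the sphere. -/
lemma sphere_integral_mul_harmonic_eq_zero (hα : -1 / 2 < α) {k l : ℕ} (hkl : k < l)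
    {p P : Poly d} (hp : p ∈ evenHom d k) (hP : P ∈ harmonicPoly d α l) :
    ∫ t : Metric.sphere (0 : Space d) 1, polyFun p t * polyFun P t ∂(sphereMeasure d α) = 0 := by
  have h := gaussIntegral_mul_harmonic_eq_zero hα hkl hp hP
  rw [gaussIntegral_eq_mul_sphere hα (hp.1.mul hP.1.1)] at h
  simpa only [polyFun_mul] using
    (mul_eq_zero.1 h).resolve_left (integral_pow_mul_exp_radialMeasure_ne_zero hα _)

lemma norm_kernel_sub_sum_le (hα : -1 / 2 < α) {z : ℂ} (hz : ‖z‖ ≤ 1) (x t : Space d) (l : ℕ) :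
    ‖kernel α (fun j => z * t j) x - ∑ k ∈ Finset.range l, z ^ k * polyFun (kernelPoly α x k) t‖ ≤
      ‖z‖ ^ l * Real.exp ((d + 1) * ‖x‖ * ‖t‖) := by
  set A : ℝ := (d + 1) * ‖x‖ * ‖t‖ with hA
  have hA0 : 0 ≤ A := by positivity
  have h1 := (hasSum_nat_add_iff' l).2 (hasSum_kernelPoly hα z x t)
  have h2 : HasSum (fun k => A ^ k / (k.factorial : ℝ)) (Real.exp A) := by
    rw [Real.exp_eq_exp_ℝ]
    exact NormedSpace.expSeries_div_hasSum_exp A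
  have h3 := ((hasSum_nat_add_iff' l).2 h2).mul_left (‖z‖ ^ l)
  refine (h1.norm_le_of_bounded h3 fun k => ?_).trans ?_
  · rw [norm_mul, norm_pow, pow_add, mul_comm (‖z‖ ^ k), mul_assoc]
    refine mul_le_mul_of_nonneg_left ?_ (by positivity)
    exact (mul_le_of_le_one_left (norm_nonneg _) (pow_le_one₀ (norm_nonneg _) hz)).trans
      (norm_polyFun_kernelPoly_le hα x t _)
  · refine mul_le_mul_of_nonneg_left ?_ (by positivity)
    have : 0 ≤ ∑ i ∈ Finset.range l, A ^ i / (i.factorial : ℝ) :=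
      Finset.sum_nonneg fun i _ => by positivity
    linarith

lemma continuous_kernel_complex_mul (hα : -1 / 2 < α) {X : Type*} [TopologicalSpace X] (z : ℂ)
    {f g : X → Space d} (hf : Continuous f) (hg : Continuous g) :
    Continuous fun x => kernel α (fun j => z * (f x j : ℂ)) (g x) := by
  have h : Continuous fun x => ((fun j => z * (f x j : ℂ)) : Fin (d + 1) → ℂ) :=
    continuous_pi fun j => continuous_const.mul (Complex.continuous_ofReal.comp
      ((continuous_coord (d := d) j).comp hf))
  have h2 := (continuous_kernel (d := d) hα).comp (h.prodMk hg)
  exact h2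

lemma integrable_sphere_of_continuous (hα : -1 / 2 < α)
    {g : Metric.sphere (0 : Space d) 1 → ℂ} (hg : Continuous g) :
    Integrable g (sphereMeasure d α) :=
  have := isFiniteMeasure_sphereMeasure d hα
  hg.integrable_of_hasCompactSupport (HasCompactSupport.of_compactSpace g)

/-- Orthogonality allows the kernel terms of degree below l to be subtracted for free; the remaining
tail carries ‖z‖^l. This order of vanishing makes division by z^l possible. -/
lemma norm_sphere_integral_kernel_le (hα : -1 / 2 < α) {l : ℕ} {P : Poly d}
    (hP : P ∈ harmonicPoly d α l) {z : ℂ} (hz : ‖z‖ ≤ 1) (x : Space d) :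
    ‖∫ t : Metric.sphere (0 : Space d) 1, kernel α (fun j => z * (t : Space d) j) x * polyFun P t
        ∂(sphereMeasure d α)‖ ≤
      ‖z‖ ^ l * Real.exp ((d + 1) * ‖x‖) *
        ∫ t : Metric.sphere (0 : Space d) 1, ‖polyFun P t‖ ∂(sphereMeasure d α) := by
  have hpc : ∀ p : Poly d, Continuous fun t : Metric.sphere (0 : Space d) 1 => polyFun p t :=
    fun p => (continuous_polyFun p).comp continuous_subtype_val
  have hi1 : Integrable (fun t : Metric.sphere (0 : Space d) 1 =>
      kernel α (fun j => z * (t : Space d) j) x * polyFun P t) (sphereMeasure d α) :=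
    integrable_sphere_of_continuous hα
      ((continuous_kernel_complex_mul hα z continuous_subtype_val continuous_const).mul (hpc P))
  have hi2 : ∀ k ∈ Finset.range l, Integrable (fun t : Metric.sphere (0 : Space d) 1 =>
      z ^ k * (polyFun (kernelPoly α x k) t * polyFun P t)) (sphereMeasure d α) := fun k _ =>
    (integrable_sphere_of_continuous hα ((hpc _).mul (hpc P))).const_mul _
  have h0 : ∫ t : Metric.sphere (0 : Space d) 1, ∑ k ∈ Finset.range l,
      z ^ k * (polyFun (kernelPoly α x k) t * polyFun P t) ∂(sphereMeasure d α) = 0 := by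
    rw [integral_finsetSum _ hi2]
    refine Finset.sum_eq_zero fun k hk => ?_
    rw [integral_const_mul, sphere_integral_mul_harmonic_eq_zero hα (Finset.mem_range.1 hk)
      (kernelPoly_mem_evenHom x k) hP, mul_zero]
  rw [← sub_zero (∫ t, _ ∂_), ← h0, ← integral_sub hi1 (integrable_finsetSum _ hi2),
    ← integral_const_mul]
  refine norm_integral_le_of_norm_le
    ((integrable_sphere_of_continuous hα (hpc P)).norm.const_mul _)
    (Eventually.of_forall fun t => ?_)
  have h1 := norm_kernel_sub_sum_le hα hz x t l
  rw [mem_sphere_zero_iff_norm.1 t.2, mul_one] at h1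
  have h2 : kernel α (fun j => z * (t : Space d) j) x * polyFun P t -
      ∑ k ∈ Finset.range l, z ^ k * (polyFun (kernelPoly α x k) t * polyFun P t) =
      (kernel α (fun j => z * (t : Space d) j) x -
        ∑ k ∈ Finset.range l, z ^ k * polyFun (kernelPoly α x k) t) * polyFun P t := by
    rw [sub_mul, Finset.sum_mul]
    simp only [mul_assoc]
  rw [h2, norm_mul]
  exact mul_le_mul_of_nonneg_right h1 (norm_nonneg _)

lemma exists_differentiable_eq_div_pow {g : ℂ → ℂ} (hg : Differentiable ℂ g) {l : ℕ} {C : ℝ}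
    (h : ∀ z, ‖z‖ ≤ 1 → ‖g z‖ ≤ C * ‖z‖ ^ l) :
    ∃ G : ℂ → ℂ, Differentiable ℂ G ∧ ∀ z, z ≠ 0 → G z = g z / z ^ l := by
  set f : ℂ → ℂ := fun z => g z / z ^ l with hf
  have hfd : ∀ z, z ≠ 0 → DifferentiableAt ℂ f z := fun z hz =>
    (hg z).div (differentiableAt_pow l) (pow_ne_zero _ hz)
  refine ⟨Function.update f 0 (limUnder (𝓝[≠] 0) f), fun z => ?_, fun z hz =>
    Function.update_of_ne hz _ _⟩
  by_cases hz : z = 0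
  · subst hz
    refine (Complex.differentiableOn_update_limUnder_of_bddAbove
      (Metric.ball_mem_nhds (0 : ℂ) one_pos) (fun w hw => (hfd w hw.2).differentiableWithinAt)
      ⟨C, ?_⟩).differentiableAt (Metric.ball_mem_nhds (0 : ℂ) one_pos)
    rintro _ ⟨w, ⟨hw, hw0⟩, rfl⟩
    have hw0' : 0 < ‖w‖ := norm_pos_iff.2 hw0
    simp only [Function.comp_apply, hf, norm_div, norm_pow]
    rw [div_le_iff₀ (by positivity)]
    exact h w (mem_ball_zero_iff.1 hw).le
  · refine (hfd z hz).congr_of_eventuallyEq ?_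
    filter_upwards [isOpen_ne.mem_nhds hz] with w hw
    exact Function.update_of_ne hw _ _

lemma exists_entire_extension (hα : -1 / 2 < α) (φ : 𝓢(Space d, ℂ)) {R : ℝ} (hR : 0 < R)
    (hφ : ∀ x, R ≤ ‖x‖ → φ x = 0) {l : ℕ} {P : Poly d} (hP : P ∈ harmonicPoly d α l) :
    ∃ G : ℂ → ℂ, Differentiable ℂ G ∧
      (∀ r : ℝ, 0 < r → G r = harmonicCoeff α l P φ r) ∧
        ∃ c : ℝ, ∀ z : ℂ, ‖G z‖ ≤ c * Real.exp (R * |z.im|) := by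
  set ν := (weightedMeasure d α).prod (sphereMeasure d α) with hν
  set F : ℂ → Space d × Metric.sphere (0 : Space d) 1 → ℂ := fun z p =>
    φ p.1 * (kernel α (fun j => z * (p.2 : Space d) j) p.1 * polyFun P p.2) with hF
  set B : Space d × Metric.sphere (0 : Space d) 1 → ℝ := fun p => ‖φ p.1‖ * ‖polyFun P p.2‖ with hB
  have hPi : Integrable (fun t : Metric.sphere (0 : Space d) 1 => polyFun P t)
      (sphereMeasure d α) :=
    integrable_sphere_of_continuous hα ((continuous_polyFun P).comp continuous_subtype_val)
  have hBi : Integrable B ν := (integrable_schwartz hα φ).norm.mul_prod hPi.norm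
  have hFc : ∀ z, Continuous (F z) := fun z =>
    (φ.continuous.comp continuous_fst).mul ((continuous_kernel_complex_mul hα z
      (continuous_subtype_val.comp continuous_snd) continuous_fst).mul
        ((continuous_polyFun P).comp (continuous_subtype_val.comp continuous_snd)))
  have hFb : ∀ z p, ‖F z p‖ ≤ B p * Real.exp (R * |z.im|) := by
    intro z p
    rcases le_or_gt R ‖p.1‖ with h | h
    · simp only [hF, hB, hφ p.1 h, zero_mul, norm_zero]
      exact le_rfl
    · have h1 := norm_kernel_le hα z p.1 (p.2 : Space d)
      rw [mem_sphere_zero_iff_norm.1 p.2.2, mul_one] at h1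
      have h2 : Real.exp (‖p.1‖ * |z.im|) ≤ Real.exp (R * |z.im|) :=
        Real.exp_le_exp.2 (mul_le_mul_of_nonneg_right h.le (abs_nonneg _))
      simp only [hF, hB]
      rw [norm_mul, norm_mul, mul_assoc, mul_comm ‖polyFun P _‖]
      exact mul_le_mul_of_nonneg_left (mul_le_mul_of_nonneg_right (h1.trans h2) (norm_nonneg _))
        (norm_nonneg _)
  have hFi : ∀ z, Integrable (F z) ν := fun z =>
    (hBi.mul_const _).mono' (hFc z).aestronglyMeasurable (Eventually.of_forall (hFb z))
  set g : ℂ → ℂ := fun z => ∫ p, F z p ∂ν with hg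
  have hgd : Differentiable ℂ g := by
    refine differentiable_integral_of_bound (fun z => (hFc z).aestronglyMeasurable) (fun p => ?_)
      fun r => ⟨fun p => B p * Real.exp (R * r), hBi.mul_const _, fun z hz p =>
        (hFb z p).trans ?_⟩
    · exact ((differentiable_kernel hα p.1 (p.2 : Space d)).mul_const _).const_mul _
    · have h1 : |z.im| ≤ r := (Complex.abs_im_le_norm z).trans hz.le
      refine mul_le_mul_of_nonneg_left (Real.exp_le_exp.2
        (mul_le_mul_of_nonneg_left h1 hR.le)) (mul_nonneg (norm_nonneg _) (norm_nonneg _))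
  set M : ℝ := ∫ p, B p ∂ν with hM
  have hM0 : 0 ≤ M := integral_nonneg fun p => mul_nonneg (norm_nonneg _) (norm_nonneg _)
  have hgb : ∀ z, ‖g z‖ ≤ M * Real.exp (R * |z.im|) := by
    intro z
    rw [hM, ← integral_mul_const]
    exact norm_integral_le_of_norm_le (hBi.mul_const _) (Eventually.of_forall (hFb z))
  set N : ℝ := ∫ t : Metric.sphere (0 : Space d) 1, ‖polyFun P t‖ ∂(sphereMeasure d α) with hN
  have hN0 : 0 ≤ N := integral_nonneg fun t => norm_nonneg _
  set C : ℝ := (∫ x, ‖φ x‖ ∂(weightedMeasure d α)) * (Real.exp ((d + 1) * R) * N) with hC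
  have hC0 : 0 ≤ C := mul_nonneg (integral_nonneg fun x => norm_nonneg _)
    (mul_nonneg (Real.exp_pos _).le hN0)
  have hgs : ∀ z, ‖z‖ ≤ 1 → ‖g z‖ ≤ C * ‖z‖ ^ l := by
    intro z hz
    have h1 : g z = ∫ x, φ x * ∫ t : Metric.sphere (0 : Space d) 1,
        kernel α (fun j => z * (t : Space d) j) x * polyFun P t ∂(sphereMeasure d α)
          ∂(weightedMeasure d α) := by
      simp only [hg]
      rw [hν, integral_prod _ (hFi z)]
      simp only [hF, integral_const_mul]
    rw [h1, hC, mul_assoc, ← integral_mul_const]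
    refine norm_integral_le_of_norm_le ((integrable_schwartz hα φ).norm.mul_const _)
      (Eventually.of_forall fun x => ?_)
    rw [norm_mul]
    rcases le_or_gt R ‖x‖ with h | h
    · rw [hφ x h, norm_zero, zero_mul, zero_mul]
    · refine mul_le_mul_of_nonneg_left ((norm_sphere_integral_kernel_le hα hP hz x).trans ?_)
        (norm_nonneg _)
      rw [mul_assoc, mul_comm (_ * N)]
      gcongr
  obtain ⟨G, hGd, hG⟩ := exists_differentiable_eq_div_pow hgd hgs
  -- The summands cover three regimes: M for ‖z‖ ≥ 1, where dividing by z^l only helps; C for 0 <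
  -- ‖z‖ ≤ 1, by the vanishing order; and ‖G 0‖ for z = 0.
  refine ⟨G, hGd, fun r hr => ?_, M + C + ‖G 0‖, fun z => ?_⟩
  · rw [hG _ (by exact_mod_cast hr.ne'), harmonicCoeff, div_eq_inv_mul]
    congr 1
    simp only [hg]
    rw [hν, integral_prod_symm _ (hFi r)]
    refine integral_congr_ae (Eventually.of_forall fun t => ?_)
    simp only [hF, transform]
    rw [← integral_mul_const]
    refine integral_congr_ae (Eventually.of_forall fun x => ?_)
    simp [mul_assoc]
  · have h1 : 1 ≤ Real.exp (R * |z.im|) := Real.one_le_exp (by positivity)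
    have hG0 := norm_nonneg (G 0)
    by_cases hz : z = 0
    · subst hz
      nlinarith
    · have hzn : 0 < ‖z‖ := norm_pos_iff.2 hz
      rw [hG z hz, norm_div, norm_pow, div_le_iff₀ (by positivity)]
      rcases le_total ‖z‖ 1 with h | h
      · refine (hgs z h).trans (mul_le_mul_of_nonneg_right ?_ (by positivity))
        nlinarith
      · refine (hgb z).trans ((mul_le_mul_of_nonneg_right (by linarith :
          M ≤ M + C + ‖G 0‖) (Real.exp_pos _).le).trans
            (le_mul_of_one_le_right ?_ (one_le_pow₀ h)))
        positivity

end Weinstein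

end

/-! ### The Paley–Wiener theorem -/

theorem mainTheorem2 (d : ℕ) (hd : 1 ≤ d) (α : ℝ) (hα : -1 / 2 < α)
    (φ : 𝓢(Weinstein.Space d, ℂ)) (hφ : Weinstein.EvenInLast φ) (R : ℝ) (hR : 0 < R) :
    Function.support φ ⊆ {x : Weinstein.Space d | ‖x‖ < R} ↔
      ∀ (l : ℕ), ∀ P ∈ Weinstein.sphericalHarmonics d α l,
        ∃ G : ℂ → ℂ, Differentiable ℂ G ∧
          (∀ r : ℝ, 0 < r → G r = Weinstein.harmonicCoeff α l P φ r) ∧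
          ∃ c : ℝ, ∀ z : ℂ, ‖G z‖ ≤ c * Real.exp (R * |z.im|) := by
  constructor
  · intro hs l P hP
    refine Weinstein.exists_entire_extension hα φ hR (fun x hx => ?_)
      (Weinstein.mem_sphericalHarmonics_iff.1 hP)
    by_contra hne
    exact absurd (hs hne) (not_lt.2 hx)
  · intro h x hx
    by_contra hlt
    exact hx (Weinstein.eq_zero_of_entire_extension hα φ hφ hR
      (fun l P hP => h l P (Weinstein.mem_sphericalHarmonics_iff.2 hP)) (not_lt.1 hlt))
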